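/- Let $p$ be a prime, let $K=\widehat{\mathbb{Q}_p^{ur}}\subset\mathbb{C}_p$ be the closure of the maximal unramified extension of $\mathbb{Q}_p$, and let $\mathcal{H}_p$ be the $p$-adic upper half plane, with $\mathcal{H}_p(\mathbb{C}_p)=\mathbb{C}_p\setminus\mathbb{Q}_p$ and structure sheaf $\mathcal{O}$ (over $K$). Let $\Gamma\subset\mathrm{SL}_2(\mathbb{Q}_p)$ be a discrete cocompact subgroup, let $k\ge 4$ be even and put $n=k-2$. Let $\mathcal{P}_n$ be the space of polynomials of degree $\le n$ over $\mathbb{Q}_p$ with the right action $(P\cdot A)(X)=(cX+d)^nP\left(\frac{aX+b}{cX+d}\right)$ for $A=\begin{pmatrix}a&b\\c&d\end{pmatrix}$, and let $V_n=\mathrm{Hom}_{\mathbb{Q}_p}(\mathcal{P}_n,\mathbb{Q}_p)$ with the dual left action. Let $\mathcal{V}_n=V_n\otimes_{\mathbb{Q}_p}\mathcal{O}$ with connection $\nabla=1\otimes d$. On $V_1\otimes\mathcal{O}$ put $F^j=V_1\otimes\mathcal{O}$ for $j\le 0$, $F^j=0$ for $j\ge 2$, and let $F^1$ be the kernel of $R\otimes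 f\mapsto (z\mapsto (R(X)-zR(1))f(z))$; give $V_1^{\otimes n}\otimes\mathcal{O}$ the tensor product filtration and $\mathcal{V}_n$ the induced filtration $F^\bullet\mathcal{V}_n$ via the equivariant embedding $V_n\hookrightarrow V_1^{\otimes n}$ dual to multiplication of polynomials. Let $\Gamma'\subseteq\Gamma$ be a free normal subgroup of finite index. Then $\mathcal{V}_n$, with its connection and filtration, descends to $X_{\Gamma'}=\Gamma'\backslash\mathcal{H}_p$, and $H^1_{DR}(X_{\Gamma'},\mathcal{V}_n)$ is the first hypercohomology of $\mathcal{V}_n\xrightarrow{\nabla}\mathcal{V}_n\otimes\Omega^1$ on $X_{\Gamma'}$, with Hodge filtration $$F^iH^1_{DR}(X_{\Gamma'},\mathcal{V}_n)=\mathrm{Im}\left(H^1(X_{\Gamma'},F^i\mathcal{V}_n\xrightarrow{\nabla}F^{i-1}\mathcal{V}_n\otimes\Omega^1)\to H^1_{DR}(X_{\Gamma'},\mathcal{V}_n)\right).$$ (As $\mathcal{H}_p$ is a Stein space on which $\Gamma'$ acts freely, these hypercohomology groups are computed by the $\Gamma'$-cochains with values in the global sections of the complexes on $\mathcal{H}_p$.)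 Put $H^1_{DR}(X_\Gamma,\mathcal{V}_n)=H^1_{DR}(X_{\Gamma'},\mathcal{V}_n)^{\Gamma/\Gamma'}$ with the induced filtration. Let $M_k(\Gamma)$ be the $K$-vector space of rigid analytic functions $f$ on $\mathcal{H}_p$ defined over $K$ with $f(\gamma z)=(cz+d)^kf(z)$ for all $\gamma=\begin{pmatrix}a&b\\c&d\end{pmatrix}\in\Gamma$, and let $\partial^0(z)\in V_n\otimes\mathbb{C}_p$ be $P\mapsto P(z)$. Then the map $M_k(\Gamma)\to H^1_{DR}(X_\Gamma,\mathcal{V}_n)$ sending $f$ to the class of $f(z)\,\partial^0\otimes dz$ is injective, and, identifying $M_k(\Gamma)$ with its image, $$F^iH^1_{DR}(X_\Gamma,\mathcal{V}_n)=\begin{cases}H^1_{DR}(X_\Gamma,\mathcal{V}_n)&\text{if } i\le 0,\\ M_k(\Gamma)&\text{if } 1\le i\le k-1,\\ 0&\text{if } i\ge k.\end{cases}$$ -/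

import Mathlib

open Polynomial
open scoped MatrixGroups

noncomputable section

namespace PadicHodge

variable (p : ℕ) [Fact p.Prime]

/-! ### The coefficient field and rigid analytic functions on the `p`-adic upper half plane -/

/-- The closure `K` in `ℂ_p` of the maximal unramified extension of `ℚ_p`, the latter being
generated by the roots of unity of order prime to `p`. -/
def QpUr : Subfield ℂ_[p] :=
  (IntermediateField.adjoin ℚ_[p]
    {ζ : ℂ_[p] | ∃ m : ℕ, 0 < m ∧ ¬ p ∣ m ∧ ζ ^ m = 1}).toSubfield.topologicalClosure

/-- The `ℂ_p`-valued points `ℂ_p ∖ ℚ_p` of the `p`-adic upper half plane `H_p`. -/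
def Hp : Type := {z : ℂ_[p] // z ∉ Set.range (algebraMap ℚ_[p] ℂ_[p])}

variable {p}

/-- The coordinate `z` on `H_p`. -/
def Hp.val (z : Hp p) : ℂ_[p] := Subtype.val z

variable (p) in
/-- The standard increasing affinoid exhaustion of `H_p`: the points at distance at most `p ^ N`
from `0` and at least `p ^ (-N)` from every point of `ℚ_p`. -/
def affinoid (N : ℕ) : Set (Hp p) :=
  {z | ‖z.val‖ ≤ (p : ℝ) ^ N ∧
    ∀ a : ℚ_[p], ((p : ℝ) ^ N)⁻¹ ≤ ‖z.val - algebraMap ℚ_[p] ℂ_[p] a‖}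

/-- The value at `z` of a polynomial with coefficients in `K`. -/
def evalK (P : (QpUr p)[X]) (z : Hp p) : ℂ_[p] := P.eval₂ (QpUr p).subtype z.val

/-- Rigid analytic functions on `H_p` defined over `K`: on every affinoid of the exhaustion the
function is a uniform limit of rational functions with coefficients in `K` and without poles on
that affinoid. -/
def IsRigidAnalytic (f : Hp p → ℂ_[p]) : Prop :=
  ∀ N : ℕ, ∀ ε : ℝ, 0 < ε → ∃ P Q : (QpUr p)[X],
    (∀ z ∈ affinoid p N, evalK Q z ≠ 0) ∧
    ∀ z ∈ affinoid p N, ‖f z - evalK P z / evalK Q z‖ ≤ ε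

theorem exists_lower_bound (N : ℕ) (Q : (QpUr p)[X])
    (hQ : ∀ z ∈ affinoid p N, evalK Q z ≠ 0) :
    ∃ δ : ℝ, 0 < δ ∧ ∀ z ∈ affinoid p N, δ ≤ ‖evalK Q z‖ := by
  have hp0 : (0 : ℝ) < (p : ℝ) ^ N := by
    have := (Fact.out : p.Prime).pos
    positivity
  by_cases hne : (affinoid p N).Nonempty
  swap
  · exact ⟨1, one_pos, fun z hz => (hne ⟨z, hz⟩).elim⟩
  obtain ⟨z₀, hz₀⟩ := hne
  set R : ℂ_[p][X] := Q.map (QpUr p).subtype with hR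
  have hev : ∀ z : Hp p, evalK Q z = R.eval z.val := fun z => by
    rw [hR, eval_map]; rfl
  have hprod : ∀ w : ℂ_[p], R.eval w = R.leadingCoeff * (R.roots.map fun a => w - a).prod := by
    intro w
    conv_lhs => rw [(IsAlgClosed.splits R).eq_prod_roots]
    rw [eval_mul, eval_C, eval_multiset_prod, Multiset.map_map]
    simp
  have hR0 : R ≠ 0 := by
    intro h
    exact hQ z₀ hz₀ (by rw [hev, h, eval_zero])
  have hroot : ∀ a ∈ R.roots, ∃ δ : ℝ, 0 < δ ∧ ∀ z ∈ affinoid p N, δ ≤ ‖z.val - a‖ := by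
    intro a ha
    have ha0 : R.eval a = 0 := (mem_roots'.1 ha).2
    by_cases h1 : ‖a‖ ≤ (p : ℝ) ^ N
    · by_cases h2 : ∀ b : ℚ_[p], ((p : ℝ) ^ N)⁻¹ ≤ ‖a - algebraMap ℚ_[p] ℂ_[p] b‖
      · have hmem : a ∉ Set.range (algebraMap ℚ_[p] ℂ_[p]) := by
          rintro ⟨b, rfl⟩
          have := h2 b
          rw [sub_self, norm_zero] at this
          exact absurd this (not_le.2 (inv_pos.2 hp0))
        exact absurd ((hev ⟨a, hmem⟩).trans ha0) (hQ ⟨a, hmem⟩ ⟨h1, h2⟩)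
      · push Not at h2
        obtain ⟨b, hb⟩ := h2
        refine ⟨((p : ℝ) ^ N)⁻¹, inv_pos.2 hp0, fun z hz => ?_⟩
        have h3 := hz.2 b
        have h4 : z.val - algebraMap ℚ_[p] ℂ_[p] b =
            (z.val - a) + (a - algebraMap ℚ_[p] ℂ_[p] b) := by ring
        rw [h4] at h3
        rcases le_max_iff.1 (h3.trans (PadicComplex.isNonarchimedean p _ _)) with h | h
        · exact h
        · exact absurd h (not_le.2 hb)
    · push Not at h1
      refine ⟨‖a‖ - (p : ℝ) ^ N, sub_pos.2 h1, fun z hz => ?_⟩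
      have := norm_sub_norm_le a z.val
      rw [norm_sub_rev] at this
      linarith [hz.1]
  have hmul : ∀ s : Multiset ℂ_[p],
      (∀ a ∈ s, ∃ δ : ℝ, 0 < δ ∧ ∀ z ∈ affinoid p N, δ ≤ ‖z.val - a‖) →
      ∃ δ : ℝ, 0 < δ ∧ ∀ z ∈ affinoid p N, δ ≤ ‖(s.map fun a => z.val - a).prod‖ := by
    intro s
    induction s using Multiset.induction_on with
    | empty => intro _; exact ⟨1, one_pos, fun z _ => by simp⟩
    | cons a s ih =>
      intro h
      obtain ⟨δ₁, h₁, h₁'⟩ := h a (Multiset.mem_cons_self a s)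
      obtain ⟨δ₂, h₂, h₂'⟩ := ih fun b hb => h b (Multiset.mem_cons_of_mem hb)
      refine ⟨δ₁ * δ₂, mul_pos h₁ h₂, fun z hz => ?_⟩
      rw [Multiset.map_cons, Multiset.prod_cons, norm_mul]
      exact mul_le_mul (h₁' z hz) (h₂' z hz) h₂.le (norm_nonneg _)
  obtain ⟨δ, hδ, hδ'⟩ := hmul R.roots hroot
  refine ⟨‖R.leadingCoeff‖ * δ, mul_pos (norm_pos_iff.2 (leadingCoeff_ne_zero.2 hR0)) hδ,
    fun z hz => ?_⟩
  rw [hev, hprod, norm_mul]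
  exact mul_le_mul_of_nonneg_left (hδ' z hz) (norm_nonneg _)

theorem exists_upper_bound_poly (N : ℕ) (P : (QpUr p)[X]) :
    ∃ C : ℝ, ∀ z ∈ affinoid p N, ‖evalK P z‖ ≤ C := by
  induction P using Polynomial.induction_on' with
  | add P Q hP hQ =>
    obtain ⟨C, hC⟩ := hP
    obtain ⟨D, hD⟩ := hQ
    refine ⟨C + D, fun z hz => ?_⟩
    rw [evalK, eval₂_add]
    exact (norm_add_le _ _).trans (add_le_add (hC z hz) (hD z hz))
  | monomial n a =>
    refine ⟨‖(a : ℂ_[p])‖ * ((p : ℝ) ^ N) ^ n, fun z hz => ?_⟩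
    rw [evalK, eval₂_monomial, norm_mul, norm_pow]
    exact mul_le_mul_of_nonneg_left (pow_le_pow_left₀ (norm_nonneg _) hz.1 n) (norm_nonneg _)

theorem exists_upper_bound (N : ℕ) (P Q : (QpUr p)[X])
    (hQ : ∀ z ∈ affinoid p N, evalK Q z ≠ 0) :
    ∃ C : ℝ, 0 < C ∧ ∀ z ∈ affinoid p N, ‖evalK P z / evalK Q z‖ ≤ C := by
  obtain ⟨C, hC⟩ := exists_upper_bound_poly N P
  obtain ⟨δ, hδ, hδ'⟩ := exists_lower_bound N Q hQ
  refine ⟨|C| / δ + 1, by positivity, fun z hz => ?_⟩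
  rw [norm_div]
  have : ‖evalK P z‖ / ‖evalK Q z‖ ≤ |C| / δ :=
    div_le_div₀ (abs_nonneg _) ((hC z hz).trans (le_abs_self _)) hδ (hδ' z hz)
  linarith

theorem IsRigidAnalytic.mul {f g : Hp p → ℂ_[p]} (hf : IsRigidAnalytic f)
    (hg : IsRigidAnalytic g) : IsRigidAnalytic (f * g) := by
  intro N ε hε
  obtain ⟨P₀, Q₀, hQ₀, h₀⟩ := hf N 1 one_pos
  obtain ⟨C, hC, hC'⟩ := exists_upper_bound N P₀ Q₀ hQ₀
  have hfb : ∀ z ∈ affinoid p N, ‖f z‖ ≤ 1 + C := fun z hz => by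
    have := norm_add_le (f z - evalK P₀ z / evalK Q₀ z) (evalK P₀ z / evalK Q₀ z)
    rw [sub_add_cancel] at this
    linarith [h₀ z hz, hC' z hz]
  obtain ⟨P₂, Q₂, hQ₂, h₂⟩ := hg N (ε / (2 * (1 + C))) (by positivity)
  obtain ⟨D, hD, hD'⟩ := exists_upper_bound N P₂ Q₂ hQ₂
  obtain ⟨P₁, Q₁, hQ₁, h₁⟩ := hf N (ε / (2 * D)) (by positivity)
  refine ⟨P₁ * P₂, Q₁ * Q₂, fun z hz => ?_, fun z hz => ?_⟩
  · rw [evalK, eval₂_mul]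
    exact mul_ne_zero (hQ₁ z hz) (hQ₂ z hz)
  · have e : (f * g) z - evalK (P₁ * P₂) z / evalK (Q₁ * Q₂) z =
        f z * (g z - evalK P₂ z / evalK Q₂ z) +
          (f z - evalK P₁ z / evalK Q₁ z) * (evalK P₂ z / evalK Q₂ z) := by
      have : evalK (P₁ * P₂) z / evalK (Q₁ * Q₂) z =
          (evalK P₁ z / evalK Q₁ z) * (evalK P₂ z / evalK Q₂ z) := by
        simp only [evalK, eval₂_mul]
        rw [mul_div_mul_comm]
      rw [this, Pi.mul_apply]
      ring
    rw [e]
    refine (norm_add_le _ _).trans ?_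
    rw [norm_mul, norm_mul]
    have a1 : ‖f z‖ * ‖g z - evalK P₂ z / evalK Q₂ z‖ ≤ (1 + C) * (ε / (2 * (1 + C))) :=
      mul_le_mul (hfb z hz) (h₂ z hz) (norm_nonneg _) (by positivity)
    have a2 : ‖f z - evalK P₁ z / evalK Q₁ z‖ * ‖evalK P₂ z / evalK Q₂ z‖ ≤ ε / (2 * D) * D :=
      mul_le_mul (h₁ z hz) (hD' z hz) (norm_nonneg _) (by positivity)
    have b1 : (1 + C) * (ε / (2 * (1 + C))) = ε / 2 := by field_simp
    have b2 : ε / (2 * D) * D = ε / 2 := by field_simp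
    linarith

theorem IsRigidAnalytic.add {f g : Hp p → ℂ_[p]} (hf : IsRigidAnalytic f)
    (hg : IsRigidAnalytic g) : IsRigidAnalytic (f + g) := by
  intro N ε hε
  obtain ⟨P₁, Q₁, hQ₁, h₁⟩ := hf N (ε / 2) (by positivity)
  obtain ⟨P₂, Q₂, hQ₂, h₂⟩ := hg N (ε / 2) (by positivity)
  refine ⟨P₁ * Q₂ + Q₁ * P₂, Q₁ * Q₂, fun z hz => ?_, fun z hz => ?_⟩
  · rw [evalK, eval₂_mul]
    exact mul_ne_zero (hQ₁ z hz) (hQ₂ z hz)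
  · have e : (f + g) z - evalK (P₁ * Q₂ + Q₁ * P₂) z / evalK (Q₁ * Q₂) z =
        (f z - evalK P₁ z / evalK Q₁ z) + (g z - evalK P₂ z / evalK Q₂ z) := by
      have : evalK (P₁ * Q₂ + Q₁ * P₂) z / evalK (Q₁ * Q₂) z =
          evalK P₁ z / evalK Q₁ z + evalK P₂ z / evalK Q₂ z := by
        rw [div_add_div _ _ (hQ₁ z hz) (hQ₂ z hz)]
        simp only [evalK, eval₂_mul, eval₂_add]
      rw [this, Pi.add_apply]
      ring
    rw [e]
    exact (norm_add_le _ _).trans (by linarith [h₁ z hz, h₂ z hz])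

theorem isRigidAnalytic_poly (P : (QpUr p)[X]) : IsRigidAnalytic (evalK P) := by
  intro N ε hε
  refine ⟨P, 1, fun z _ => by simp [evalK], fun z _ => ?_⟩
  have : evalK (1 : (QpUr p)[X]) z = 1 := by simp [evalK]
  rw [this, div_one, sub_self, norm_zero]
  exact hε.le

variable (p) in
/-- The `K`-algebra `𝒪(H_p)` of rigid analytic functions on `H_p` defined over `K`. -/
def rigid : Subalgebra (QpUr p) (Hp p → ℂ_[p]) where
  carrier := {f | IsRigidAnalytic f}
  mul_mem' := IsRigidAnalytic.mul
  add_mem' := IsRigidAnalytic.add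
  algebraMap_mem' a := by
    have h : IsRigidAnalytic (evalK (C a) : Hp p → ℂ_[p]) := isRigidAnalytic_poly (C a)
    have e : algebraMap (QpUr p) (Hp p → ℂ_[p]) a = evalK (C a) := by
      funext z
      simp only [evalK, eval₂_C]
      rfl
    change IsRigidAnalytic (algebraMap (QpUr p) (Hp p → ℂ_[p]) a)
    rw [e]
    exact h

/-- Extension by zero to `ℂ_p` (used only to speak of derivatives at points of the open set
`H_p`). -/
def extendZero (f : Hp p → ℂ_[p]) : ℂ_[p] → ℂ_[p] :=
  Function.extend Hp.val f 0

theorem extendZero_add (f g : Hp p → ℂ_[p]) :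
    extendZero (f + g) = extendZero f + extendZero g := by
  simpa [extendZero] using Function.extend_add (Hp.val (p := p)) f g 0 0

theorem extendZero_smul (a : QpUr p) (f : Hp p → ℂ_[p]) :
    extendZero (a • f) = fun w => (a : ℂ_[p]) * extendZero f w := by
  have h := Function.extend_smul a (Hp.val (p := p)) f 0
  rw [smul_zero] at h
  exact h

theorem extendZero_zero : extendZero (0 : Hp p → ℂ_[p]) = 0 :=
  Function.extend_zero (Hp.val (p := p))

/-! ### The action of `SL_2(ℚ_p)` by linear fractional transformations -/

/-- The automorphy factor `c z + d`. -/
def denom (γ : SL(2, ℚ_[p])) (z : Hp p) : ℂ_[p] :=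
  algebraMap ℚ_[p] ℂ_[p] (γ 1 0) * z.val + algebraMap ℚ_[p] ℂ_[p] (γ 1 1)

/-- The numerator `a z + b`. -/
def num (γ : SL(2, ℚ_[p])) (z : Hp p) : ℂ_[p] :=
  algebraMap ℚ_[p] ℂ_[p] (γ 0 0) * z.val + algebraMap ℚ_[p] ℂ_[p] (γ 0 1)

theorem linear_ne_zero (c d : ℚ_[p]) (h : ¬ (c = 0 ∧ d = 0)) (z : Hp p) :
    algebraMap ℚ_[p] ℂ_[p] c * z.val + algebraMap ℚ_[p] ℂ_[p] d ≠ 0 := by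
  intro h0
  by_cases hc : c = 0
  · subst hc
    rw [map_zero, zero_mul, zero_add, map_eq_zero] at h0
    exact h ⟨rfl, h0⟩
  · apply z.2
    refine ⟨-d / c, ?_⟩
    have hc' : algebraMap ℚ_[p] ℂ_[p] c ≠ 0 := (_root_.map_ne_zero _).2 hc
    rw [map_div₀, map_neg, div_eq_iff hc']
    change _ = z.val * _
    linear_combination -h0

theorem det_eq (γ : SL(2, ℚ_[p])) : γ 0 0 * γ 1 1 - γ 0 1 * γ 1 0 = 1 := by
  have := γ.det_coe
  rwa [Matrix.det_fin_two] at this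

theorem denom_ne_zero (γ : SL(2, ℚ_[p])) (z : Hp p) : denom γ z ≠ 0 := by
  refine linear_ne_zero _ _ ?_ z
  rintro ⟨h1, h2⟩
  have := det_eq γ
  rw [h1, h2] at this
  simp at this

instance : SMul SL(2, ℚ_[p]) (Hp p) where
  smul γ z := ⟨num γ z / denom γ z, by
    rintro ⟨t, ht⟩
    have hd := denom_ne_zero γ z
    rw [eq_div_iff hd] at ht
    refine linear_ne_zero (γ 0 0 - t * γ 1 0) (γ 0 1 - t * γ 1 1) ?_ z ?_
    · rintro ⟨h1, h2⟩
      have := det_eq γ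
      have h3 : (0 : ℚ_[p]) = 1 := by
        linear_combination this - γ 1 1 * h1 + γ 1 0 * h2
      exact zero_ne_one h3
    · simp only [map_sub, map_mul]
      simp only [num, denom] at ht
      linear_combination -ht⟩

theorem smul_val (γ : SL(2, ℚ_[p])) (z : Hp p) : (γ • z).val = num γ z / denom γ z := rfl

theorem denom_mul (γ δ : SL(2, ℚ_[p])) (z : Hp p) :
    denom (γ * δ) z = denom γ (δ • z) * denom δ z := by
  have h := denom_ne_zero δ z
  have e : denom γ (δ • z) = algebraMap ℚ_[p] ℂ_[p] (γ 1 0) * (num δ z / denom δ z) +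
      algebraMap ℚ_[p] ℂ_[p] (γ 1 1) := rfl
  rw [e, add_mul, mul_assoc, div_mul_cancel₀ _ h]
  simp only [denom, num, Matrix.SpecialLinearGroup.coe_mul, Matrix.mul_apply, Fin.sum_univ_two,
    map_add, map_mul]
  ring

theorem num_mul (γ δ : SL(2, ℚ_[p])) (z : Hp p) :
    num (γ * δ) z = num γ (δ • z) * denom δ z := by
  have h := denom_ne_zero δ z
  have e : num γ (δ • z) = algebraMap ℚ_[p] ℂ_[p] (γ 0 0) * (num δ z / denom δ z) +
      algebraMap ℚ_[p] ℂ_[p] (γ 0 1) := rfl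
  rw [e, add_mul, mul_assoc, div_mul_cancel₀ _ h]
  simp only [denom, num, Matrix.SpecialLinearGroup.coe_mul, Matrix.mul_apply, Fin.sum_univ_two,
    map_add, map_mul]
  ring

/-- `SL_2(ℚ_p)` acts on `H_p` by `z ↦ (a z + b) / (c z + d)`. -/
instance : MulAction SL(2, ℚ_[p]) (Hp p) where
  one_smul z := by
    apply Subtype.ext
    change num 1 z / denom 1 z = z.val
    simp [num, denom]
  mul_smul γ δ z := by
    apply Subtype.ext
    change num (γ * δ) z / denom (γ * δ) z = num γ (δ • z) / denom γ (δ • z)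
    rw [num_mul, denom_mul, mul_div_mul_right _ _ (denom_ne_zero δ z)]

/-! ### The representations `V_n` and `V_n`-valued functions and differential forms on `H_p` -/

variable (p) in
/-- The space `𝒫_n` of polynomials of degree at most `n` over `ℚ_p`. -/
abbrev Poly (n : ℕ) : Submodule ℚ_[p] ℚ_[p][X] := degreeLE ℚ_[p] (n : WithBot ℕ)

/-- `(c X + d) ^ n * P ((a X + b) / (c X + d))`. -/
def polyActAux (n : ℕ) (γ : SL(2, ℚ_[p])) (P : ℚ_[p][X]) : ℚ_[p][X] :=
  ∑ i ∈ Finset.range (n + 1), C (P.coeff i) * (C (γ 0 0) * X + C (γ 0 1)) ^ i *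
    (C (γ 1 0) * X + C (γ 1 1)) ^ (n - i)

theorem polyActAux_mem (n : ℕ) (γ : SL(2, ℚ_[p])) (P : ℚ_[p][X]) :
    polyActAux n γ P ∈ Poly p n := by
  refine Submodule.sum_mem _ fun i hi => ?_
  rw [mem_degreeLE]
  have hi' : i ≤ n := Nat.lt_succ_iff.1 (Finset.mem_range.1 hi)
  apply degree_le_of_natDegree_le
  have l1 : ∀ a b : ℚ_[p], (C a * X + C b).natDegree ≤ 1 := fun a b => natDegree_linear_le
  have l2 : ∀ (a b : ℚ_[p]) (j : ℕ), ((C a * X + C b) ^ j).natDegree ≤ j := fun a b j =>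
    natDegree_pow_le.trans (by simpa using Nat.mul_le_mul_left j (l1 a b))
  refine natDegree_mul_le.trans ?_
  refine (Nat.add_le_add (natDegree_C_mul_le _ _) le_rfl).trans ?_
  have := l2 (γ 0 0) (γ 0 1) i
  have := l2 (γ 1 0) (γ 1 1) (n - i)
  omega

/-- The right action `P ↦ P · γ` of `γ ∈ SL_2(ℚ_p)` on `𝒫_n`,
`(P · γ)(X) = (c X + d) ^ n * P ((a X + b) / (c X + d))`. -/
def polyAct (n : ℕ) (γ : SL(2, ℚ_[p])) : Poly p n →ₗ[ℚ_[p]] Poly p n where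
  toFun P := ⟨polyActAux n γ P, polyActAux_mem n γ P⟩
  map_add' P Q := by
    apply Subtype.ext
    simp only [polyActAux, Submodule.coe_add, coeff_add, C_add, add_mul, Finset.sum_add_distrib]
  map_smul' a P := by
    apply Subtype.ext
    simp only [polyActAux, Submodule.coe_smul, coeff_smul, smul_eq_mul, C_mul, RingHom.id_apply,
      Finset.smul_sum]
    refine Finset.sum_congr rfl fun i _ => ?_
    rw [smul_eq_C_mul]
    ring

/-- The value at `z` of a polynomial with coefficients in `ℚ_p`. -/
def evalQ (P : ℚ_[p][X]) (z : Hp p) : ℂ_[p] := P.eval₂ (algebraMap ℚ_[p] ℂ_[p]) z.val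

theorem evalQ_polyAct (n : ℕ) (γ : SL(2, ℚ_[p])) (P : Poly p n) (z : Hp p) :
    evalQ (polyAct n γ P : ℚ_[p][X]) z = denom γ z ^ n * evalQ (P : ℚ_[p][X]) (γ • z) := by
  have hP : (P : ℚ_[p][X]).natDegree < n + 1 :=
    Nat.lt_succ_iff.2 (natDegree_le_of_degree_le (mem_degreeLE.1 P.2))
  have h := denom_ne_zero γ z
  rw [evalQ, evalQ, eval₂_eq_sum_range' _ hP]
  change (polyActAux n γ P).eval₂ _ _ = _
  rw [polyActAux, eval₂_finsetSum, Finset.mul_sum]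
  refine Finset.sum_congr rfl fun i hi => ?_
  have hi' : i ≤ n := Nat.lt_succ_iff.1 (Finset.mem_range.1 hi)
  simp only [eval₂_mul, eval₂_pow, eval₂_add, eval₂_C, eval₂_X]
  change _ * num γ z ^ i * denom γ z ^ (n - i) = _
  rw [smul_val, div_pow]
  have : denom γ z ^ n = denom γ z ^ i * denom γ z ^ (n - i) := by
    rw [← pow_add, Nat.add_sub_cancel' hi']
  rw [this]
  field_simp

variable (p) in
/-- The representation `V_n ⊗ ℂ_p`, where `V_n = Hom(𝒫_n, ℚ_p)`. -/
abbrev Vn (n : ℕ) : Type := Poly p n →ₗ[ℚ_[p]] ℂ_[p]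

instance (n : ℕ) : AddCommGroup (Vn p n) := inferInstance

instance (n : ℕ) : Module (QpUr p) (Vn p n) := inferInstance

/-- The left action of `γ` on `V_n ⊗ ℂ_p`: `(γ · R)(P) = R(P · γ)`. -/
def rho (n : ℕ) (γ : SL(2, ℚ_[p])) : Vn p n →ₗ[QpUr p] Vn p n where
  toFun R := R.comp (polyAct n γ)
  map_add' _ _ := rfl
  map_smul' _ _ := rfl

variable (p) in
/-- `V_n`-valued functions on `H_p`. The differential form `s ⊗ dz` is represented by its
coefficient `s`. -/
abbrev Sec (n : ℕ) : Type := Hp p → Vn p n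

variable (p) in
/-- The rigid analytic sections `V_n ⊗ 𝒪(H_p)`. -/
def anSec (n : ℕ) : Submodule (QpUr p) (Sec p n) where
  carrier := {s | ∀ P : Poly p n, (fun z => s z P) ∈ rigid p}
  add_mem' hs ht P := (rigid p).add_mem (hs P) (ht P)
  zero_mem' _ := (rigid p).zero_mem
  smul_mem' a _ hs P := (rigid p).smul_mem (hs P) a

/-- The action of `γ` on sections: `(γ s)(z) = γ · s(γ⁻¹ z)`. -/
def secAct (n : ℕ) (γ : SL(2, ℚ_[p])) : Sec p n →ₗ[QpUr p] Sec p n where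
  toFun s z := rho n γ (s (γ⁻¹ • z))
  map_add' s t := by funext z; simp
  map_smul' a s := by funext z; simp

/-- The action of `γ` on forms `ω = s ⊗ dz`: `γ ω = γ · (γ⁻¹)^* ω`, whose coefficient is
`γ · s(γ⁻¹ z)` times the derivative `(c' z + d')⁻²` of `z ↦ γ⁻¹ z`, `(c', d')` being the lower row
of `γ⁻¹`. -/
def formAct (n : ℕ) (γ : SL(2, ℚ_[p])) : Sec p n →ₗ[QpUr p] Sec p n where
  toFun s z := (denom γ⁻¹ z ^ 2)⁻¹ • rho n γ (s (γ⁻¹ • z))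
  map_add' s t := by funext z; simp
  map_smul' a s := by
    funext z
    simp only [Pi.smul_apply, map_smul, RingHom.id_apply]
    exact smul_comm _ _ _

/-- `IsNabla s t` says that `∇ s = t ⊗ dz` for the connection `∇ = 1 ⊗ d` on `V_n ⊗ 𝒪`. -/
def IsNabla {n : ℕ} (s t : Sec p n) : Prop :=
  ∀ (P : Poly p n) (z : Hp p), HasDerivAt (extendZero fun w => s w P) (t z P) z.val

theorem IsNabla.add {n : ℕ} {s t s' t' : Sec p n} (h : IsNabla s t) (h' : IsNabla s' t') :
    IsNabla (s + s') (t + t') := fun P z => by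
  have e : (fun w => (s + s') w P) = (fun w => s w P) + fun w => s' w P := rfl
  rw [e, extendZero_add]
  exact (h P z).add (h' P z)

theorem IsNabla.smul {n : ℕ} {s t : Sec p n} (a : QpUr p) (h : IsNabla s t) :
    IsNabla (a • s) (a • t) := fun P z => by
  have e : (fun w => (a • s) w P) = a • fun w => s w P := rfl
  rw [e, extendZero_smul]
  exact (h P z).const_mul (a : ℂ_[p])

theorem isNabla_zero {n : ℕ} : IsNabla (0 : Sec p n) 0 := fun P z => by
  have e : (fun w => (0 : Sec p n) w P) = 0 := rfl
  rw [e, extendZero_zero]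
  exact hasDerivAt_const _ _

/-! ### The Hodge filtration on `V_n ⊗ 𝒪` -/

/-- The polynomial `1` in `𝒫_1`. -/
def polyOne : Poly p 1 := ⟨1, mem_degreeLE.2 (degree_one_le.trans (by simp))⟩

/-- The polynomial `X` in `𝒫_1`. -/
def polyX : Poly p 1 := ⟨X, mem_degreeLE.2 (degree_X_le.trans (by simp))⟩

variable (p) in
/-- The kernel of the evaluation map `V_1 ⊗ 𝒪 → 𝒪`, `R ⊗ f ↦ (z ↦ R(X - z) f(z))`, where
`R(X - z) = R(X) - z R(1)`. -/
def kerEv : Submodule (QpUr p) (Sec p 1) where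
  carrier := {s | s ∈ anSec p 1 ∧ ∀ z : Hp p, s z polyX - z.val * s z polyOne = 0}
  add_mem' {s t} hs ht := ⟨add_mem hs.1 ht.1, fun z => by
    simp only [LinearMap.add_apply, Pi.add_apply]
    linear_combination hs.2 z + ht.2 z⟩
  zero_mem' := ⟨zero_mem _, fun z => by simp⟩
  smul_mem' a s hs := ⟨Submodule.smul_mem _ a hs.1, fun z => by
    change (a : ℂ_[p]) * s z polyX - z.val * ((a : ℂ_[p]) * s z polyOne) = 0
    linear_combination (a : ℂ_[p]) * hs.2 z⟩

variable (p) in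
/-- The filtration on `V_1 ⊗ 𝒪`: everything in degrees `≤ 0`, the kernel of the evaluation map in
degree `1`, and zero in degrees `≥ 2`. -/
def filOne (j : ℤ) : Submodule (QpUr p) (Sec p 1) :=
  if j ≤ 0 then anSec p 1 else if j = 1 then kerEv p else ⊥

variable (p) in
/-- `V_1^{⊗ n}`-valued functions on `H_p`, `V_1^{⊗ n} ⊗ ℂ_p` being the space of multilinear forms
on `𝒫_1 × ⋯ × 𝒫_1`. -/
abbrev TensorSec (n : ℕ) : Type :=
  Hp p → MultilinearMap ℚ_[p] (fun _ : Fin n => Poly p 1) ℂ_[p]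

variable (p) in
/-- The induced filtration on `V_1^{⊗ n} ⊗ 𝒪`: the `j`-th step is spanned by the tensors
`a · (ℓ_1 ⊗ ⋯ ⊗ ℓ_n)` with `a ∈ 𝒪`, `ℓ_i ∈ F^{d_i}(V_1 ⊗ 𝒪)` and `d_1 + ⋯ + d_n ≥ j`. -/
def filTensor (n : ℕ) (j : ℤ) : Submodule (QpUr p) (TensorSec p n) :=
  Submodule.span (QpUr p)
    {t | ∃ a ∈ rigid p, ∃ (ℓ : Fin n → Sec p 1) (d : Fin n → ℤ),
      j ≤ ∑ i, d i ∧ (∀ i, ℓ i ∈ filOne p (d i)) ∧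
      ∀ (z : Hp p) (P : Fin n → Poly p 1), t z P = a z * ∏ i, ℓ i z (P i)}

variable (p) in
/-- The multiplication `𝒫_1 × ⋯ × 𝒫_1 → 𝒫_n`. -/
def mulPoly (n : ℕ) : MultilinearMap ℚ_[p] (fun _ : Fin n => Poly p 1) (Poly p n) :=
  ((MultilinearMap.mkPiAlgebra ℚ_[p] (Fin n) ℚ_[p][X]).compLinearMap
    fun _ => (Poly p 1).subtype).codRestrict (Poly p n) fun P => by
      simp only [MultilinearMap.compLinearMap_apply, MultilinearMap.mkPiAlgebra_apply,
        Submodule.subtype_apply]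
      rw [mem_degreeLE]
      apply degree_le_of_natDegree_le
      refine (natDegree_prod_le _ _).trans ?_
      refine (Finset.sum_le_card_nsmul _ _ 1 fun i _ => ?_).trans (by simp)
      exact natDegree_le_of_degree_le (mem_degreeLE.1 (P i).2)

variable (p) in
/-- The embedding `V_n ⊗ 𝒪 → V_1^{⊗ n} ⊗ 𝒪` induced by the (`GL_2`-equivariant) embedding
`V_n → V_1^{⊗ n}` dual to multiplication of polynomials. -/
def toTensor (n : ℕ) : Sec p n →ₗ[QpUr p] TensorSec p n where
  toFun s z := (s z).compMultilinearMap (mulPoly p n)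
  map_add' _ _ := rfl
  map_smul' _ _ := rfl

variable (p) in
/-- The filtration on `V_n ⊗ 𝒪` induced from `V_1^{⊗ n} ⊗ 𝒪` via the direct summand
`V_n ⊆ V_1^{⊗ n}`. -/
def fil (n : ℕ) (j : ℤ) : Submodule (QpUr p) (Sec p n) :=
  anSec p n ⊓ (filTensor p n j).comap (toTensor p n)

/-! ### De Rham cohomology of Mumford curves

For a free discrete subgroup `Γ'` acting freely on `H_p`, the space `H_p` is a Galois covering of
`X_{Γ'} = Γ' \ H_p` in the rigid analytic sense, with group `Γ'`, and `H_p` is a Stein space, so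
that coherent sheaves on it are acyclic. The hypercohomology of a complex `E⁰ → E¹` of coherent
sheaves on `X_{Γ'}` is therefore that of the Čech complex of this covering, i.e. the total complex
of the `Γ'`-cochains with values in the global sections on `H_p` of the pulled back complex. A
`1`-cochain is a pair `(c, ω)` with `c : Γ' → E⁰(H_p)` and `ω ∈ E¹(H_p)`. -/

section Cohomology

variable (n : ℕ) {Γ : Subgroup SL(2, ℚ_[p])} (Γ' : Subgroup Γ)

/-- `1`-cochains of total degree one, without analyticity conditions. -/
abbrev Cochain : Type := (Γ' → Sec p n) × Sec p n

instance : AddCommGroup (Cochain n Γ') := inferInstance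

instance : Module (QpUr p) (Cochain n Γ') := inferInstance

/-- Hypercocycles of degree one of the de Rham complex of `V_n ⊗ 𝒪` on `X_{Γ'}`: analytic `c`, `ω`
with `c(γ δ) = c(γ) + γ c(δ)` and `∇ c(γ) = γ ω - ω`. -/
def cocycles : Submodule (QpUr p) (Cochain n Γ') where
  carrier := {x | (∀ γ, x.1 γ ∈ anSec p n) ∧ x.2 ∈ anSec p n ∧
    (∀ γ δ : Γ', x.1 (γ * δ) = x.1 γ + secAct n ((γ : Γ) : SL(2, ℚ_[p])) (x.1 δ)) ∧
    ∀ γ : Γ', IsNabla (x.1 γ) (formAct n ((γ : Γ) : SL(2, ℚ_[p])) x.2 - x.2)}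
  add_mem' {x y} hx hy := by
    refine ⟨fun γ => add_mem (hx.1 γ) (hy.1 γ), add_mem hx.2.1 hy.2.1, fun γ δ => ?_,
      fun γ => ?_⟩
    · simp only [Prod.fst_add, Pi.add_apply, map_add, hx.2.2.1 γ δ, hy.2.2.1 γ δ]
      abel
    · have := (hx.2.2.2 γ).add (hy.2.2.2 γ)
      simp only [Prod.fst_add, Prod.snd_add, Pi.add_apply, map_add]
      rwa [add_sub_add_comm]
  zero_mem' := by
    refine ⟨fun γ => zero_mem _, zero_mem _, fun γ δ => ?_, fun γ => ?_⟩
    · simp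
    · simpa using isNabla_zero
  smul_mem' a x hx := by
    refine ⟨fun γ => Submodule.smul_mem _ a (hx.1 γ), Submodule.smul_mem _ a hx.2.1,
      fun γ δ => ?_, fun γ => ?_⟩
    · simp only [Prod.smul_fst, Pi.smul_apply, map_smul, hx.2.2.1 γ δ, smul_add]
    · have := (hx.2.2.2 γ).smul a
      simp only [Prod.smul_fst, Prod.smul_snd, Pi.smul_apply, map_smul]
      rwa [← smul_sub]

instance : AddCommGroup (cocycles n Γ') := inferInstance

instance : Module (QpUr p) (cocycles n Γ') := inferInstance

/-- Coboundaries: the pairs `(γ ↦ γ s - s, ∇ s)` with `s ∈ V_n ⊗ 𝒪(H_p)`. -/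
def coboundaries : Submodule (QpUr p) (Cochain n Γ') where
  carrier := {x | ∃ s ∈ anSec p n,
    (∀ γ : Γ', x.1 γ = secAct n ((γ : Γ) : SL(2, ℚ_[p])) s - s) ∧ IsNabla s x.2}
  add_mem' {x y} := by
    rintro ⟨s, hs, h1, h2⟩ ⟨t, ht, h3, h4⟩
    refine ⟨s + t, add_mem hs ht, fun γ => ?_, h2.add h4⟩
    simp only [Prod.fst_add, Pi.add_apply, map_add, h1 γ, h3 γ]
    abel
  zero_mem' := ⟨0, zero_mem _, fun γ => by simp, isNabla_zero⟩
  smul_mem' a x := by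
    rintro ⟨s, hs, h1, h2⟩
    refine ⟨a • s, Submodule.smul_mem _ a hs, fun γ => ?_, h2.smul a⟩
    simp only [Prod.smul_fst, Pi.smul_apply, map_smul, h1 γ, smul_sub]

/-- `H^1_DR(X_{Γ'}, 𝒱_n)` for `Γ'` acting freely on `H_p`. -/
def H1Free : Type := cocycles n Γ' ⧸ (coboundaries n Γ').submoduleOf (cocycles n Γ')

instance : AddCommGroup (H1Free n Γ') := inferInstanceAs
  (AddCommGroup (cocycles n Γ' ⧸ (coboundaries n Γ').submoduleOf (cocycles n Γ')))

instance : Module (QpUr p) (H1Free n Γ') := inferInstanceAs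
  (Module (QpUr p) (cocycles n Γ' ⧸ (coboundaries n Γ').submoduleOf (cocycles n Γ')))

/-- The class of a cocycle. -/
def toH1Free : cocycles n Γ' →ₗ[QpUr p] H1Free n Γ' :=
  ((coboundaries n Γ').submoduleOf (cocycles n Γ')).mkQ

/-- The cochains of the subcomplex `F^i E → F^{i-1} E ⊗ Ω¹`. -/
def filCochains (i : ℤ) : Submodule (QpUr p) (Cochain n Γ') :=
  (Submodule.pi Set.univ fun _ => fil p n i).prod (fil p n (i - 1))

/-- The Hodge filtration: `F^i` is the image in `H^1_DR` of the first hypercohomology of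
`F^i E → F^{i-1} E ⊗ Ω¹`. -/
def hodgeFree (i : ℤ) : Submodule (QpUr p) (H1Free n Γ') :=
  ((filCochains n Γ' i).submoduleOf (cocycles n Γ')).map (toH1Free n Γ')

variable [Γ'.Normal]

/-- The action of `g ∈ Γ` on cochains for the normal subgroup `Γ'`:
`(g c)(γ) = g c(g⁻¹ γ g)` and `ω ↦ g ω`. It induces the action of `Γ / Γ'` on `H^1_DR(X_{Γ'})`. -/
def cochainAct (g : Γ) (x : Cochain n Γ') : Cochain n Γ' :=
  (fun γ => secAct n (g : SL(2, ℚ_[p])) (x.1 (MulAut.conjNormal g⁻¹ γ)),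
    formAct n (g : SL(2, ℚ_[p])) x.2)

/-- The cocycles whose class is invariant under `Γ / Γ'`. -/
def invCocycles : Submodule (QpUr p) (Cochain n Γ') where
  carrier := {x | x ∈ cocycles n Γ' ∧ ∀ g : Γ, cochainAct n Γ' g x - x ∈ coboundaries n Γ'}
  add_mem' {x y} hx hy := by
    refine ⟨add_mem hx.1 hy.1, fun g => ?_⟩
    have e : cochainAct n Γ' g (x + y) - (x + y) =
        (cochainAct n Γ' g x - x) + (cochainAct n Γ' g y - y) := by
      have : cochainAct n Γ' g (x + y) = cochainAct n Γ' g x + cochainAct n Γ' g y := by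
        refine Prod.ext (funext fun γ => ?_) ?_ <;> simp [cochainAct]
      rw [this]
      abel
    rw [e]
    exact add_mem (hx.2 g) (hy.2 g)
  zero_mem' := by
    refine ⟨zero_mem _, fun g => ?_⟩
    have : cochainAct n Γ' g 0 = 0 := by
      refine Prod.ext (funext fun γ => ?_) ?_ <;> simp [cochainAct]
    rw [this, sub_zero]
    exact zero_mem _
  smul_mem' a x hx := by
    refine ⟨Submodule.smul_mem _ a hx.1, fun g => ?_⟩
    have : cochainAct n Γ' g (a • x) = a • cochainAct n Γ' g x := by
      refine Prod.ext (funext fun γ => ?_) ?_ <;> simp [cochainAct]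
    rw [this, ← smul_sub]
    exact Submodule.smul_mem _ a (hx.2 g)

/-- `H^1_DR(X_Γ, 𝒱_n)`, defined by means of a free normal subgroup `Γ'` of finite index of `Γ` as
the space of `Γ / Γ'`-invariants in `H^1_DR(X_{Γ'}, 𝒱_n)`. -/
def H1 : Submodule (QpUr p) (H1Free n Γ') :=
  ((invCocycles n Γ').submoduleOf (cocycles n Γ')).map (toH1Free n Γ')

/-- The Hodge filtration on `H^1_DR(X_Γ, 𝒱_n)`, induced from `H^1_DR(X_{Γ'}, 𝒱_n)`. -/
def hodge (i : ℤ) : Submodule (QpUr p) (H1 n Γ') :=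
  (hodgeFree n Γ' i).submoduleOf (H1 n Γ')

end Cohomology

/-! ### Modular forms -/

/-- `M_k(Γ)`: rigid analytic functions `f` on `H_p` defined over `K` with
`f(γ z) = (c z + d) ^ k f(z)` for all `γ ∈ Γ`. -/
def modularForms (Γ : Subgroup SL(2, ℚ_[p])) (k : ℕ) :
    Submodule (QpUr p) (Hp p → ℂ_[p]) where
  carrier := {f | f ∈ rigid p ∧ ∀ γ ∈ Γ, ∀ z : Hp p, f (γ • z) = denom γ z ^ k * f z}
  add_mem' hf hg := ⟨add_mem hf.1 hg.1, fun γ hγ z => by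
    simp only [Pi.add_apply, hf.2 γ hγ z, hg.2 γ hγ z, mul_add]⟩
  zero_mem' := ⟨zero_mem _, fun γ _ z => by simp⟩
  smul_mem' a f hf := ⟨(rigid p).smul_mem hf.1 a, fun γ hγ z => by
    simp only [Pi.smul_apply, hf.2 γ hγ z]
    exact (mul_smul_comm _ _ _).symm⟩

/-- Evaluation at `z` as an element `∂⁰(z)` of `V_n ⊗ ℂ_p`. -/
def evalAt (n : ℕ) (z : Hp p) : Vn p n where
  toFun P := evalQ (P : ℚ_[p][X]) z
  map_add' P Q := eval₂_add _ _
  map_smul' a P := by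
    simp only [evalQ, Submodule.coe_smul, smul_eq_C_mul, eval₂_mul, eval₂_C, RingHom.id_apply]
    rw [Algebra.smul_def]

/-- The section `f ∂⁰` of `V_n ⊗ 𝒪`, where `∂⁰(z)(P) = P(z)`. -/
def omegaSec (n : ℕ) : (Hp p → ℂ_[p]) →ₗ[QpUr p] Sec p n where
  toFun f z := f z • evalAt n z
  map_add' f g := by funext z; simp [add_smul]
  map_smul' a f := by
    funext z
    exact smul_assoc a (f z) (evalAt n z)

theorem evalQ_mem (P : ℚ_[p][X]) : (evalQ P : Hp p → ℂ_[p]) ∈ rigid p := by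
  have hle : ∀ x : ℚ_[p], algebraMap ℚ_[p] ℂ_[p] x ∈ QpUr p := fun x =>
    Subfield.le_topologicalClosure _ (IntermediateField.algebraMap_mem _ x)
  have := isRigidAnalytic_poly (P.map ((algebraMap ℚ_[p] ℂ_[p]).codRestrict (QpUr p) hle))
  have e : (evalQ P : Hp p → ℂ_[p]) =
      evalK (P.map ((algebraMap ℚ_[p] ℂ_[p]).codRestrict (QpUr p) hle)) := by
    funext z
    rw [evalK, eval₂_map]
    rfl
  rw [e]
  exact this

theorem omegaSec_mem {n : ℕ} {f : Hp p → ℂ_[p]} (hf : f ∈ rigid p) :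
    omegaSec n f ∈ anSec p n := fun P => (rigid p).mul_mem hf (evalQ_mem (P : ℚ_[p][X]))

/-- `f ∂⁰ ⊗ dz` is a `Γ`-invariant form if `f ∈ M_{n+2}(Γ)`. -/
theorem formAct_omegaSec {n : ℕ} {Γ : Subgroup SL(2, ℚ_[p])} {f : Hp p → ℂ_[p]}
    (hf : f ∈ modularForms Γ (n + 2)) {γ : SL(2, ℚ_[p])} (hγ : γ ∈ Γ) :
    formAct n γ (omegaSec n f) = omegaSec n f := by
  funext z
  ext P
  change (denom γ⁻¹ z ^ 2)⁻¹ * (f (γ⁻¹ • z) * evalQ (polyAct n γ P : ℚ_[p][X]) (γ⁻¹ • z)) =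
    f z * evalQ (P : ℚ_[p][X]) z
  rw [hf.2 _ (inv_mem hγ), evalQ_polyAct, smul_inv_smul]
  have h1 : denom γ (γ⁻¹ • z) * denom γ⁻¹ z = 1 := by
    rw [← denom_mul, mul_inv_cancel]
    simp [denom]
  have h2 := denom_ne_zero γ⁻¹ z
  have h3 : denom γ (γ⁻¹ • z) ^ n * denom γ⁻¹ z ^ n = 1 := by rw [← mul_pow, h1, one_pow]
  have h4 : (denom γ⁻¹ z ^ 2)⁻¹ * denom γ⁻¹ z ^ 2 = 1 := inv_mul_cancel₀ (pow_ne_zero 2 h2)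
  rw [pow_add]
  linear_combination f z * evalQ (P : ℚ_[p][X]) z *
    ((denom γ⁻¹ z ^ 2)⁻¹ * denom γ⁻¹ z ^ 2 * h3 + h4)

theorem omega_cocycle {n : ℕ} {Γ : Subgroup SL(2, ℚ_[p])} (Γ' : Subgroup Γ) {f : Hp p → ℂ_[p]}
    (hf : f ∈ modularForms Γ (n + 2)) :
    ((0, omegaSec n f) : Cochain n Γ') ∈ cocycles n Γ' := by
  refine ⟨fun γ => zero_mem _, omegaSec_mem hf.1, fun γ δ => by simp, fun γ => ?_⟩
  change IsNabla 0 (formAct n ((γ : Γ) : SL(2, ℚ_[p])) (omegaSec n f) - omegaSec n f)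
  rw [formAct_omegaSec hf (γ : Γ).2, sub_self]
  exact isNabla_zero

theorem omega_invCocycle {n : ℕ} {Γ : Subgroup SL(2, ℚ_[p])} (Γ' : Subgroup Γ) [Γ'.Normal]
    {f : Hp p → ℂ_[p]} (hf : f ∈ modularForms Γ (n + 2)) :
    ((0, omegaSec n f) : Cochain n Γ') ∈ invCocycles n Γ' := by
  refine ⟨omega_cocycle Γ' hf, fun g => ?_⟩
  have : cochainAct n Γ' g (0, omegaSec n f) = (0, omegaSec n f) := by
    refine Prod.ext (funext fun γ => ?_) (formAct_omegaSec hf g.2)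
    simp [cochainAct]
  rw [this, sub_self]
  exact zero_mem _

/-- The map `M_{n+2}(Γ) → H^1_DR(X_Γ, 𝒱_n)` sending `f` to the class of `ω_f = f ∂⁰ ⊗ dz`. -/
def omega (n : ℕ) {Γ : Subgroup SL(2, ℚ_[p])} (Γ' : Subgroup Γ) [Γ'.Normal] :
    modularForms Γ (n + 2) →ₗ[QpUr p] H1 n Γ' where
  toFun f := ⟨toH1Free n Γ' ⟨(0, omegaSec n f), omega_cocycle Γ' f.2⟩,
    ⟨⟨(0, omegaSec n f), omega_cocycle Γ' f.2⟩, omega_invCocycle Γ' f.2, rfl⟩⟩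
  map_add' f g := by
    apply Subtype.ext
    refine Eq.trans (congrArg (toH1Free n Γ') (Subtype.ext (Prod.ext ?_ ?_)))
      (map_add (toH1Free n Γ') _ _)
    · exact (add_zero _).symm
    · exact map_add (omegaSec n) _ _
  map_smul' a f := by
    apply Subtype.ext
    refine Eq.trans (congrArg (toH1Free n Γ') (Subtype.ext (Prod.ext ?_ ?_)))
      ((toH1Free n Γ').map_smul a _)
    · exact (smul_zero _).symm
    · exact map_smul (omegaSec n) _ _

end PadicHodge

end

noncomputable section

namespace PadicHodge

variable {p : ℕ} [Fact p.Prime]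

/-! ### Ultrametric estimates in `ℂ_p` -/

/-! Write a section s of V_n ⊗ 𝒪 through its components s_m(z) = s(z)((X - z)^m), 0 ≤ m ≤ n
(`comp`). In these coordinates everything is explicit: F^j is the vanishing of s_m for all m > n - j
(`mem_fil_iff`), the connection is (∇s)_m = s_m' + m s_{m-1} (`IsNabla.hasDerivAt_comp`), and the
top component s_n transforms like a form of weight -n (`comp_secAct`). The forms f ∂⁰ ⊗ dz are
exactly those whose only component is the one with m = 0, that is, those in F^n ⊗ Ω¹.

Since the integers m ≥ 1 are invertible, these equations are solved from the top component downwards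
by differentiation alone, without any integration. Every ω equals ∇s modulo F^n ⊗ Ω¹ for some s in
F^1 (`exists_primitive`), and an s in F^1 with ∇s in F^n ⊗ Ω¹ is zero (`IsNabla.eq_zero_of_comp`).
Hence a cocycle (c, ω) with all c(γ) in F^1 is cohomologous to a pair (0, f ∂⁰ ⊗ dz)
(`exists_sub_omegaSec_mem_coboundaries`). This is why the filtration does not change between degrees
1 and k - 1; in degrees ≤ 0 and ≥ k the subcomplex is everything or zero.

It remains to see that f ∂⁰ ⊗ dz is exact on X_{Γ'} only for f = 0. This gives injectivity, and it
also gives modularity of f under all of Γ, since invariance of the class makes the form of f|g - f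
exact. If f ∂⁰ ⊗ dz = ∇s with s invariant, then s_n is a form of weight -n; once s_n = 0, the
uniqueness above gives s = 0. So the analytic input is that there are no non-zero forms of negative
weight (`eq_zero_of_negative_weight`).

For that, cocompactness moves every point into a fixed affinoid, on which a form g of weight -n is
bounded; the automorphy factor turns this into |g(z)|² ≤ D · dist(z, ℚ_p)^n. On the Bruhat–Tits tree
log|g| is subharmonic, by a Jensen inequality for rational approximants
(`log_norm_le_of_neighbours`). The level j of a vertex is strictly superharmonic: one neighbour has
level j + 1 and p have level j - 1. So log(|g|²/p^{jn}) is bounded above, but violates the mean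
value inequality near its supremum unless g = 0 (`eq_zero_of_norm_sq_le`). -/

theorem norm_sub_le_max_sub (x y z : ℂ_[p]) : ‖x - z‖ ≤ max ‖x - y‖ ‖y - z‖ := by
  rw [← sub_add_sub_cancel x y z]
  exact PadicComplex.isNonarchimedean p _ _

theorem norm_sub_eq_of_lt {x y z : ℂ_[p]} (h : ‖x - y‖ < ‖y - z‖) : ‖x - z‖ = ‖y - z‖ := by
  rw [← sub_add_sub_cancel x y z, IsUltrametricDist.norm_add_eq_max_of_norm_ne_norm h.ne,
    max_eq_right h.le]

theorem norm_sub_le_max (x y : ℂ_[p]) : ‖x - y‖ ≤ max ‖x‖ ‖y‖ := by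
  simpa using norm_sub_le_max_sub x 0 y

theorem norm_eq_one_of_pow_eq_one {w : ℂ_[p]} {m : ℕ} (h : w ^ m = 1) (hm : m ≠ 0) : ‖w‖ = 1 :=
  (pow_eq_one_iff_of_nonneg (norm_nonneg w) hm).1 (by rw [← norm_pow, h, norm_one])

theorem norm_sum_le_of_le {ι : Type*} (s : Finset ι) (f : ι → ℂ_[p]) {B : ℝ} (hB : 0 ≤ B)
    (h : ∀ i ∈ s, ‖f i‖ ≤ B) : ‖∑ i ∈ s, f i‖ ≤ B :=
  IsUltrametricDist.norm_sum_le_of_forall_le_of_nonneg hB h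

theorem one_lt_prime_real : (1 : ℝ) < p := by exact_mod_cast (Fact.out : p.Prime).one_lt

theorem norm_natCast_le_one (m : ℕ) : ‖(m : ℂ_[p])‖ ≤ 1 := by
  have := norm_algebraMap' ℂ_[p] (m : ℚ_[p])
  rw [map_natCast] at this
  rw [this]
  exact_mod_cast Padic.norm_int_le_one (p := p) m

theorem norm_prime_lt_one : ‖(p : ℂ_[p])‖ < 1 := by
  have := norm_algebraMap' ℂ_[p] (p : ℚ_[p])
  rw [map_natCast] at this
  rw [this]
  exact Padic.norm_p_lt_one

/-- Supplies arbitrarily large integers that are p-adic units. They serve as orders of groups of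
roots of unity, over which one can average without loss. -/
theorem norm_mul_prime_add_one (m : ℕ) : ‖((m * p + 1 : ℕ) : ℂ_[p])‖ = 1 := by
  push_cast
  have h : ‖(m : ℂ_[p]) * p‖ < 1 := by
    rw [norm_mul]
    exact (mul_le_of_le_one_left (norm_nonneg _) (norm_natCast_le_one m)).trans_lt
      norm_prime_lt_one
  rw [IsUltrametricDist.norm_add_eq_max_of_norm_ne_norm (by rw [norm_one]; exact h.ne), norm_one,
    max_eq_right h.le]

/-- If w were close to 1, so would be all its powers, and the vanishing sum 1 + w + ⋯ + w^(mp) would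
be congruent to the unit mp + 1. -/
theorem norm_sub_one_of_pow_eq_one {m : ℕ} {w : ℂ_[p]} (hw : w ^ (m * p + 1) = 1) (h1 : w ≠ 1) :
    ‖w - 1‖ = 1 := by
  have hn : ‖w‖ = 1 := norm_eq_one_of_pow_eq_one hw (by omega)
  have hle : ‖w - 1‖ ≤ 1 := by
    refine (norm_sub_le_max _ _).trans ?_
    rw [hn, norm_one, max_self]
  refine hle.eq_or_lt.resolve_right fun hlt => ?_
  have hs : ∑ i ∈ Finset.range (m * p + 1), w ^ i = 0 := by
    have := geom_sum_mul w (m * p + 1)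
    rw [hw, sub_self] at this
    exact (mul_eq_zero.1 this).resolve_right (sub_ne_zero.2 h1)
  have hs' : ((m * p + 1 : ℕ) : ℂ_[p]) = -∑ i ∈ Finset.range (m * p + 1), (w ^ i - 1) := by
    rw [Finset.sum_sub_distrib, hs]
    simp
  have hb := norm_mul_prime_add_one (p := p) m
  rw [hs', norm_neg] at hb
  have : ‖∑ i ∈ Finset.range (m * p + 1), (w ^ i - 1)‖ ≤ ‖w - 1‖ := by
    refine norm_sum_le_of_le _ _ (norm_nonneg _) fun i _ => ?_
    rw [← geom_sum_mul, norm_mul]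
    refine mul_le_of_le_one_left (norm_nonneg _) (norm_sum_le_of_le _ _ zero_le_one fun k _ => ?_)
    rw [norm_pow, hn, one_pow]
  linarith

/-- There are arbitrarily many elements of the unit circle in pairwise distinct residue classes. -/
theorem exists_residually_distinct (m : ℕ) : ∃ s : Finset ℂ_[p], m < s.card ∧
    (∀ u ∈ s, ‖u‖ = 1) ∧ ∀ u ∈ s, ∀ v ∈ s, u ≠ v → ‖u - v‖ = 1 := by
  -- The required set consists of all roots of unity of order dividing m p + 1; the quotient of two
  -- distinct ones lies at distance 1 from 1.
  have : NeZero ((m * p + 1 : ℕ) : ℂ_[p]) := ⟨by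
    rw [← norm_ne_zero_iff, norm_mul_prime_add_one]; exact one_ne_zero⟩
  obtain ⟨ζ, hζ⟩ := HasEnoughRootsOfUnity.exists_primitiveRoot ℂ_[p] (m * p + 1)
  have hu : ∀ u ∈ nthRootsFinset (m * p + 1) (1 : ℂ_[p]), ‖u‖ = 1 := fun u hu =>
    norm_eq_one_of_pow_eq_one ((mem_nthRootsFinset (by omega) _).1 hu) (by omega)
  refine ⟨nthRootsFinset (m * p + 1) 1, ?_, hu, fun u hu' v hv hne => ?_⟩
  · rw [hζ.card_nthRootsFinset]
    have := (Fact.out : p.Prime).pos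
    nlinarith
  · have hv0 : v ≠ 0 := by rw [← norm_ne_zero_iff, hu v hv]; exact one_ne_zero
    have h1 := (mem_nthRootsFinset (by omega) _).1 hu'
    have h2 := (mem_nthRootsFinset (by omega) _).1 hv
    have := norm_sub_one_of_pow_eq_one (p := p) (m := m) (w := u / v)
      (by rw [div_pow, h1, h2, div_one]) (by rwa [Ne, div_eq_one_iff_eq hv0])
    rwa [div_sub_one hv0, norm_div, hu v hv, div_one] at this

/-- Pigeonhole: an element of T is at distance less than 1 from at most one of a set of residually
distinct units, so with more units than elements of T one of them avoids all of T. -/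
theorem exists_generic_unit (T : Finset ℂ_[p]) :
    ∃ u : ℂ_[p], ‖u‖ ≤ 1 ∧ ∀ c ∈ T, ‖u - c‖ = max 1 ‖c‖ := by
  classical
  obtain ⟨s, hs, h1, h2⟩ := exists_residually_distinct (p := p) T.card
  have key : ∃ u ∈ s, ∀ c ∈ T, 1 ≤ ‖u - c‖ := by
    by_contra! h
    choose! φ hφ hφ' using h
    obtain ⟨u, hu, v, hv, hne, he⟩ := Finset.exists_ne_map_eq_of_card_lt_of_maps_to hs hφ
    have h3 := norm_sub_le_max_sub u (φ u) v
    rw [h2 u hu v hv hne] at h3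
    have h4 := hφ' u hu
    have h5 := hφ' v hv
    rw [← he, norm_sub_rev] at h5
    exact absurd h3 (not_le.2 (max_lt h4 h5))
  obtain ⟨u, hu, hT⟩ := key
  refine ⟨u, (h1 u hu).le, fun c hc => le_antisymm ?_ (max_le (hT c hc) ?_)⟩
  · refine (norm_sub_le_max _ _).trans ?_
    rw [h1 u hu]
  · by_contra! h
    have h6 : ‖c‖ ≤ max ‖c - u‖ ‖u‖ := by simpa using norm_sub_le_max_sub c u 0
    rw [h1 u hu, norm_sub_rev, max_eq_left (hT c hc)] at h6
    exact absurd h6 (not_le.2 h)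

/-- A point of the closed disc with centre `a` and radius `‖t‖` in general position with respect
to the finite set `T`. -/
theorem exists_generic (T : Finset ℂ_[p]) (a : ℂ_[p]) {t : ℂ_[p]} (ht : t ≠ 0) :
    ∃ z : ℂ_[p], ‖z - a‖ ≤ ‖t‖ ∧ ∀ c ∈ T, ‖z - c‖ = max ‖t‖ ‖c - a‖ := by
  classical
  have ht' : 0 < ‖t‖ := norm_pos_iff.2 ht
  obtain ⟨u, hu, hT⟩ := exists_generic_unit (T.image fun c => (c - a) / t)
  refine ⟨a + t * u, ?_, fun c hc => ?_⟩
  · rw [add_sub_cancel_left, norm_mul]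
    exact mul_le_of_le_one_right ht'.le hu
  · have := hT _ (Finset.mem_image_of_mem _ hc)
    have e : a + t * u - c = t * (u - (c - a) / t) := by
      field_simp
      ring
    rw [e, norm_mul, this, mul_max_of_nonneg _ _ ht'.le, mul_one, norm_div,
      mul_div_cancel₀ _ ht'.ne']

/-! ### Cauchy estimates -/

/-- Cauchy's estimate for the coefficients of a polynomial over `ℂ_p`. -/
theorem norm_coeff_mul_pow_le (P : ℂ_[p][X]) (t : ℂ_[p]) {M : ℝ}
    (hM : ∀ y : ℂ_[p], ‖y‖ ≤ ‖t‖ → ‖P.eval y‖ ≤ M) (k : ℕ) : ‖P.coeff k‖ * ‖t‖ ^ k ≤ M := by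
  have hM0 : 0 ≤ M := (norm_nonneg _).trans (hM t le_rfl)
  rcases lt_or_ge P.natDegree k with hk | hk
  · rw [coeff_eq_zero_of_natDegree_lt hk]
    simpa using hM0
  -- The order exceeds the degree, so that the Fourier modes separate, and it is a unit, so that
  -- dividing by it costs nothing.
  obtain ⟨N, hN, hNd⟩ : ∃ N : ℕ, ‖(N : ℂ_[p])‖ = 1 ∧ P.natDegree < N :=
    ⟨_, norm_mul_prime_add_one (P.natDegree), by
      have := (Fact.out : p.Prime).pos
      nlinarith⟩
  have hN0 : (N : ℂ_[p]) ≠ 0 := by rw [← norm_ne_zero_iff, hN]; exact one_ne_zero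
  have : NeZero (N : ℂ_[p]) := ⟨hN0⟩
  obtain ⟨ζ, hζ⟩ := HasEnoughRootsOfUnity.exists_primitiveRoot ℂ_[p] N
  have hζ1 : ‖ζ‖ = 1 := norm_eq_one_of_pow_eq_one hζ.pow_eq_one (by omega)
  -- Discrete Fourier inversion on the circle of radius ‖t‖: since 0 < N - k + i < 2N, the exponent
  -- N - k + i is divisible by N only for i = k.
  have hsum : ∑ j ∈ Finset.range N, (ζ ^ j) ^ (N - k) * P.eval (t * ζ ^ j) =
      N * (P.coeff k * t ^ k) := by
    have e : ∀ j ∈ Finset.range N, (ζ ^ j) ^ (N - k) * P.eval (t * ζ ^ j) =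
        ∑ i ∈ Finset.range (P.natDegree + 1), P.coeff i * t ^ i * (ζ ^ (N - k + i)) ^ j := by
      intro j _
      rw [eval_eq_sum_range, Finset.mul_sum]
      refine Finset.sum_congr rfl fun i _ => ?_
      rw [mul_pow, ← pow_mul, ← pow_mul, ← pow_mul, add_mul, pow_add, mul_comm j, mul_comm j]
      ring
    rw [Finset.sum_congr rfl e, Finset.sum_comm,
      Finset.sum_eq_single_of_mem k (Finset.mem_range.2 (by omega))]
    · rw [Nat.sub_add_cancel (by omega), hζ.pow_eq_one]
      simp [mul_comm]
    · intro i hi hik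
      rw [← Finset.mul_sum]
      have hi' := Finset.mem_range.1 hi
      have h1 : ζ ^ (N - k + i) ≠ 1 := by
        rw [Ne, hζ.pow_eq_one_iff_dvd]
        rintro ⟨q, hq⟩
        rcases Nat.lt_or_ge q 1 with h | h
        · interval_cases q
          omega
        · rcases Nat.lt_or_ge q 2 with h' | h'
          · interval_cases q
            omega
          · have := Nat.mul_le_mul_left N h'
            omega
      have h2 := geom_sum_mul (ζ ^ (N - k + i)) N
      rw [pow_right_comm, hζ.pow_eq_one, one_pow, sub_self, mul_eq_zero] at h2
      rw [mul_eq_zero]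
      refine Or.inr ?_
      exact h2.resolve_right (sub_ne_zero.2 h1)
  have h3 : ‖(N : ℂ_[p]) * (P.coeff k * t ^ k)‖ ≤ M := by
    rw [← hsum]
    refine norm_sum_le_of_le _ _ hM0 fun j _ => ?_
    rw [norm_mul, norm_pow, norm_pow, hζ1, one_pow, one_pow, one_mul]
    refine hM _ ?_
    rw [norm_mul, norm_pow, hζ1, one_pow, mul_one]
  rwa [norm_mul, hN, one_mul, norm_mul, norm_pow] at h3

theorem eval_eq_prod_roots (R : ℂ_[p][X]) (w : ℂ_[p]) :
    R.eval w = R.leadingCoeff * (R.roots.map fun a => w - a).prod := by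
  conv_lhs => rw [(IsAlgClosed.splits R).eq_prod_roots]
  rw [eval_mul, eval_C, eval_multiset_prod, Multiset.map_map]
  simp

/-- A polynomial without zeros in a closed disc has constant absolute value there. -/
theorem norm_eval_eq_of_no_zeros {Q : ℂ_[p][X]} {x : ℂ_[p]} {r : ℝ}
    (hQ : ∀ y : ℂ_[p], ‖y‖ ≤ r → Q.eval (x + y) ≠ 0) {y : ℂ_[p]} (hy : ‖y‖ ≤ r) :
    ‖Q.eval (x + y)‖ = ‖Q.eval x‖ := by
  have h : ∀ c ∈ Q.roots, ‖x + y - c‖ = ‖x - c‖ := by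
    intro c hc
    -- Every root is farther from x than y is long, so moving by y does not change the distance to
    -- it.
    refine norm_sub_eq_of_lt ?_
    rw [add_sub_cancel_left]
    by_contra! h
    refine hQ (c - x) ?_ ?_
    · rw [norm_sub_rev]
      exact h.trans hy
    · rw [add_sub_cancel]
      exact (mem_roots'.1 hc).2
  have hm : ∀ w, ‖Q.eval w‖ = ‖Q.leadingCoeff‖ * (Q.roots.map fun c => ‖w - c‖).prod := by
    intro w
    rw [eval_eq_prod_roots, norm_mul]
    congr 1
    exact (Multiset.prod_hom' Q.roots (normHom (α := ℂ_[p])) fun c => w - c).symm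
  rw [hm, hm, Multiset.map_congr rfl h]

/-- By Cauchy's estimate the term of degree k is at most M (‖y‖/‖t‖)^k, and only k ≥ 2 occurs. -/
theorem norm_eval_le_of_coeff_zero {T : ℂ_[p][X]} {t : ℂ_[p]} {M : ℝ} (ht : t ≠ 0)
    (hM : ∀ y : ℂ_[p], ‖y‖ ≤ ‖t‖ → ‖T.eval y‖ ≤ M) (h0 : T.coeff 0 = 0) (h1 : T.coeff 1 = 0)
    {y : ℂ_[p]} (hy : ‖y‖ ≤ ‖t‖) : ‖T.eval y‖ ≤ M * (‖y‖ / ‖t‖) ^ 2 := by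
  have hM0 : 0 ≤ M := (norm_nonneg _).trans (hM t le_rfl)
  have ht' : 0 < ‖t‖ := norm_pos_iff.2 ht
  rw [eval_eq_sum_range]
  refine norm_sum_le_of_le _ _ (by positivity) fun k _ => ?_
  match k with
  | 0 => rw [h0]; simp; positivity
  | 1 => rw [h1]; simp; positivity
  | k + 2 =>
    have h2 := norm_coeff_mul_pow_le T t hM (k + 2)
    rw [norm_mul, norm_pow]
    have e : ‖T.coeff (k + 2)‖ * ‖y‖ ^ (k + 2) =
        ‖T.coeff (k + 2)‖ * ‖t‖ ^ (k + 2) * (‖y‖ / ‖t‖) ^ (k + 2) := by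
      rw [div_pow]
      field_simp
    rw [e]
    refine mul_le_mul h2 ?_ (by positivity) hM0
    exact pow_le_pow_of_le_one (by positivity) ((div_le_one ht').2 hy) (by omega)

/-- Taylor expansion to first order of a rational function without poles in a closed disc. -/
theorem rational_taylor_bound (P Q : ℂ_[p][X]) (x : ℂ_[p]) {t : ℂ_[p]} {M : ℝ} (ht : t ≠ 0)
    (hQ : ∀ y : ℂ_[p], ‖y‖ ≤ ‖t‖ → Q.eval (x + y) ≠ 0)
    (hM : ∀ y : ℂ_[p], ‖y‖ ≤ ‖t‖ → ‖P.eval (x + y) / Q.eval (x + y)‖ ≤ M) :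
    ‖(derivative P * Q - P * derivative Q).eval x / (Q * Q).eval x‖ * ‖t‖ ≤ M ∧
    ∀ y : ℂ_[p], ‖y‖ ≤ ‖t‖ → ‖P.eval (x + y) / Q.eval (x + y) - P.eval x / Q.eval x -
      (derivative P * Q - P * derivative Q).eval x / (Q * Q).eval x * y‖ ≤
        M * (‖y‖ / ‖t‖) ^ 2 := by
  have hM0 : 0 ≤ M := (norm_nonneg _).trans (hM t le_rfl)
  have ht' : 0 < ‖t‖ := norm_pos_iff.2 ht
  have hQ0 : Q.eval x ≠ 0 := by simpa using hQ 0 (by simp)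
  set q := ‖Q.eval x‖ with hq
  have hqpos : 0 < q := norm_pos_iff.2 hQ0
  have hQn : ∀ y : ℂ_[p], ‖y‖ ≤ ‖t‖ → ‖Q.eval (x + y)‖ = q := fun y hy =>
    norm_eval_eq_of_no_zeros hQ hy
  have hP : ∀ y : ℂ_[p], ‖y‖ ≤ ‖t‖ → ‖P.eval (x + y)‖ ≤ M * q := by
    intro y hy
    have := hM y hy
    rwa [norm_div, hQn y hy, div_le_iff₀ hqpos] at this
  have hev : ∀ (R : ℂ_[p][X]) (y : ℂ_[p]), (taylor x R).eval y = R.eval (x + y) := fun R y => by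
    rw [taylor_eval, add_comm]
  have hP1 : ‖P.derivative.eval x‖ * ‖t‖ ≤ M * q := by
    have := norm_coeff_mul_pow_le (taylor x P) t (fun y hy => by rw [hev]; exact hP y hy) 1
    rwa [taylor_coeff_one, pow_one] at this
  have hQ1 : ‖Q.derivative.eval x‖ * ‖t‖ ≤ q := by
    have := norm_coeff_mul_pow_le (taylor x Q) t (fun y hy => by rw [hev]; exact (hQn y hy).le) 1
    rwa [taylor_coeff_one, pow_one] at this
  have hP0 : ‖P.eval x‖ ≤ M * q := by simpa using hP 0 (by simp)
  set d := (derivative P * Q - P * derivative Q).eval x with hd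
  have hdb : ‖d‖ * ‖t‖ ≤ M * q * q := by
    rw [hd, eval_sub, eval_mul, eval_mul]
    have h1 : ‖P.derivative.eval x * Q.eval x‖ * ‖t‖ ≤ M * q * q := by
      rw [norm_mul, mul_right_comm]
      exact mul_le_mul_of_nonneg_right hP1 hqpos.le
    have h2 : ‖P.eval x * Q.derivative.eval x‖ * ‖t‖ ≤ M * q * q := by
      rw [norm_mul, mul_assoc]
      exact mul_le_mul hP0 hQ1 (by positivity) (by positivity)
    refine (mul_le_mul_of_nonneg_right (norm_sub_le_max _ _) ht'.le).trans ?_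
    rw [max_mul_of_nonneg _ _ ht'.le]
    exact max_le h1 h2
  refine ⟨?_, fun y hy => ?_⟩
  · rw [norm_div, eval_mul, norm_mul, div_mul_eq_mul_div, div_le_iff₀ (by positivity), ← mul_assoc]
    exact hdb
  -- The first order Taylor remainder of P/Q at x with denominators cleared. The factors of Q have
  -- constant absolute value q on the disc, so bounding T is the same as bounding the remainder.
  set T : ℂ_[p][X] := C (Q.eval x ^ 2) * taylor x P - C (P.eval x * Q.eval x) * taylor x Q -
    C d * X * taylor x Q with hT
  have hTe : ∀ y, T.eval y = Q.eval x ^ 2 * P.eval (x + y) - P.eval x * Q.eval x * Q.eval (x + y) -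
      d * y * Q.eval (x + y) := by
    intro y
    simp only [hT, eval_sub, eval_mul, eval_C, eval_X, hev]
  have hTb : ∀ y, ‖y‖ ≤ ‖t‖ → ‖T.eval y‖ ≤ M * q ^ 3 := by
    intro y hy
    rw [hTe]
    refine (norm_sub_le_max _ _).trans (max_le
      ((norm_sub_le_max _ _).trans (max_le ?_ ?_)) ?_)
    · rw [norm_mul, norm_pow]
      have := mul_le_mul_of_nonneg_left (hP y hy) (by positivity : 0 ≤ q ^ 2)
      linarith
    · rw [norm_mul, norm_mul, hQn y hy]
      have := mul_le_mul_of_nonneg_right hP0 (by positivity : 0 ≤ q * q)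
      linarith
    · rw [norm_mul, norm_mul, hQn y hy]
      have h1 : ‖d‖ * ‖y‖ ≤ M * q * q := (mul_le_mul_of_nonneg_left hy (norm_nonneg _)).trans hdb
      have := mul_le_mul_of_nonneg_right h1 hqpos.le
      linarith
  have h0 : T.coeff 0 = 0 := by
    rw [coeff_zero_eq_eval_zero, hTe, add_zero]
    ring
  have h1 : T.coeff 1 = 0 := by
    have e : T = C (Q.eval x ^ 2) * taylor x P - C (P.eval x * Q.eval x) * taylor x Q -
      C d * (X * taylor x Q) := by rw [hT, mul_assoc (C d)]
    rw [e, coeff_sub, coeff_sub, coeff_C_mul, coeff_C_mul, coeff_C_mul, coeff_X_mul,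
      taylor_coeff_one, taylor_coeff_one, taylor_coeff_zero, hd]
    simp only [eval_sub, eval_mul]
    ring
  have h2 := norm_eval_le_of_coeff_zero ht hTb h0 h1 hy
  have e : T.eval y = Q.eval x ^ 2 * Q.eval (x + y) * (P.eval (x + y) / Q.eval (x + y) -
      P.eval x / Q.eval x - d / (Q * Q).eval x * y) := by
    rw [hTe, eval_mul]
    have := hQ y hy
    field_simp
  rw [e, norm_mul, norm_mul, norm_pow, hQn y hy] at h2
  have h3 : 0 < q ^ 2 * q := by positivity
  refine le_of_mul_le_mul_left (h2.trans_eq ?_) h3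
  ring

/-! ### Absolute values of analytic functions on the Bruhat–Tits tree -/

theorem prime_zpow_pos (j : ℤ) : (0 : ℝ) < (p : ℝ) ^ j :=
  zpow_pos (zero_lt_one.trans one_lt_prime_real) j

theorem norm_algebraMap_sub (a b : ℚ_[p]) :
    ‖algebraMap ℚ_[p] ℂ_[p] a - algebraMap ℚ_[p] ℂ_[p] b‖ = ‖a - b‖ := by
  rw [← map_sub, norm_algebraMap']

theorem norm_le_zpow_of_lt {x : ℚ_[p]} {j : ℤ} (h : ‖x‖ < (p : ℝ) ^ (j + 1)) :
    ‖x‖ ≤ (p : ℝ) ^ j := (Padic.norm_le_pow_iff_norm_lt_pow_add_one x j).2 h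

/-- The points of `H_p` reducing to the vertex of the Bruhat–Tits tree given by the disc with
centre `a` and radius `p ^ j`. -/
def vertexSet (a : ℚ_[p]) (j : ℤ) : Set (Hp p) :=
  {z | ‖z.val - algebraMap ℚ_[p] ℂ_[p] a‖ ≤ (p : ℝ) ^ j ∧
    ∀ b : ℚ_[p], (p : ℝ) ^ j ≤ ‖z.val - algebraMap ℚ_[p] ℂ_[p] b‖}

/-- The centres of the `p` discs of radius `p ^ (j - 1)` which make up the disc in `ℚ_p` with centre
`a` and radius `p ^ j`. -/
def child (a : ℚ_[p]) (j : ℤ) (i : Fin p) : ℚ_[p] := a + (i : ℕ) * (p : ℚ_[p]) ^ (-j)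

theorem norm_child_sub_le (a : ℚ_[p]) (j : ℤ) (i : Fin p) : ‖child a j i - a‖ ≤ (p : ℝ) ^ j := by
  rw [child, add_sub_cancel_left, norm_mul, Padic.norm_p_zpow, neg_neg]
  refine mul_le_of_le_one_left (prime_zpow_pos j).le ?_
  exact_mod_cast Padic.norm_int_le_one (p := p) (i : ℕ)

/-- The index is the residue modulo p of (b - a)/p^(-j), that is, the next p-adic digit of b. -/
theorem exists_child (a b : ℚ_[p]) {j : ℤ} (h : ‖b - a‖ ≤ (p : ℝ) ^ j) :
    ∃ i : Fin p, ‖b - child a j i‖ ≤ (p : ℝ) ^ (j - 1) := by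
  have hp0 : (p : ℚ_[p]) ≠ 0 := by exact_mod_cast (Fact.out : p.Prime).ne_zero
  have hx : ‖(b - a) * (p : ℚ_[p]) ^ j‖ ≤ 1 := by
    rw [norm_mul, Padic.norm_p_zpow, zpow_neg]
    exact mul_inv_le_one_of_le₀ h (prime_zpow_pos j).le
  obtain ⟨i, hi, hi'⟩ := PadicInt.exists_mem_range (⟨_, hx⟩ : ℤ_[p])
  refine ⟨⟨i, hi⟩, norm_le_zpow_of_lt ?_⟩
  rw [IsLocalRing.mem_maximalIdeal, PadicInt.mem_nonunits] at hi'
  have hi2 : ‖(b - a) * (p : ℚ_[p]) ^ j - i‖ < 1 := by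
    rw [PadicInt.norm_def] at hi'
    exact hi'
  have e : b - child a j ⟨i, hi⟩ = ((b - a) * (p : ℚ_[p]) ^ j - i) * (p : ℚ_[p]) ^ (-j) := by
    rw [child, sub_mul, mul_assoc, ← zpow_add₀ hp0]
    simp
    ring
  rw [e, norm_mul, Padic.norm_p_zpow, neg_neg, sub_add_cancel]
  exact mul_lt_of_lt_one_left (prime_zpow_pos j) hi2

theorem norm_child_sub_child (a : ℚ_[p]) (j : ℤ) {i k : Fin p} (h : i ≠ k) :
    (p : ℝ) ^ j ≤ ‖child a j i - child a j k‖ := by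
  have e : child a j i - child a j k = ((((i : ℕ) : ℤ) - ((k : ℕ) : ℤ) : ℤ) : ℚ_[p]) *
      (p : ℚ_[p]) ^ (-j) := by
    simp only [child]
    push_cast
    ring
  have h1 : ‖((((i : ℕ) : ℤ) - ((k : ℕ) : ℤ) : ℤ) : ℚ_[p])‖ = 1 := by
    refine le_antisymm (Padic.norm_int_le_one _) (not_lt.1 fun hlt => ?_)
    rw [Padic.norm_intCast_lt_one_iff] at hlt
    have hi := i.2
    have hk := k.2
    refine h (Fin.ext ?_)
    have := Int.eq_zero_of_abs_lt_dvd hlt (by rw [abs_lt]; omega)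
    omega
  rw [e, norm_mul, h1, Padic.norm_p_zpow, neg_neg, one_mul]

/-- Every vertex has points in general position with respect to a finite set. -/
theorem exists_generic_vertex (T : Finset ℂ_[p]) (a : ℚ_[p]) (j : ℤ) :
    ∃ z ∈ vertexSet a j, ∀ c ∈ T,
      ‖z.val - c‖ = max ((p : ℝ) ^ j) ‖c - algebraMap ℚ_[p] ℂ_[p] a‖ := by
  classical
  have hp0 : (p : ℚ_[p]) ≠ 0 := by exact_mod_cast (Fact.out : p.Prime).ne_zero
  have ht : algebraMap ℚ_[p] ℂ_[p] ((p : ℚ_[p]) ^ (-j)) ≠ 0 :=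
    (_root_.map_ne_zero _).2 (zpow_ne_zero _ hp0)
  -- Genericity with respect to the centres of the children is what keeps z at distance at least p^j
  -- from every point of ℚ_p in the disc.
  obtain ⟨z, hz, hT⟩ := exists_generic
    (T ∪ Finset.univ.image fun i : Fin p => algebraMap ℚ_[p] ℂ_[p] (child a j i))
    (algebraMap ℚ_[p] ℂ_[p] a) ht
  rw [norm_algebraMap', Padic.norm_p_zpow, neg_neg] at hz hT
  have hb : ∀ b : ℚ_[p], (p : ℝ) ^ j ≤ ‖z - algebraMap ℚ_[p] ℂ_[p] b‖ := by
    intro b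
    rcases le_or_gt ‖b - a‖ ((p : ℝ) ^ j) with h | h
    · obtain ⟨i, hi⟩ := exists_child a b h
      have h1 : (p : ℝ) ^ j ≤ ‖z - algebraMap ℚ_[p] ℂ_[p] (child a j i)‖ := by
        rw [hT _ (Finset.mem_union_right _ (Finset.mem_image_of_mem _ (Finset.mem_univ i)))]
        exact le_max_left _ _
      have h2 : (p : ℝ) ^ (j - 1) < (p : ℝ) ^ j :=
        zpow_lt_zpow_right₀ one_lt_prime_real (by omega)
      rw [← norm_algebraMap_sub] at hi
      rw [norm_sub_rev] at h1 ⊢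
      rwa [norm_sub_eq_of_lt (hi.trans_lt (h2.trans_le h1))]
    · rw [← norm_algebraMap_sub, norm_sub_rev] at h
      rw [norm_sub_eq_of_lt (hz.trans_lt h)]
      exact h.le
  refine ⟨⟨z, ?_⟩, ⟨hz, hb⟩, fun c hc => hT c (Finset.mem_union_left _ hc)⟩
  rintro ⟨b, rfl⟩
  have := hb b
  rw [sub_self, norm_zero] at this
  exact absurd this (not_le.2 (prime_zpow_pos j))

/-! ### Jensen inequalities and subharmonicity on the tree -/

theorem log_norm_eval {P : ℂ_[p][X]} {z : ℂ_[p]} (hz : P.eval z ≠ 0) :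
    Real.log ‖P.eval z‖ = Real.log ‖P.leadingCoeff‖ +
      (P.roots.map fun c => Real.log ‖z - c‖).sum := by
  have h0 : ∀ s : Multiset ℂ_[p], (∀ c ∈ s, z - c ≠ 0) →
      Real.log ‖(s.map fun c => z - c).prod‖ = (s.map fun c => Real.log ‖z - c‖).sum := by
    intro s
    induction s using Multiset.induction_on with
    | empty => intro _; simp
    | cons c s ih =>
      intro h
      have h1 := h c (Multiset.mem_cons_self _ _)
      have h2 : ∀ c ∈ s, z - c ≠ 0 := fun c hc => h c (Multiset.mem_cons_of_mem hc)
      have h3 : (s.map fun c => z - c).prod ≠ 0 := by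
        rw [Ne, Multiset.prod_eq_zero_iff, Multiset.mem_map]
        rintro ⟨c, hc, hc'⟩
        exact h2 c hc hc'
      rw [Multiset.map_cons, Multiset.prod_cons, norm_mul,
        Real.log_mul (norm_ne_zero_iff.2 h1) (norm_ne_zero_iff.2 h3), ih h2, Multiset.map_cons,
        Multiset.sum_cons]
  have hz' := hz
  rw [eval_eq_prod_roots] at hz'
  rw [eval_eq_prod_roots, norm_mul, Real.log_mul (norm_ne_zero_iff.2 (left_ne_zero_of_mul hz'))
    (norm_ne_zero_iff.2 (right_ne_zero_of_mul hz')), h0]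
  rintro c hc h
  rw [sub_eq_zero] at h
  subst h
  exact hz (mem_roots'.1 hc).2

/-- A mean value of `log ‖P‖` minus its value at a point is a sum over the zeros. -/
theorem sum_log_norm_eval_sub {ι : Type*} [Fintype ι] {μ : ι → ℝ} (hμ : ∑ i, μ i = 1)
    {P : ℂ_[p][X]} {w : ℂ_[p]} {z : ι → ℂ_[p]} (hw : P.eval w ≠ 0) (hz : ∀ i, P.eval (z i) ≠ 0) :
    ∑ i, μ i * Real.log ‖P.eval (z i)‖ - Real.log ‖P.eval w‖ =
      (P.roots.map fun c => ∑ i, μ i * Real.log ‖z i - c‖ - Real.log ‖w - c‖).sum := by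
  have h1 : ∑ i, μ i * Real.log ‖P.eval (z i)‖ = Real.log ‖P.leadingCoeff‖ +
      (P.roots.map fun c => ∑ i, μ i * Real.log ‖z i - c‖).sum := by
    simp only [log_norm_eval (hz _), mul_add, Finset.sum_add_distrib, ← Finset.sum_mul, hμ, one_mul]
    congr 1
    induction P.roots using Multiset.induction_on with
    | empty => simp
    | cons c s ih => simp [mul_add, Finset.sum_add_distrib, ih]
  rw [h1, log_norm_eval hw, Multiset.sum_map_sub]
  ring

theorem evalK_eq_eval_map (P : (QpUr p)[X]) (z : Hp p) :
    evalK P z = (P.map (QpUr p).subtype).eval z.val := by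
  rw [eval_map]
  rfl

/-- A Jensen inequality: the absolute value of an analytic function at `z₀` is at most a weighted
geometric mean of its values at vertices if this holds for linear functions, with equality for
those without zeros in an affinoid. -/
theorem log_norm_le_of_jensen {f : Hp p → ℂ_[p]} (hf : f ∈ rigid p) {ι : Type*} [Fintype ι]
    [Nonempty ι]
    {μ : ι → ℝ} (hμ0 : ∀ i, 0 ≤ μ i) (hμ : ∑ i, μ i = 1) (a : ι → ℚ_[p]) (j : ι → ℤ) (B : ι → ℝ)
    (hB0 : ∀ i, 0 < B i) (hB : ∀ i, ∀ z ∈ vertexSet (a i) (j i), ‖f z‖ ≤ B i) {N : ℕ} {z₀ : Hp p}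
    (hz₀ : z₀ ∈ affinoid p N) (hN : ∀ i, vertexSet (a i) (j i) ⊆ affinoid p N) (hfz : f z₀ ≠ 0)
    (hle : ∀ c, c ≠ z₀.val → Real.log ‖z₀.val - c‖ ≤
      ∑ i, μ i * Real.log (max ((p : ℝ) ^ j i) ‖c - algebraMap ℚ_[p] ℂ_[p] (a i)‖))
    (heq : ∀ c, (∀ w ∈ affinoid p N, Hp.val w ≠ c) → Real.log ‖z₀.val - c‖ =
      ∑ i, μ i * Real.log (max ((p : ℝ) ^ j i) ‖c - algebraMap ℚ_[p] ℂ_[p] (a i)‖)) :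
    Real.log ‖f z₀‖ ≤ ∑ i, μ i * Real.log (B i) := by
  classical
  have hfz' : 0 < ‖f z₀‖ := norm_pos_iff.2 hfz
  -- Below ‖f z₀‖, so that the approximant has the same absolute value as f at z₀; at most every B
  -- i, so that it satisfies the same bounds at the vertices.
  obtain ⟨ε, hε, hε1, hεB⟩ : ∃ ε : ℝ, 0 < ε ∧ ε < ‖f z₀‖ ∧ ∀ i, ε ≤ B i := by
    obtain ⟨i₀, hi₀⟩ := Finite.exists_min B
    refine ⟨min (‖f z₀‖ / 2) (B i₀), lt_min (by positivity) (hB0 _), ?_, fun i => ?_⟩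
    · exact (min_le_left _ _).trans_lt (by linarith)
    · exact (min_le_right _ _).trans (hi₀ i)
  obtain ⟨P, Q, hQ, hPQ⟩ := hf N ε hε
  simp only [evalK_eq_eval_map] at hQ hPQ
  set P' := P.map (QpUr p).subtype
  set Q' := Q.map (QpUr p).subtype
  have hz₀n : ‖P'.eval z₀.val / Q'.eval z₀.val‖ = ‖f z₀‖ := by
    rw [← sub_zero (P'.eval z₀.val / Q'.eval z₀.val)]
    have := norm_sub_eq_of_lt (x := P'.eval z₀.val / Q'.eval z₀.val) (y := f z₀) (z := 0)
      (by rw [sub_zero, norm_sub_rev]; exact (hPQ z₀ hz₀).trans_lt hε1)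
    rw [this, sub_zero]
  have hP0 : P'.eval z₀.val ≠ 0 := by
    intro h
    rw [h, zero_div, norm_zero] at hz₀n
    exact hfz'.ne hz₀n
  -- At a point generic for all zeros and poles, the distance to c depends only on the vertex: it is
  -- the maximum occurring in `hle` and `heq`.
  choose z hzm hzg using fun i =>
    exists_generic_vertex (P'.roots.toFinset ∪ Q'.roots.toFinset) (a i) (j i)
  have hQz : ∀ i, Q'.eval (z i).val ≠ 0 := fun i => hQ _ (hN i (hzm i))
  have hPne : P' ≠ 0 := by
    rintro h
    rw [h, eval_zero] at hP0
    exact hP0 rfl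
  have hgen : ∀ i, ∀ c, c ∈ P'.roots ∨ c ∈ Q'.roots → ‖(z i).val - c‖ =
      max ((p : ℝ) ^ j i) ‖c - algebraMap ℚ_[p] ℂ_[p] (a i)‖ := fun i c hc =>
    hzg i c (by simpa only [Finset.mem_union, Multiset.mem_toFinset] using hc)
  have hPz : ∀ i, P'.eval (z i).val ≠ 0 := by
    intro i h
    have := hgen i _ (Or.inl ((mem_roots hPne).2 h))
    rw [sub_self, norm_zero] at this
    exact ((prime_zpow_pos (p := p) (j i)).trans_le (le_max_left _ _)).ne this
  have h1 : 0 ≤ ∑ i, μ i * Real.log ‖P'.eval (z i).val‖ - Real.log ‖P'.eval z₀.val‖ := by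
    rw [sum_log_norm_eval_sub hμ hP0 hPz]
    refine Multiset.sum_nonneg fun x hx => ?_
    obtain ⟨c, hc, rfl⟩ := Multiset.mem_map.1 hx
    rw [sub_nonneg]
    simp only [hgen _ c (Or.inl hc)]
    refine hle c ?_
    rintro rfl
    exact hP0 (mem_roots'.1 hc).2
  -- The poles enter with a negative sign, so for them an inequality would not suffice; equality
  -- holds because they lie off the affinoid.
  have h2 : ∑ i, μ i * Real.log ‖Q'.eval (z i).val‖ - Real.log ‖Q'.eval z₀.val‖ = 0 := by
    rw [sum_log_norm_eval_sub hμ (hQ _ hz₀) hQz]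
    refine Multiset.sum_eq_zero fun x hx => ?_
    obtain ⟨c, hc, rfl⟩ := Multiset.mem_map.1 hx
    rw [sub_eq_zero]
    simp only [hgen _ c (Or.inr hc)]
    refine (heq c fun w hw hwc => hQ w hw ?_).symm
    rw [hwc]
    exact (mem_roots'.1 hc).2
  rw [← hz₀n, norm_div, Real.log_div (norm_ne_zero_iff.2 hP0) (norm_ne_zero_iff.2 (hQ _ hz₀))]
  have h3 : ∑ i, μ i * Real.log ‖P'.eval (z i).val / Q'.eval (z i).val‖ ≤
      ∑ i, μ i * Real.log (B i) := by
    refine Finset.sum_le_sum fun i _ => mul_le_mul_of_nonneg_left ?_ (hμ0 i)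
    refine Real.log_le_log (norm_pos_iff.2 (div_ne_zero (hPz i) (hQz i))) ?_
    have h4 := norm_sub_le_max (f (z i)) (f (z i) - P'.eval (z i).val / Q'.eval (z i).val)
    rw [sub_sub_cancel] at h4
    exact h4.trans (max_le (hB i _ (hzm i)) ((hPQ _ (hN i (hzm i))).trans (hεB i)))
  simp only [norm_div, Real.log_div (norm_ne_zero_iff.2 (hPz _)) (norm_ne_zero_iff.2 (hQz _)),
    mul_sub, Finset.sum_sub_distrib] at h3
  linarith

/-- Translates the affinoids of the exhaustion into the geometry around a. The second clause locates
the poles of approximants: far from a, or very close to a point of ℚ_p. -/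
theorem exists_affinoid_of_bounds (a : ℚ_[p]) (m M : ℤ) : ∃ N : ℕ,
    (∀ z : Hp p, ‖z.val - algebraMap ℚ_[p] ℂ_[p] a‖ ≤ (p : ℝ) ^ M →
      (∀ b : ℚ_[p], (p : ℝ) ^ m ≤ ‖z.val - algebraMap ℚ_[p] ℂ_[p] b‖) → z ∈ affinoid p N) ∧
    ∀ c : ℂ_[p], (∀ w ∈ affinoid p N, Hp.val w ≠ c) →
      (p : ℝ) ^ M < ‖c - algebraMap ℚ_[p] ℂ_[p] a‖ ∨
        ∃ b : ℚ_[p], ‖c - algebraMap ℚ_[p] ℂ_[p] b‖ < (p : ℝ) ^ m := by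
  obtain ⟨N₁, h₁⟩ := pow_unbounded_of_one_lt ‖a‖ (one_lt_prime_real (p := p))
  have h0 : ∃ N : ℕ, ∀ z : Hp p, ‖z.val - algebraMap ℚ_[p] ℂ_[p] a‖ ≤ (p : ℝ) ^ M →
      (∀ b : ℚ_[p], (p : ℝ) ^ m ≤ ‖z.val - algebraMap ℚ_[p] ℂ_[p] b‖) → z ∈ affinoid p N := by
    refine ⟨N₁ + M.natAbs + m.natAbs, fun z hz hb => ⟨?_, fun b => ?_⟩⟩
    · have h2 : ‖z.val‖ ≤ max ‖z.val - algebraMap ℚ_[p] ℂ_[p] a‖ ‖algebraMap ℚ_[p] ℂ_[p] a‖ := by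
        simpa using norm_sub_le_max_sub z.val (algebraMap ℚ_[p] ℂ_[p] a) 0
      refine h2.trans (max_le (hz.trans ?_) ?_)
      · rw [← zpow_natCast]
        exact zpow_le_zpow_right₀ one_lt_prime_real.le (by omega)
      · rw [norm_algebraMap']
        exact h₁.le.trans (pow_le_pow_right₀ one_lt_prime_real.le (by omega))
    · refine le_trans ?_ (hb b)
      rw [← zpow_natCast, ← zpow_neg]
      exact zpow_le_zpow_right₀ one_lt_prime_real.le (by omega)
  obtain ⟨N, hN⟩ := h0
  refine ⟨N, hN, fun c hc => ?_⟩
  by_contra! h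
  have hr : c ∉ Set.range (algebraMap ℚ_[p] ℂ_[p]) := by
    rintro ⟨b, rfl⟩
    have := h.2 b
    rw [sub_self, norm_zero] at this
    exact absurd this (not_le.2 (prime_zpow_pos m))
  exact hc ⟨c, hr⟩ (hN ⟨c, hr⟩ h.1 h.2) rfl

theorem log_zpow_prime {p : ℕ} (j : ℤ) : Real.log ((p : ℝ) ^ j) = j * Real.log p := Real.log_zpow _ _

theorem log_prime_pos : 0 < Real.log (p : ℝ) := Real.log_pos one_lt_prime_real

/-- Absolute values on ℚ_p are powers of p, so a point close to ℚ_p cannot lie in the open annulus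
p^m < ‖c - a‖ < p^(m+1), which reduces to an open edge of the tree. -/
theorem norm_sub_algebraMap_eq_of_lt {c : ℂ_[p]} {a b : ℚ_[p]} {m : ℤ}
    (hb : ‖c - algebraMap ℚ_[p] ℂ_[p] b‖ < (p : ℝ) ^ m) :
    (‖c - algebraMap ℚ_[p] ℂ_[p] a‖ ≤ (p : ℝ) ^ m ∧ ‖b - a‖ ≤ (p : ℝ) ^ m) ∨
      (p : ℝ) ^ (m + 1) ≤ ‖c - algebraMap ℚ_[p] ℂ_[p] a‖ := by
  rcases lt_or_ge ‖b - a‖ ((p : ℝ) ^ (m + 1)) with h | h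
  · have h1 := norm_le_zpow_of_lt h
    refine Or.inl ⟨(norm_sub_le_max_sub _ (algebraMap ℚ_[p] ℂ_[p] b) _).trans
      (max_le hb.le ?_), h1⟩
    rwa [norm_algebraMap_sub]
  · have h2 : (p : ℝ) ^ m < (p : ℝ) ^ (m + 1) := zpow_lt_zpow_right₀ one_lt_prime_real (by omega)
    rw [← norm_algebraMap_sub] at h
    right
    rwa [norm_sub_eq_of_lt (hb.trans (h2.trans_le h))]

/-- Subharmonicity of the logarithm of the absolute value of an analytic function on the
Bruhat–Tits tree. -/
theorem log_norm_le_of_neighbours {f : Hp p → ℂ_[p]} (hf : f ∈ rigid p) {a : ℚ_[p]} {j : ℤ}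
    {z₀ : Hp p} (hz₀ : z₀ ∈ vertexSet a j) (hfz : f z₀ ≠ 0) {Bu Bd : ℝ} (hu0 : 0 < Bu)
    (hd0 : 0 < Bd) (hu : ∀ z ∈ vertexSet a (j + 1), ‖f z‖ ≤ Bu)
    (hd : ∀ i, ∀ z ∈ vertexSet (child a j i) (j - 1), ‖f z‖ ≤ Bd) :
    ((p : ℝ) + 1) * Real.log ‖f z₀‖ ≤ Real.log Bu + p * Real.log Bd := by
  have hpj : (p : ℝ) ^ j < (p : ℝ) ^ (j + 1) := zpow_lt_zpow_right₀ one_lt_prime_real (by omega)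
  have hpj' : (p : ℝ) ^ (j - 1) < (p : ℝ) ^ j := zpow_lt_zpow_right₀ one_lt_prime_real (by omega)
  have hlp := log_prime_pos (p := p)
  obtain ⟨N, hN, hN'⟩ := exists_affinoid_of_bounds a (j - 1) (j + 1)
  -- `none` stands for the neighbour of level j + 1, containing the disc; `some i` stands for the p
  -- children of level j - 1. All p + 1 neighbours get the same weight.
  set A : Option (Fin p) → ℚ_[p] := fun o => o.elim a (child a j) with hA
  set J : Option (Fin p) → ℤ := fun o => o.elim (j + 1) fun _ => j - 1 with hJ
  set B : Option (Fin p) → ℝ := fun o => o.elim Bu fun _ => Bd with hB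
  have hp1 : (0 : ℝ) < (p : ℝ) + 1 := by positivity
  have hcard : (Fintype.card (Option (Fin p)) : ℝ) = p + 1 := by simp
  have hchild : ∀ i, ‖algebraMap ℚ_[p] ℂ_[p] (child a j i) - algebraMap ℚ_[p] ℂ_[p] a‖ ≤
      (p : ℝ) ^ j := fun i => by
    rw [norm_algebraMap_sub]
    exact norm_child_sub_le a j i
  have hsum : ∀ c : ℂ_[p], ∑ o, ((p : ℝ) + 1)⁻¹ *
      Real.log (max ((p : ℝ) ^ J o) ‖c - algebraMap ℚ_[p] ℂ_[p] (A o)‖) =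
      ((p : ℝ) + 1)⁻¹ * (Real.log (max ((p : ℝ) ^ (j + 1)) ‖c - algebraMap ℚ_[p] ℂ_[p] a‖) +
        ∑ i, Real.log (max ((p : ℝ) ^ (j - 1))
          ‖c - algebraMap ℚ_[p] ℂ_[p] (child a j i)‖)) := by
    intro c
    rw [← Finset.mul_sum, Fintype.sum_option]
    rfl
  have hfar : ∀ c : ℂ_[p], (p : ℝ) ^ j < ‖c - algebraMap ℚ_[p] ℂ_[p] a‖ →
      ‖z₀.val - c‖ = ‖c - algebraMap ℚ_[p] ℂ_[p] a‖ ∧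
      ∑ i, Real.log (max ((p : ℝ) ^ (j - 1)) ‖c - algebraMap ℚ_[p] ℂ_[p] (child a j i)‖) =
        p * Real.log ‖c - algebraMap ℚ_[p] ℂ_[p] a‖ := by
    intro c hc
    have hc' := hc
    rw [norm_sub_rev] at hc'
    refine ⟨?_, ?_⟩
    · rw [norm_sub_eq_of_lt (hz₀.1.trans_lt hc'), norm_sub_rev]
    · have : ∀ i, max ((p : ℝ) ^ (j - 1)) ‖c - algebraMap ℚ_[p] ℂ_[p] (child a j i)‖ =
          ‖c - algebraMap ℚ_[p] ℂ_[p] a‖ := by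
        intro i
        rw [norm_sub_rev, norm_sub_eq_of_lt ((hchild i).trans_lt hc'), norm_sub_rev]
        exact max_eq_right (hpj'.trans hc).le
      simp [this]
  have hnear : ∀ c : ℂ_[p], ‖c - algebraMap ℚ_[p] ℂ_[p] a‖ ≤ (p : ℝ) ^ j →
      ‖z₀.val - c‖ ≤ (p : ℝ) ^ j := fun c hc => by
    rw [norm_sub_rev] at hc
    exact (norm_sub_le_max_sub _ (algebraMap ℚ_[p] ℂ_[p] a) _).trans (max_le hz₀.1 hc)
  have hsplit : ∀ (c : ℂ_[p]) (i₀ : Fin p), (∑ i, Real.log (max ((p : ℝ) ^ (j - 1))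
      ‖c - algebraMap ℚ_[p] ℂ_[p] (child a j i)‖)) =
      Real.log (max ((p : ℝ) ^ (j - 1)) ‖c - algebraMap ℚ_[p] ℂ_[p] (child a j i₀)‖) +
      ∑ i ∈ Finset.univ.erase i₀, Real.log (max ((p : ℝ) ^ (j - 1))
        ‖c - algebraMap ℚ_[p] ℂ_[p] (child a j i)‖) := fun c i₀ =>
    (Finset.add_sum_erase _ _ (Finset.mem_univ i₀)).symm
  have herase : ∀ i₀ : Fin p, ∑ i ∈ Finset.univ.erase i₀, Real.log ((p : ℝ) ^ j) =
      ((p : ℝ) - 1) * (j * Real.log p) := by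
    intro i₀
    rw [Finset.sum_const, Finset.card_erase_of_mem (Finset.mem_univ _), Finset.card_univ,
      Fintype.card_fin, nsmul_eq_mul, log_zpow_prime, Nat.cast_sub (Fact.out : p.Prime).one_le,
      Nat.cast_one]
  have hother : ∀ (c : ℂ_[p]) (i₀ i : Fin p), i ≠ i₀ →
      ‖c - algebraMap ℚ_[p] ℂ_[p] (child a j i₀)‖ < (p : ℝ) ^ j →
      (p : ℝ) ^ j ≤ ‖c - algebraMap ℚ_[p] ℂ_[p] (child a j i)‖ := by
    intro c i₀ i hi h
    have h3 := norm_child_sub_child a j hi.symm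
    rw [← norm_algebraMap_sub] at h3
    rwa [norm_sub_eq_of_lt (h.trans_le h3)]
  have key := log_norm_le_of_jensen hf (μ := fun _ => ((p : ℝ) + 1)⁻¹)
    (fun _ => by positivity)
    (by rw [Finset.sum_const, Finset.card_univ, nsmul_eq_mul, hcard, mul_inv_cancel₀ hp1.ne'])
    A J B (fun o => by cases o <;> assumption)
    (fun o => by
      cases o with
      | none => exact hu
      | some i => exact hd i)
    (z₀ := z₀) (hN z₀ (hz₀.1.trans hpj.le) fun b => hpj'.le.trans (hz₀.2 b))
    (fun o => by
      cases o with
      | none => exact fun z hz => hN z hz.1 fun b => (hpj'.trans hpj).le.trans (hz.2 b)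
      | some i =>
        refine fun z hz => hN z ?_ hz.2
        refine (norm_sub_le_max_sub _ (algebraMap ℚ_[p] ℂ_[p] (child a j i)) _).trans
          (max_le (hz.1.trans (hpj'.trans hpj).le) ((hchild i).trans hpj.le)))
    hfz ?_ ?_
  · rw [← Finset.mul_sum, Fintype.sum_option, inv_mul_eq_div, le_div_iff₀ hp1, mul_comm] at key
    simpa [B] using key
  · intro c hc
    have hc0 : 0 < ‖z₀.val - c‖ := norm_pos_iff.2 (sub_ne_zero.2 hc.symm)
    rw [hsum, inv_mul_eq_div, le_div_iff₀ hp1]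
    rcases lt_or_ge ((p : ℝ) ^ j) ‖c - algebraMap ℚ_[p] ℂ_[p] a‖ with h | h
    · obtain ⟨h1, h2⟩ := hfar c h
      rw [h1] at hc0 ⊢
      rw [h2]
      have := Real.log_le_log hc0 (le_max_right ((p : ℝ) ^ (j + 1)) _)
      linarith
    · have h1 := Real.log_le_log hc0 (hnear c h)
      rw [log_zpow_prime] at h1
      have h2 : ((j : ℝ) + 1) * Real.log p ≤
          Real.log (max ((p : ℝ) ^ (j + 1)) ‖c - algebraMap ℚ_[p] ℂ_[p] a‖) := by
        have := Real.log_le_log (prime_zpow_pos (p := p) (j + 1))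
          (le_max_left _ ‖c - algebraMap ℚ_[p] ℂ_[p] a‖)
        rw [log_zpow_prime] at this
        exact_mod_cast this
      -- At most one child centre is nearer to c than p^j. Its term may lose one unit of level,
      -- which the larger neighbouring disc makes up: (j + 1) + (j - 1) + (p - 1) j = (p + 1) j.
      obtain ⟨i₀, hi₀⟩ : ∃ i₀ : Fin p, ∀ i, i ≠ i₀ →
          (p : ℝ) ^ j ≤ ‖c - algebraMap ℚ_[p] ℂ_[p] (child a j i)‖ := by
        by_cases hex : ∃ i₀ : Fin p, ‖c - algebraMap ℚ_[p] ℂ_[p] (child a j i₀)‖ < (p : ℝ) ^ j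
        · obtain ⟨i₀, hi₀⟩ := hex
          exact ⟨i₀, fun i hi => hother c i₀ i hi hi₀⟩
        · push Not at hex
          exact ⟨⟨0, (Fact.out : p.Prime).pos⟩, fun i _ => hex i⟩
      have h3 : ((j : ℝ) - 1) * Real.log p ≤ Real.log (max ((p : ℝ) ^ (j - 1))
          ‖c - algebraMap ℚ_[p] ℂ_[p] (child a j i₀)‖) := by
        have := Real.log_le_log (prime_zpow_pos (p := p) (j - 1))
          (le_max_left _ ‖c - algebraMap ℚ_[p] ℂ_[p] (child a j i₀)‖)
        rw [log_zpow_prime] at this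
        exact_mod_cast this
      have h4 : ((p : ℝ) - 1) * (j * Real.log p) ≤ ∑ i ∈ Finset.univ.erase i₀,
          Real.log (max ((p : ℝ) ^ (j - 1)) ‖c - algebraMap ℚ_[p] ℂ_[p] (child a j i)‖) := by
        rw [← herase i₀]
        refine Finset.sum_le_sum fun i hi => Real.log_le_log (prime_zpow_pos j) ?_
        exact (hi₀ i (Finset.ne_of_mem_erase hi)).trans (le_max_right _ _)
      rw [hsplit c i₀]
      have := mul_le_mul_of_nonneg_right h1 hp1.le
      linarith
  · intro c hc
    rw [hsum, inv_mul_eq_div, eq_div_iff hp1.ne']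
    have hbig : (p : ℝ) ^ (j + 1) ≤ ‖c - algebraMap ℚ_[p] ℂ_[p] a‖ →
        Real.log ‖z₀.val - c‖ * ((p : ℝ) + 1) =
          Real.log (max ((p : ℝ) ^ (j + 1)) ‖c - algebraMap ℚ_[p] ℂ_[p] a‖) +
          ∑ i, Real.log (max ((p : ℝ) ^ (j - 1))
            ‖c - algebraMap ℚ_[p] ℂ_[p] (child a j i)‖) := by
      intro h
      obtain ⟨h1, h2⟩ := hfar c (hpj.trans_le h)
      rw [h1, h2, max_eq_right h]
      ring
    -- A pole is either at distance at least p^(j+1) from a, or in the disc of a single child at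
    -- distance exactly p^j from the other centres. In both cases the inequalities above are
    -- equalities.
    rcases hN' c hc with h | ⟨b, hb⟩
    · exact hbig h.le
    rcases norm_sub_algebraMap_eq_of_lt (a := a) (hb.trans hpj') with ⟨h, hba⟩ | h
    swap
    · exact hbig h
    obtain ⟨i₀, hi₀⟩ := exists_child a b hba
    have h1 : ‖c - algebraMap ℚ_[p] ℂ_[p] (child a j i₀)‖ ≤ (p : ℝ) ^ (j - 1) := by
      rw [← norm_algebraMap_sub] at hi₀
      exact (norm_sub_le_max_sub _ (algebraMap ℚ_[p] ℂ_[p] b) _).trans (max_le hb.le hi₀)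
    have h2 : ‖z₀.val - c‖ = (p : ℝ) ^ j := by
      refine le_antisymm (hnear c h) ?_
      rw [norm_sub_rev]
      have := hz₀.2 b
      rw [norm_sub_rev] at this
      rwa [norm_sub_eq_of_lt (hb.trans (hpj'.trans_le this))]
    have h3 : ∑ i ∈ Finset.univ.erase i₀,
        Real.log (max ((p : ℝ) ^ (j - 1)) ‖c - algebraMap ℚ_[p] ℂ_[p] (child a j i)‖) =
        ((p : ℝ) - 1) * (j * Real.log p) := by
      rw [← herase i₀]
      refine Finset.sum_congr rfl fun i hi => congrArg Real.log ?_
      have h4 := hother c i₀ i (Finset.ne_of_mem_erase hi) (h1.trans_lt hpj')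
      rw [max_eq_right (hpj'.le.trans h4)]
      refine le_antisymm ((norm_sub_le_max_sub _ (algebraMap ℚ_[p] ℂ_[p] a) _).trans
        (max_le h ?_)) h4
      rw [norm_sub_rev]
      exact hchild i
    rw [h2, hsplit c i₀, h3, max_eq_left h1, max_eq_left (h.trans hpj.le), log_zpow_prime,
      log_zpow_prime, log_zpow_prime]
    push_cast
    ring

/-- Log-convexity along an edge (the three circles theorem): log ‖f‖ at an inner point is at most
the interpolation of its bounds at the two ends, so f cannot vanish on both end vertices. -/
theorem exists_ne_zero_of_edge {f : Hp p → ℂ_[p]} (hf : f ∈ rigid p) {a : ℚ_[p]} {j : ℤ}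
    {z₀ : Hp p} (h1 : (p : ℝ) ^ j < ‖z₀.val - algebraMap ℚ_[p] ℂ_[p] a‖)
    (h2 : ‖z₀.val - algebraMap ℚ_[p] ℂ_[p] a‖ < (p : ℝ) ^ (j + 1)) (hfz : f z₀ ≠ 0) :
    ∃ z, (z ∈ vertexSet a j ∨ z ∈ vertexSet a (j + 1)) ∧ f z ≠ 0 := by
  by_contra! hzero
  have hpj : (p : ℝ) ^ j < (p : ℝ) ^ (j + 1) := zpow_lt_zpow_right₀ one_lt_prime_real (by omega)
  have hlp := log_prime_pos (p := p)
  have hfz' : 0 < ‖f z₀‖ := norm_pos_iff.2 hfz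
  obtain ⟨N, hN, hN'⟩ := exists_affinoid_of_bounds a j (j + 1)
  set t := ‖z₀.val - algebraMap ℚ_[p] ℂ_[p] a‖ with ht
  have ht0 : 0 < t := (prime_zpow_pos j).trans h1
  -- The position of z₀ on the edge from level j to level j + 1.
  set θ : ℝ := Real.log t / Real.log p - j with hθ
  have hlt : Real.log t = (j + θ) * Real.log p := by
    rw [hθ]
    field_simp
    ring
  have hθ0 : 0 ≤ θ := by
    have := Real.log_lt_log (prime_zpow_pos j) h1
    rw [log_zpow_prime, hlt] at this
    by_contra! h
    nlinarith
  have hθ1 : θ ≤ 1 := by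
    have := Real.log_lt_log ht0 h2
    rw [log_zpow_prime, hlt] at this
    push_cast at this
    by_contra! h
    nlinarith
  have hsum : ∀ g : Bool → ℝ, ∑ i, (bif i then θ else 1 - θ) * g i =
      θ * g true + (1 - θ) * g false := fun g => by simp
  -- As f vanishes at both ends, any positive bound is allowed there; ‖f z₀‖ / 2 contradicts the
  -- conclusion.
  have key := log_norm_le_of_jensen hf (ι := Bool) (μ := fun i => bif i then θ else 1 - θ)
    (fun i => by cases i <;> simp <;> linarith) (by simp) (fun _ => a)
    (fun i => bif i then j + 1 else j) (fun _ => ‖f z₀‖ / 2) (fun _ => by positivity)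
    (fun i z hz => by
      have : f z = 0 := by
        cases i
        · exact hzero z (Or.inl hz)
        · exact hzero z (Or.inr hz)
      rw [this, norm_zero]
      positivity)
    (z₀ := z₀) (hN z₀ h2.le fun b => ?_)
    (fun i => by
      cases i with
      | false => exact fun z hz => hN z (hz.1.trans hpj.le) hz.2
      | true => exact fun z hz => hN z hz.1 fun b => hpj.le.trans (hz.2 b)) hfz ?_ ?_
  · rw [hsum, ← add_mul] at key
    have h3 := Real.log_lt_log (by positivity) (half_lt_self hfz')
    linarith
  · rcases lt_or_ge ‖a - b‖ ((p : ℝ) ^ (j + 1)) with h | h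
    · have h3 := norm_le_zpow_of_lt h
      by_contra! h4
      rw [← norm_algebraMap_sub, norm_sub_rev] at h3
      exact absurd ((norm_sub_le_max_sub _ (algebraMap ℚ_[p] ℂ_[p] b) _).trans
        (max_le h4.le h3)) (not_le.2 h1)
    · rw [← norm_algebraMap_sub] at h
      rw [norm_sub_eq_of_lt (h2.trans_le h)]
      exact hpj.le.trans h
  · intro c hc
    have hc0 : 0 < ‖z₀.val - c‖ := norm_pos_iff.2 (sub_ne_zero.2 hc.symm)
    rw [hsum]
    simp only [cond_true, cond_false]
    set x := ‖c - algebraMap ℚ_[p] ℂ_[p] a‖ with hx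
    have hm := norm_sub_le_max_sub z₀.val (algebraMap ℚ_[p] ℂ_[p] a) c
    rw [norm_sub_rev (algebraMap ℚ_[p] ℂ_[p] a) c] at hm
    rcases le_max_iff.1 hm with h | h
    · have h3 := Real.log_le_log hc0 h
      have h4 := Real.log_le_log (prime_zpow_pos (p := p) (j + 1)) (le_max_left _ x)
      have h5 := Real.log_le_log (prime_zpow_pos (p := p) j) (le_max_left _ x)
      rw [log_zpow_prime] at h4 h5
      push_cast at h4
      have h6 := mul_le_mul_of_nonneg_left h4 hθ0
      have h7 := mul_le_mul_of_nonneg_left h5 (sub_nonneg.2 hθ1)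
      rw [← ht, hlt] at h3
      linarith
    · have h3 := Real.log_le_log hc0 h
      have h4 := Real.log_le_log (hc0.trans_le h) (le_max_right ((p : ℝ) ^ (j + 1)) x)
      have h5 := Real.log_le_log (hc0.trans_le h) (le_max_right ((p : ℝ) ^ j) x)
      have h6 := mul_le_mul_of_nonneg_left h4 hθ0
      have h7 := mul_le_mul_of_nonneg_left h5 (sub_nonneg.2 hθ1)
      linarith
  · intro c hc
    rw [hsum]
    simp only [cond_true, cond_false]
    have hbig : (p : ℝ) ^ (j + 1) ≤ ‖c - algebraMap ℚ_[p] ℂ_[p] a‖ →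
        Real.log ‖z₀.val - c‖ =
          θ * Real.log (max ((p : ℝ) ^ (j + 1)) ‖c - algebraMap ℚ_[p] ℂ_[p] a‖) +
          (1 - θ) * Real.log (max ((p : ℝ) ^ j) ‖c - algebraMap ℚ_[p] ℂ_[p] a‖) := by
      intro h
      rw [max_eq_right h, max_eq_right (hpj.le.trans h)]
      rw [norm_sub_rev] at h
      rw [norm_sub_eq_of_lt (h2.trans_le h), norm_sub_rev]
      ring
    rcases hN' c hc with h | ⟨b, hb⟩
    · exact hbig h.le
    rcases norm_sub_algebraMap_eq_of_lt (a := a) hb with ⟨h, -⟩ | h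
    swap
    · exact hbig h
    have h3 : ‖z₀.val - c‖ = t := by
      rw [norm_sub_rev, norm_sub_eq_of_lt (y := algebraMap ℚ_[p] ℂ_[p] a), norm_sub_rev]
      rw [norm_sub_rev _ z₀.val]
      exact h.trans_lt h1
    rw [h3, hlt, max_eq_left h, max_eq_left (h.trans hpj.le), log_zpow_prime, log_zpow_prime]
    push_cast
    ring

/-! ### Vertices near a given point, and the vanishing criterion -/

theorem isClosed_range_algebraMap : IsClosed (Set.range (algebraMap ℚ_[p] ℂ_[p])) :=
  (AddMonoidHomClass.isometry_of_norm (algebraMap ℚ_[p] ℂ_[p])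
    fun x => norm_algebraMap' _ x).isClosedEmbedding.isClosed_range

/-- The distance of a point of `H_p` to `ℚ_p`, up to a factor of `p`. -/
theorem exists_zpow_le_norm_sub (z : Hp p) : ∃ (a : ℚ_[p]) (j : ℤ),
    ‖z.val - algebraMap ℚ_[p] ℂ_[p] a‖ < (p : ℝ) ^ (j + 1) ∧
    ∀ b : ℚ_[p], (p : ℝ) ^ j ≤ ‖z.val - algebraMap ℚ_[p] ℂ_[p] b‖ := by
  have hne : (Set.range (algebraMap ℚ_[p] ℂ_[p])).Nonempty := Set.range_nonempty _
  have hd : 0 < Metric.infDist z.val (Set.range (algebraMap ℚ_[p] ℂ_[p])) :=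
    (isClosed_range_algebraMap.notMem_iff_infDist_pos hne).1 z.2
  obtain ⟨j, hj1, hj2⟩ := exists_mem_Ico_zpow hd (one_lt_prime_real (p := p))
  obtain ⟨_, ⟨a, rfl⟩, ha⟩ := (Metric.infDist_lt_iff hne).1 hj2
  refine ⟨a, j, by rwa [← dist_eq_norm], fun b => hj1.trans ?_⟩
  rw [← dist_eq_norm]
  exact Metric.infDist_le_dist_of_mem ⟨b, rfl⟩

theorem exists_vertex_ne_zero {f : Hp p → ℂ_[p]} (hf : f ∈ rigid p) {z₀ : Hp p} (hfz : f z₀ ≠ 0) :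
    ∃ a j, ∃ z ∈ vertexSet a j, f z ≠ 0 := by
  obtain ⟨a, j, h1, h2⟩ := exists_zpow_le_norm_sub z₀
  rcases le_or_gt ‖z₀.val - algebraMap ℚ_[p] ℂ_[p] a‖ ((p : ℝ) ^ j) with h | h
  · exact ⟨a, j, z₀, ⟨h, h2⟩, hfz⟩
  · obtain ⟨z, hz | hz, hz'⟩ := exists_ne_zero_of_edge hf h h1 hfz
    · exact ⟨a, j, z, hz, hz'⟩
    · exact ⟨a, j + 1, z, hz, hz'⟩

/-- An analytic function on `H_p` which is bounded by a positive power of the distance to `ℚ_p`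
vanishes. -/
theorem eq_zero_of_norm_sq_le {f : Hp p → ℂ_[p]} (hf : f ∈ rigid p) {n : ℕ} (hn : n ≠ 0) {D : ℝ}
    (h : ∀ (z : Hp p) (b : ℚ_[p]), ‖f z‖ ^ 2 ≤ D * ‖z.val - algebraMap ℚ_[p] ℂ_[p] b‖ ^ n) :
    f = 0 := by
  funext z₀
  by_contra hfz
  -- The function ‖f‖² divided by the n-th power of the radius, over all vertices. The hypothesis
  -- bounds it by D, because ‖z - a‖ ≤ p^j at the vertex; it is not zero throughout by
  -- `exists_vertex_ne_zero`.
  set S : Set ℝ := {x | ∃ a j, ∃ z ∈ vertexSet (p := p) a j, x = ‖f z‖ ^ 2 / ((p : ℝ) ^ j) ^ n}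
    with hS
  have hD : 0 ≤ D := by
    have h1 := h z₀ 0
    by_contra! h2
    have h3 : 0 < ‖f z₀‖ := norm_pos_iff.2 hfz
    nlinarith [pow_nonneg (norm_nonneg (z₀.val - algebraMap ℚ_[p] ℂ_[p] 0)) n, pow_pos h3 2]
  have hbdd : BddAbove S := by
    refine ⟨D, ?_⟩
    rintro _ ⟨a, j, z, hz, rfl⟩
    rw [div_le_iff₀ (pow_pos (prime_zpow_pos j) n)]
    refine (h z a).trans (mul_le_mul_of_nonneg_left ?_ hD)
    exact pow_le_pow_left₀ (norm_nonneg _) hz.1 n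
  obtain ⟨a₁, j₁, z₁, hz₁, hfz₁⟩ := exists_vertex_ne_zero hf hfz
  set s := sSup S with hs
  have hs0 : 0 < s := by
    refine lt_of_lt_of_le ?_ (le_csSup hbdd ⟨a₁, j₁, z₁, hz₁, rfl⟩)
    have := prime_zpow_pos (p := p) j₁
    have := norm_pos_iff.2 hfz₁
    positivity
  have hle : ∀ a j, ∀ z ∈ vertexSet (p := p) a j, ‖f z‖ ≤ √(s * ((p : ℝ) ^ j) ^ n) := by
    intro a j z hz
    refine Real.le_sqrt_of_sq_le ?_
    rw [← div_le_iff₀ (pow_pos (prime_zpow_pos j) n)]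
    exact le_csSup hbdd ⟨a, j, z, hz, rfl⟩
  have hlp := log_prime_pos (p := p)
  have hp1 := one_lt_prime_real (p := p)
  have hn0 : (0 : ℝ) < n := by exact_mod_cast Nat.pos_of_ne_zero hn
  -- The amount by which n j log p exceeds its mean over the p + 1 neighbours. The supremum need not
  -- be attained: a vertex within a factor exp(-δ) of it already gives a contradiction.
  set δ : ℝ := ((p : ℝ) - 1) * n * Real.log p / ((p : ℝ) + 1) with hδ
  have hδ0 : 0 < δ := div_pos (mul_pos (mul_pos (by linarith) hn0) hlp) (by linarith)
  have hlt : s * Real.exp (-δ) < s :=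
    mul_lt_of_lt_one_right hs0 (by rw [Real.exp_lt_one_iff]; linarith)
  obtain ⟨_, ⟨a, j, z, hz, rfl⟩, hx⟩ := exists_lt_of_lt_csSup
    (show S.Nonempty from ⟨_, a₁, j₁, z₁, hz₁, rfl⟩) hlt
  have hpjn := pow_pos (prime_zpow_pos (p := p) j) n
  have hfz' : f z ≠ 0 := by
    intro h0
    rw [h0, norm_zero] at hx
    have := mul_pos hs0 (Real.exp_pos (-δ))
    simp at hx
    linarith
  have hfp : 0 < ‖f z‖ := norm_pos_iff.2 hfz'
  have h1 := Real.log_lt_log (mul_pos hs0 (Real.exp_pos _)) hx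
  rw [Real.log_mul hs0.ne' (Real.exp_pos _).ne', Real.log_exp, Real.log_div (by positivity)
    hpjn.ne', Real.log_pow, Real.log_pow, log_zpow_prime] at h1
  have hpos : ∀ i : ℤ, 0 < s * ((p : ℝ) ^ i) ^ n := fun i =>
    mul_pos hs0 (pow_pos (prime_zpow_pos i) n)
  have h2 := log_norm_le_of_neighbours hf hz hfz' (Real.sqrt_pos.2 (hpos (j + 1)))
    (Real.sqrt_pos.2 (hpos (j - 1))) (hle a (j + 1)) fun i => hle _ (j - 1)
  have hlog : ∀ i : ℤ, Real.log √(s * ((p : ℝ) ^ i) ^ n) =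
      (Real.log s + n * (i * Real.log p)) / 2 := by
    intro i
    rw [Real.log_sqrt (hpos i).le, Real.log_mul hs0.ne' (pow_pos (prime_zpow_pos i) n).ne',
      Real.log_pow, log_zpow_prime]
  rw [hlog, hlog] at h2
  push_cast at h1 h2
  have h3 : ((p : ℝ) + 1) * δ = ((p : ℝ) - 1) * n * Real.log p := by
    rw [hδ]
    field_simp
  nlinarith

/-! ### Linear fractional transformations of affinoids -/

theorem affinoid_mono {N M : ℕ} (h : N ≤ M) : affinoid p N ⊆ affinoid p M := fun z hz => by
  have h1 : (p : ℝ) ^ N ≤ (p : ℝ) ^ M := pow_le_pow_right₀ one_lt_prime_real.le h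
  have h0 : (0 : ℝ) < (p : ℝ) ^ N := pow_pos (zero_lt_one.trans one_lt_prime_real) N
  exact ⟨hz.1.trans h1, fun b => (inv_anti₀ h0 h1).trans (hz.2 b)⟩

/-- The form is α times the difference of z and the point -β/α of ℚ_p, which has absolute value at
least p^(-N). This bounds α, and then ‖z‖ ≤ p^N bounds β. -/
theorem norm_coeff_le_of_mem_affinoid {N : ℕ} {z : Hp p} (hz : z ∈ affinoid p N) (α β : ℚ_[p]) :
    ‖α‖ ≤ (p : ℝ) ^ (2 * N) *
      ‖algebraMap ℚ_[p] ℂ_[p] α * z.val + algebraMap ℚ_[p] ℂ_[p] β‖ ∧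
    ‖β‖ ≤ (p : ℝ) ^ (2 * N) *
      ‖algebraMap ℚ_[p] ℂ_[p] α * z.val + algebraMap ℚ_[p] ℂ_[p] β‖ := by
  have hp1 : (1 : ℝ) ≤ (p : ℝ) ^ N := one_le_pow₀ one_lt_prime_real.le
  have hp0 : (0 : ℝ) < (p : ℝ) ^ N := by linarith
  set x := algebraMap ℚ_[p] ℂ_[p] α * z.val + algebraMap ℚ_[p] ℂ_[p] β with hx
  have hα : ‖α‖ ≤ (p : ℝ) ^ N * ‖x‖ := by
    by_cases h : α = 0
    · rw [h, norm_zero]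
      positivity
    · have h' : algebraMap ℚ_[p] ℂ_[p] α ≠ 0 := (_root_.map_ne_zero _).2 h
      have e : x = algebraMap ℚ_[p] ℂ_[p] α * (z.val - algebraMap ℚ_[p] ℂ_[p] (-β / α)) := by
        rw [hx, map_div₀, map_neg]
        field_simp
        ring
      rw [e, norm_mul, norm_algebraMap', mul_left_comm]
      refine le_mul_of_one_le_right (norm_nonneg _) ?_
      have := mul_le_mul_of_nonneg_left (hz.2 (-β / α)) hp0.le
      rwa [mul_inv_cancel₀ hp0.ne'] at this
  have e2 : (p : ℝ) ^ (2 * N) * ‖x‖ = (p : ℝ) ^ N * ((p : ℝ) ^ N * ‖x‖) := by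
    rw [two_mul, pow_add]
    ring
  have h2 : (p : ℝ) ^ N * ‖x‖ ≤ (p : ℝ) ^ (2 * N) * ‖x‖ := by
    rw [e2]
    exact le_mul_of_one_le_left (by positivity) hp1
  refine ⟨hα.trans h2, ?_⟩
  have e : algebraMap ℚ_[p] ℂ_[p] β = x - algebraMap ℚ_[p] ℂ_[p] α * z.val := by
    rw [hx]
    ring
  rw [← norm_algebraMap' ℂ_[p] β, e]
  refine (norm_sub_le_max _ _).trans (max_le ?_ ?_)
  · exact (le_mul_of_one_le_left (norm_nonneg _) hp1).trans h2
  · rw [norm_mul, norm_algebraMap', e2, mul_comm]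
    exact mul_le_mul hz.1 hα (norm_nonneg _) hp0.le

theorem smul_sub_mul_denom (γ : SL(2, ℚ_[p])) (z : Hp p) (b : ℚ_[p]) :
    ((γ • z).val - algebraMap ℚ_[p] ℂ_[p] b) * denom γ z =
      algebraMap ℚ_[p] ℂ_[p] (γ 0 0 - b * γ 1 0) * z.val +
        algebraMap ℚ_[p] ℂ_[p] (γ 0 1 - b * γ 1 1) := by
  rw [smul_val, sub_mul, div_mul_cancel₀ _ (denom_ne_zero γ z)]
  simp only [num, denom, map_sub, map_mul]
  ring

/-- A lower bound for the distance of γz to ℚ_p in terms of ‖cz + d‖^(-2). The determinant relation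
writes 1 as a combination of the two linear forms cz + d and (γz - b)(cz + d), each of which
controls its own leading coefficient. -/
theorem one_le_norm_denom_sq_mul {N : ℕ} (γ : SL(2, ℚ_[p])) {z : Hp p} (hz : z ∈ affinoid p N)
    (b : ℚ_[p]) : 1 ≤ (p : ℝ) ^ (2 * N) * (‖denom γ z‖ ^ 2 *
      ‖(γ • z).val - algebraMap ℚ_[p] ℂ_[p] b‖) := by
  have h1 := (norm_coeff_le_of_mem_affinoid hz (γ 0 0 - b * γ 1 0) (γ 0 1 - b * γ 1 1)).1
  have h2 := (norm_coeff_le_of_mem_affinoid hz (γ 1 0) (γ 1 1)).1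
  rw [← smul_sub_mul_denom, norm_mul] at h1
  change _ ≤ _ * ‖denom γ z‖ at h2
  have e : (1 : ℂ_[p]) = denom γ z * algebraMap ℚ_[p] ℂ_[p] (γ 0 0 - b * γ 1 0) -
      algebraMap ℚ_[p] ℂ_[p] (γ 1 0) *
        (((γ • z).val - algebraMap ℚ_[p] ℂ_[p] b) * denom γ z) := by
    have h3 : algebraMap ℚ_[p] ℂ_[p] (γ 0 0 * γ 1 1 - γ 0 1 * γ 1 0) = 1 := by
      rw [det_eq, map_one]
    rw [smul_sub_mul_denom]
    simp only [denom, map_sub, map_mul] at h3 ⊢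
    linear_combination -h3
  have h4 := norm_sub_le_max (denom γ z * algebraMap ℚ_[p] ℂ_[p] (γ 0 0 - b * γ 1 0))
    (algebraMap ℚ_[p] ℂ_[p] (γ 1 0) * (((γ • z).val - algebraMap ℚ_[p] ℂ_[p] b) * denom γ z))
  rw [← e, norm_one] at h4
  refine h4.trans (max_le ?_ ?_)
  · rw [norm_mul, norm_algebraMap']
    refine (mul_le_mul_of_nonneg_left h1 (norm_nonneg _)).trans_eq ?_
    ring
  · rw [norm_mul, norm_mul, norm_algebraMap']
    refine (mul_le_mul_of_nonneg_right h2 (by positivity)).trans_eq ?_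
    ring

/-- If cz + d were small, c and d would be small, and the determinant could not be 1. -/
theorem one_le_of_det {L N : ℕ} {z : Hp p} (hz : z ∈ affinoid p N) {a b c d : ℚ_[p]}
    (ha : ‖a‖ ≤ (p : ℝ) ^ L) (hb : ‖b‖ ≤ (p : ℝ) ^ L) (h : a * d - b * c = 1) :
    1 ≤ (p : ℝ) ^ (L + 2 * N) *
      ‖algebraMap ℚ_[p] ℂ_[p] c * z.val + algebraMap ℚ_[p] ℂ_[p] d‖ := by
  obtain ⟨h1, h2⟩ := norm_coeff_le_of_mem_affinoid hz c d
  have hp0 : (0 : ℝ) < (p : ℝ) ^ L := pow_pos (zero_lt_one.trans one_lt_prime_real) L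
  have h3 : ‖(1 : ℚ_[p])‖ ≤ max ‖a * d‖ ‖b * c‖ := by
    rw [← h, sub_eq_add_neg, ← norm_neg (b * c)]
    exact Padic.nonarchimedean _ _
  rw [norm_one] at h3
  rw [pow_add, mul_assoc]
  refine h3.trans (max_le ?_ ?_)
  · rw [norm_mul]
    exact mul_le_mul ha h2 (norm_nonneg _) hp0.le
  · rw [norm_mul]
    exact mul_le_mul hb h1 (norm_nonneg _) hp0.le

theorem norm_linear_le {L N : ℕ} {z : Hp p} (hz : z ∈ affinoid p N) {c d : ℚ_[p]}
    (hc : ‖c‖ ≤ (p : ℝ) ^ L) (hd : ‖d‖ ≤ (p : ℝ) ^ L) :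
    ‖algebraMap ℚ_[p] ℂ_[p] c * z.val + algebraMap ℚ_[p] ℂ_[p] d‖ ≤ (p : ℝ) ^ (L + N) := by
  have hp1 : (1 : ℝ) ≤ (p : ℝ) ^ N := one_le_pow₀ one_lt_prime_real.le
  have hp0 : (0 : ℝ) < (p : ℝ) ^ L := pow_pos (zero_lt_one.trans one_lt_prime_real) L
  rw [pow_add]
  refine (PadicComplex.isNonarchimedean p _ _).trans (max_le ?_ ?_)
  · rw [norm_mul, norm_algebraMap']
    exact mul_le_mul hc hz.1 (norm_nonneg _) hp0.le
  · rw [norm_algebraMap']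
    exact hd.trans (le_mul_of_one_le_right hp0.le hp1)

theorem smul_mem_affinoid {L N : ℕ} {γ : SL(2, ℚ_[p])} (hγ : ∀ i k, ‖γ i k‖ ≤ (p : ℝ) ^ L)
    {z : Hp p} (hz : z ∈ affinoid p N) : γ • z ∈ affinoid p (2 * L + 3 * N) := by
  have hp0 : ∀ m : ℕ, (0 : ℝ) < (p : ℝ) ^ m := pow_pos (zero_lt_one.trans one_lt_prime_real)
  have hdet := det_eq γ
  have hd0 : 0 < ‖denom γ z‖ := norm_pos_iff.2 (denom_ne_zero γ z)
  have h1 : 1 ≤ (p : ℝ) ^ (L + 2 * N) * ‖denom γ z‖ := one_le_of_det hz (hγ 0 0) (hγ 0 1) hdet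
  have h2 : ‖denom γ z‖ ≤ (p : ℝ) ^ (L + N) := norm_linear_le hz (hγ 1 0) (hγ 1 1)
  have h3 : ‖num γ z‖ ≤ (p : ℝ) ^ (L + N) := norm_linear_le hz (hγ 0 0) (hγ 0 1)
  have e : (p : ℝ) ^ (2 * L + 3 * N) = (p : ℝ) ^ (L + N) * (p : ℝ) ^ (L + 2 * N) := by
    rw [← pow_add]
    congr 1
    ring
  refine ⟨?_, fun b => ?_⟩
  · rw [smul_val, norm_div, div_le_iff₀ hd0, e, mul_assoc]
    exact h3.trans (le_mul_of_one_le_right (hp0 _).le h1)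
  · have h4 := one_le_of_det hz (hγ 1 1) (hγ 1 0) (c := γ 0 1 - b * γ 1 1)
      (d := γ 0 0 - b * γ 1 0) (by linear_combination hdet)
    -- Subtracting b times the lower row keeps the determinant 1, so the row completing the matrix
    -- does not depend on b and the bound is uniform in b.
    have h5 := one_le_of_det (L := L) hz (a := -γ 1 0) (b := -γ 1 1) (c := γ 0 0 - b * γ 1 0)
      (d := γ 0 1 - b * γ 1 1) (by rw [norm_neg]; exact hγ 1 0) (by rw [norm_neg]; exact hγ 1 1)
      (by linear_combination hdet)
    rw [← smul_sub_mul_denom, norm_mul] at h5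
    rw [e, inv_le_iff_one_le_mul₀ (mul_pos (hp0 _) (hp0 _))]
    refine h5.trans ?_
    have := mul_le_mul_of_nonneg_left h2 (mul_nonneg (hp0 (L + 2 * N)).le
      (norm_nonneg ((γ • z).val - algebraMap ℚ_[p] ℂ_[p] b)))
    linarith

theorem exists_entry_bound (γ : SL(2, ℚ_[p])) : ∃ L : ℕ, ∀ i k, ‖γ i k‖ ≤ (p : ℝ) ^ L := by
  obtain ⟨L, hL⟩ := pow_unbounded_of_one_lt (∑ x : Fin 2 × Fin 2, ‖γ x.1 x.2‖)
    (one_lt_prime_real (p := p))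
  refine ⟨L, fun i k => le_trans ?_ hL.le⟩
  exact Finset.single_le_sum (f := fun x : Fin 2 × Fin 2 => ‖γ x.1 x.2‖)
    (fun _ _ => norm_nonneg _) (Finset.mem_univ (i, k))

theorem entry_bound_inv {L : ℕ} {γ : SL(2, ℚ_[p])} (h : ∀ i k, ‖γ i k‖ ≤ (p : ℝ) ^ L) :
    ∀ i k, ‖γ⁻¹ i k‖ ≤ (p : ℝ) ^ L := by
  intro i k
  rw [Matrix.SpecialLinearGroup.coe_inv, Matrix.adjugate_fin_two]
  fin_cases i <;> fin_cases k <;> simp <;> exact h _ _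

theorem exists_smul_affinoid_subset (γ : SL(2, ℚ_[p])) (N : ℕ) :
    ∃ M, ∀ z ∈ affinoid p N, γ • z ∈ affinoid p M := by
  obtain ⟨L, hL⟩ := exists_entry_bound γ
  exact ⟨_, fun z hz => smul_mem_affinoid hL hz⟩

/-! ### Analytic functions under linear fractional transformations -/

variable (p) in
/-- The inclusion `ℚ_p → K`. -/
def toQpUr : ℚ_[p] →+* QpUr p :=
  (algebraMap ℚ_[p] ℂ_[p]).codRestrict (QpUr p) fun x =>
    Subfield.le_topologicalClosure _ (IntermediateField.algebraMap_mem _ x)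

/-- The polynomial `(c X + d) ^ D * P ((a X + b) / (c X + d))`. -/
def homSubst (γ : SL(2, ℚ_[p])) (D : ℕ) (P : (QpUr p)[X]) : (QpUr p)[X] :=
  ∑ i ∈ Finset.range (D + 1), C (P.coeff i) *
    (C (toQpUr p (γ 0 0)) * X + C (toQpUr p (γ 0 1))) ^ i *
    (C (toQpUr p (γ 1 0)) * X + C (toQpUr p (γ 1 1))) ^ (D - i)

theorem evalK_homSubst (γ : SL(2, ℚ_[p])) {D : ℕ} {P : (QpUr p)[X]} (hP : P.natDegree ≤ D)
    (z : Hp p) : evalK (homSubst γ D P) z = denom γ z ^ D * evalK P (γ • z) := by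
  have h := denom_ne_zero γ z
  rw [evalK, evalK, eval₂_eq_sum_range' _ (Nat.lt_succ_of_le hP), homSubst, eval₂_finsetSum,
    Finset.mul_sum]
  refine Finset.sum_congr rfl fun i hi => ?_
  have hi' : i ≤ D := Nat.lt_succ_iff.1 (Finset.mem_range.1 hi)
  simp only [eval₂_mul, eval₂_pow, eval₂_add, eval₂_C, eval₂_X]
  change _ * num γ z ^ i * denom γ z ^ (D - i) = _
  rw [smul_val, div_pow]
  have : denom γ z ^ D = denom γ z ^ i * denom γ z ^ (D - i) := by
    rw [← pow_add, Nat.add_sub_cancel' hi']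
  rw [this]
  field_simp

/-- Numerator and denominator are homogenised to the same degree, so the powers of cz + d cancel;
the affinoid is mapped into a larger one. -/
theorem rigid_comp_smul {f : Hp p → ℂ_[p]} (hf : f ∈ rigid p) (γ : SL(2, ℚ_[p])) :
    (fun z => f (γ • z)) ∈ rigid p := by
  intro N ε hε
  obtain ⟨M, hM⟩ := exists_smul_affinoid_subset γ N
  obtain ⟨P, Q, hQ, h⟩ := hf M ε hε
  have hP' := evalK_homSubst γ (le_max_left P.natDegree Q.natDegree)
  have hQ' := evalK_homSubst γ (le_max_right P.natDegree Q.natDegree)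
  refine ⟨homSubst γ (max P.natDegree Q.natDegree) P, homSubst γ (max P.natDegree Q.natDegree) Q,
    fun z hz => ?_, fun z hz => ?_⟩
  · rw [hQ']
    exact mul_ne_zero (pow_ne_zero _ (denom_ne_zero γ z)) (hQ _ (hM z hz))
  · rw [hP', hQ', mul_div_mul_left _ _ (pow_ne_zero _ (denom_ne_zero γ z))]
    exact h _ (hM z hz)

theorem exists_bound_affinoid {f : Hp p → ℂ_[p]} (hf : f ∈ rigid p) (N : ℕ) :
    ∃ B : ℝ, ∀ z ∈ affinoid p N, ‖f z‖ ≤ B := by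
  obtain ⟨P, Q, hQ, h⟩ := hf N 1 one_pos
  obtain ⟨B, -, hB⟩ := exists_upper_bound N P Q hQ
  refine ⟨max 1 B, fun z hz => ?_⟩
  have := PadicComplex.isNonarchimedean p (f z - evalK P z / evalK Q z) (evalK P z / evalK Q z)
  rw [sub_add_cancel] at this
  exact this.trans (max_le_max (h z hz) (hB z hz))

/-! ### Cocompact subgroups -/

theorem exists_smul_mem_affinoid_two (z : Hp p) : ∃ A : SL(2, ℚ_[p]), A • z ∈ affinoid p 2 := by
  obtain ⟨a, j, h1, h2⟩ := exists_zpow_le_norm_sub z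
  have hp0 : (p : ℚ_[p]) ≠ 0 := by exact_mod_cast (Fact.out : p.Prime).ne_zero
  -- A diagonal matrix of determinant 1 scales by a square t², so the level j can only be reduced
  -- modulo 2. This is why the second affinoid appears.
  set m := j / 2 with hm
  set t := (p : ℚ_[p]) ^ m with ht
  have ht0 : t ≠ 0 := zpow_ne_zero _ hp0
  have htn : ‖t * t‖ = (p : ℝ) ^ (-(2 * m)) := by
    rw [norm_mul, ht, Padic.norm_p_zpow, ← zpow_add₀ (zero_lt_one.trans one_lt_prime_real).ne']
    congr 1
    ring
  let A : SL(2, ℚ_[p]) := ⟨!![t, -(t * a); 0, t⁻¹], by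
    rw [Matrix.det_fin_two_of, mul_inv_cancel₀ ht0]
    ring⟩
  have hA : (A • z).val = algebraMap ℚ_[p] ℂ_[p] (t * t) *
      (z.val - algebraMap ℚ_[p] ℂ_[p] a) := by
    have hn : num A z = algebraMap ℚ_[p] ℂ_[p] t * z.val +
      algebraMap ℚ_[p] ℂ_[p] (-(t * a)) := rfl
    have hd : denom A z = algebraMap ℚ_[p] ℂ_[p] 0 * z.val +
      algebraMap ℚ_[p] ℂ_[p] t⁻¹ := rfl
    rw [smul_val, hn, hd]
    simp only [map_zero, map_neg, map_mul, map_inv₀, zero_mul, zero_add, div_inv_eq_mul]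
    ring
  have hpow : (p : ℝ) ^ (2 : ℕ) = (p : ℝ) ^ (2 : ℤ) := by norm_cast
  have hpz : ∀ i : ℤ, (0 : ℝ) < (p : ℝ) ^ i := prime_zpow_pos
  refine ⟨A, ?_, fun b => ?_⟩
  · rw [hA, norm_mul, norm_algebraMap', htn, hpow]
    refine (mul_le_mul_of_nonneg_left h1.le (hpz _).le).trans ?_
    rw [← zpow_add₀ (zero_lt_one.trans one_lt_prime_real).ne']
    exact zpow_le_zpow_right₀ one_lt_prime_real.le (by omega)
  · have e : (A • z).val - algebraMap ℚ_[p] ℂ_[p] b = algebraMap ℚ_[p] ℂ_[p] (t * t) *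
        (z.val - algebraMap ℚ_[p] ℂ_[p] (a + b / (t * t))) := by
      have : algebraMap ℚ_[p] ℂ_[p] (t * t) ≠ 0 := (_root_.map_ne_zero _).2 (mul_ne_zero ht0 ht0)
      rw [hA, map_add, map_div₀]
      generalize algebraMap ℚ_[p] ℂ_[p] (t * t) = x at this
      field_simp
      ring
    rw [e, norm_mul, norm_algebraMap', htn, hpow, ← zpow_neg]
    refine le_trans ?_ (mul_le_mul_of_nonneg_left (h2 _) (hpz _).le)
    rw [← zpow_add₀ (zero_lt_one.trans one_lt_prime_real).ne']
    exact zpow_le_zpow_right₀ one_lt_prime_real.le (by omega)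

/-- The sets of matrices with entries bounded by p^L are open and exhaust the group; their images in
the compact quotient are open, so one of them already covers. -/
theorem exists_entry_bound_of_cocompact (Γ : Subgroup SL(2, ℚ_[p]))
    [CompactSpace (SL(2, ℚ_[p]) ⧸ Γ)] :
    ∃ L : ℕ, ∀ A : SL(2, ℚ_[p]), ∃ γ ∈ Γ, ∀ i k, ‖(A * γ) i k‖ ≤ (p : ℝ) ^ L := by
  set U : ℕ → Set SL(2, ℚ_[p]) := fun L => {A | ∀ i k, ‖A i k‖ < (p : ℝ) ^ L} with hU
  have hopen : ∀ L, IsOpen (U L) := by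
    intro L
    have : U L = ⋂ i, ⋂ k, {A : SL(2, ℚ_[p]) | ‖A i k‖ < (p : ℝ) ^ L} := by
      ext A
      simp [hU]
    rw [this]
    refine isOpen_iInter_of_finite fun i => isOpen_iInter_of_finite fun k => ?_
    refine isOpen_lt (continuous_norm.comp ?_) continuous_const
    exact (continuous_apply_apply i k).comp continuous_subtype_val
  have hmono : ∀ {L M : ℕ}, L ≤ M → U L ⊆ U M := fun {L M} h A hA i k =>
    (hA i k).trans_le (pow_le_pow_right₀ one_lt_prime_real.le h)
  obtain ⟨L, hL⟩ := isCompact_univ.elim_directed_cover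
    (fun L => ((↑) : SL(2, ℚ_[p]) → SL(2, ℚ_[p]) ⧸ Γ) '' U L)
    (fun L => QuotientGroup.isOpenMap_coe _ (hopen L))
    (fun x _ => by
      obtain ⟨A, rfl⟩ := QuotientGroup.mk_surjective x
      obtain ⟨L, hL⟩ := exists_entry_bound A
      refine Set.mem_iUnion.2 ⟨L + 1, A, fun i k => (hL i k).trans_lt ?_, rfl⟩
      exact pow_lt_pow_right₀ one_lt_prime_real (Nat.lt_succ_self L))
    (directed_of_isDirected_le fun L M h => Set.image_mono (hmono h))
  refine ⟨L, fun A => ?_⟩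
  obtain ⟨B, hB, hBA⟩ := hL (Set.mem_univ (A : SL(2, ℚ_[p]) ⧸ Γ))
  have h := QuotientGroup.eq.1 hBA.symm
  refine ⟨A⁻¹ * B, h, fun i k => ?_⟩
  rw [mul_inv_cancel_left]
  exact (hB i k).le

/-- A cocompact subgroup moves every point of `H_p` into a fixed affinoid. -/
theorem exists_affinoid_covering (Γ : Subgroup SL(2, ℚ_[p])) [CompactSpace (SL(2, ℚ_[p]) ⧸ Γ)] :
    ∃ N : ℕ, ∀ z : Hp p, ∃ γ ∈ Γ, γ • z ∈ affinoid p N := by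
  obtain ⟨L, hL⟩ := exists_entry_bound_of_cocompact Γ
  refine ⟨2 * L + 3 * 2, fun z => ?_⟩
  obtain ⟨A, hA⟩ := exists_smul_mem_affinoid_two z
  obtain ⟨γ, hγ, h⟩ := hL A
  refine ⟨γ⁻¹, inv_mem hγ, ?_⟩
  -- A moves z into a fixed affinoid, and A γ has bounded entries, so its inverse moves that
  -- affinoid by a bounded amount.
  have e : γ⁻¹ • z = (A * γ)⁻¹ • A • z := by
    rw [← mul_smul, mul_inv_rev, mul_assoc, inv_mul_cancel, mul_one]
  rw [e]
  exact smul_mem_affinoid (entry_bound_inv h) hA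

/-- Correct the element of Γ by one of finitely many coset representatives, and enlarge the affinoid
accordingly. -/
theorem exists_affinoid_covering_of_finiteIndex {Γ : Subgroup SL(2, ℚ_[p])}
    [CompactSpace (SL(2, ℚ_[p]) ⧸ Γ)] (Γ' : Subgroup Γ) [Γ'.FiniteIndex] :
    ∃ N : ℕ, ∀ z : Hp p, ∃ γ : Γ', ((γ : Γ) : SL(2, ℚ_[p])) • z ∈ affinoid p N := by
  obtain ⟨N, hN⟩ := exists_affinoid_covering Γ
  choose M hM using fun q : Γ ⧸ Γ' =>
    exists_smul_affinoid_subset ((q.out : Γ) : SL(2, ℚ_[p]))⁻¹ N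
  obtain ⟨M', hM'⟩ := Finite.exists_le M
  refine ⟨M', fun z => ?_⟩
  obtain ⟨γ, hγ, h⟩ := hN z
  set g : Γ := ⟨γ, hγ⟩
  set q : Γ ⧸ Γ' := (g : Γ ⧸ Γ')
  have hq : q.out⁻¹ * g ∈ Γ' := QuotientGroup.eq.1 (QuotientGroup.out_eq' q)
  refine ⟨⟨_, hq⟩, affinoid_mono (hM' q) ?_⟩
  have := hM q _ h
  rwa [← mul_smul] at this

/-- There are no modular forms of negative weight for a group which moves every point into a fixed
affinoid. -/
theorem eq_zero_of_negative_weight {Γ : Set SL(2, ℚ_[p])} {N : ℕ}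
    (hΓ : ∀ z : Hp p, ∃ γ ∈ Γ, γ • z ∈ affinoid p N) {n : ℕ} (hn : n ≠ 0) {g : Hp p → ℂ_[p]}
    (hg : g ∈ rigid p) (hw : ∀ γ ∈ Γ, ∀ z, g z = denom γ z ^ n * g (γ • z)) : g = 0 := by
  obtain ⟨B, hB⟩ := exists_bound_affinoid hg N
  refine eq_zero_of_norm_sq_le hg hn (D := ((p : ℝ) ^ (2 * N)) ^ n * B ^ 2) fun z b => ?_
  obtain ⟨γ, hγ, h⟩ := hΓ z
  -- Applied to γ⁻¹ at γz, which lies in the fixed affinoid; the factor of γ⁻¹ at γz is the inverse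
  -- of that of γ at z, so the lower bound becomes the upper bound `h4`.
  have h1 := one_le_norm_denom_sq_mul γ⁻¹ h b
  rw [inv_smul_smul] at h1
  have h2 : denom γ z * denom γ⁻¹ (γ • z) = 1 := by
    have := denom_mul γ⁻¹ γ z
    rw [inv_mul_cancel] at this
    rw [mul_comm, ← this]
    simp [denom]
  have h3 : ‖denom γ z‖ * ‖denom γ⁻¹ (γ • z)‖ = 1 := by rw [← norm_mul, h2, norm_one]
  have h4 : ‖denom γ z‖ ^ 2 ≤ (p : ℝ) ^ (2 * N) * ‖z.val - algebraMap ℚ_[p] ℂ_[p] b‖ := by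
    have := mul_le_mul_of_nonneg_left h1 (sq_nonneg ‖denom γ z‖)
    rw [mul_one] at this
    refine this.trans_eq ?_
    linear_combination (p : ℝ) ^ (2 * N) * ‖z.val - algebraMap ℚ_[p] ℂ_[p] b‖ *
      (‖denom γ z‖ * ‖denom γ⁻¹ (γ • z)‖ + 1) * h3
  have h5 : ‖g (γ • z)‖ ^ 2 ≤ B ^ 2 := pow_le_pow_left₀ (norm_nonneg _) (hB _ h) 2
  rw [hw γ hγ z, norm_mul, mul_pow, norm_pow, pow_right_comm]
  refine (mul_le_mul (pow_le_pow_left₀ (by positivity) h4 n) h5 (by positivity)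
    (by positivity)).trans_eq ?_
  rw [mul_pow]
  ring

/-! ### Derivatives of analytic functions -/

theorem val_injective : Function.Injective (Hp.val (p := p)) := Subtype.val_injective

theorem extendZero_val (f : Hp p → ℂ_[p]) (z : Hp p) : extendZero f z.val = f z :=
  val_injective.extend_apply f 0 z

theorem extendZero_mul (φ : ℂ_[p] → ℂ_[p]) (f : Hp p → ℂ_[p]) :
    extendZero (fun w => φ w.val * f w) = fun x => φ x * extendZero f x := by
  funext x
  by_cases hx : ∃ w : Hp p, w.val = x
  · obtain ⟨w, rfl⟩ := hx
    rw [extendZero_val, extendZero_val]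
  · simp only [extendZero, Function.extend_apply' _ _ _ hx, Pi.zero_apply, mul_zero]

theorem exists_mem_affinoid (z : Hp p) : ∃ N, z ∈ affinoid p N := by
  obtain ⟨a, j, h1, h2⟩ := exists_zpow_le_norm_sub z
  obtain ⟨N, hN, -⟩ := exists_affinoid_of_bounds a j (j + 1)
  exact ⟨N, hN z h1.le h2⟩

/-- Each affinoid is a union of open discs of one radius p^(-N), which makes the Cauchy estimates
uniform on it. -/
theorem exists_add_mem_affinoid {N : ℕ} {z : Hp p} (hz : z ∈ affinoid p N) {y : ℂ_[p]}
    (hy : ‖y‖ < ((p : ℝ) ^ N)⁻¹) : ∃ w ∈ affinoid p N, w.val = z.val + y := by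
  have hp1 : (1 : ℝ) ≤ (p : ℝ) ^ N := one_le_pow₀ one_lt_prime_real.le
  have hp0 : (0 : ℝ) < ((p : ℝ) ^ N)⁻¹ := by positivity
  have h : ∀ b : ℚ_[p], ((p : ℝ) ^ N)⁻¹ ≤ ‖z.val + y - algebraMap ℚ_[p] ℂ_[p] b‖ := by
    intro b
    rw [norm_sub_eq_of_lt (y := z.val) (by
      rw [add_sub_cancel_left]
      exact hy.trans_le (hz.2 b))]
    exact hz.2 b
  refine ⟨⟨z.val + y, ?_⟩, ⟨?_, h⟩, rfl⟩
  · rintro ⟨b, hb⟩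
    have := h b
    rw [hb, sub_self, norm_zero] at this
    exact absurd this (not_le.2 hp0)
  · refine (PadicComplex.isNonarchimedean p _ _).trans (max_le hz.1 ?_)
    exact hy.le.trans ((inv_le_one_of_one_le₀ hp1).trans hp1)

/-- The value at `z` of the derivative of the rational function `P / Q`. -/
def evalDeriv (P Q : (QpUr p)[X]) (z : Hp p) : ℂ_[p] :=
  evalK (derivative P * Q - P * derivative Q) z / evalK (Q * Q) z

/-- The rational function `P / Q` without poles on `affinoid N` approximates `f` up to `ε`. -/
def IsApprox (f : Hp p → ℂ_[p]) (N : ℕ) (ε : ℝ) (P Q : (QpUr p)[X]) : Prop :=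
  (∀ z ∈ affinoid p N, evalK Q z ≠ 0) ∧ ∀ z ∈ affinoid p N, ‖f z - evalK P z / evalK Q z‖ ≤ ε

theorem evalDeriv_bound {N : ℕ} {P Q : (QpUr p)[X]} (hQ : ∀ z ∈ affinoid p N, evalK Q z ≠ 0)
    {M : ℝ} (hM : ∀ z ∈ affinoid p N, ‖evalK P z / evalK Q z‖ ≤ M) {z : Hp p}
    (hz : z ∈ affinoid p N) {t : ℂ_[p]} (ht0 : t ≠ 0) (ht : ‖t‖ < ((p : ℝ) ^ N)⁻¹) :
    ‖evalDeriv P Q z‖ * ‖t‖ ≤ M ∧ ∀ w ∈ affinoid p N, ‖w.val - z.val‖ ≤ ‖t‖ →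
      ‖evalK P w / evalK Q w - evalK P z / evalK Q z - evalDeriv P Q z * (w.val - z.val)‖ ≤
        M * (‖w.val - z.val‖ / ‖t‖) ^ 2 := by
  have h := rational_taylor_bound (P.map (QpUr p).subtype) (Q.map (QpUr p).subtype) z.val (M := M)
    ht0 (fun y hy => by
      obtain ⟨w, hw, hwe⟩ := exists_add_mem_affinoid hz (hy.trans_lt ht)
      rw [← hwe, ← evalK_eq_eval_map]
      exact hQ w hw) (fun y hy => by
      obtain ⟨w, hw, hwe⟩ := exists_add_mem_affinoid hz (hy.trans_lt ht)
      rw [← hwe, ← evalK_eq_eval_map, ← evalK_eq_eval_map]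
      exact hM w hw)
  rw [derivative_map, derivative_map, ← Polynomial.map_mul, ← Polynomial.map_mul,
    ← Polynomial.map_mul, ← Polynomial.map_sub] at h
  simp only [evalDeriv, evalK_eq_eval_map]
  refine ⟨h.1, fun w _ hw' => ?_⟩
  have := h.2 _ hw'
  rwa [add_sub_cancel] at this

theorem evalDeriv_sub {P₁ Q₁ P₂ Q₂ : (QpUr p)[X]} {z : Hp p} (h₁ : evalK Q₁ z ≠ 0)
    (h₂ : evalK Q₂ z ≠ 0) :
    evalDeriv (P₁ * Q₂ - P₂ * Q₁) (Q₁ * Q₂) z = evalDeriv P₁ Q₁ z - evalDeriv P₂ Q₂ z := by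
  simp only [evalDeriv, evalK_eq_eval_map, derivative_sub, derivative_mul, Polynomial.map_sub,
    Polynomial.map_mul, Polynomial.map_add, eval_sub, eval_mul, eval_add] at h₁ h₂ ⊢
  field_simp
  ring

theorem evalK_sub_div {P₁ Q₁ P₂ Q₂ : (QpUr p)[X]} {z : Hp p} (h₁ : evalK Q₁ z ≠ 0)
    (h₂ : evalK Q₂ z ≠ 0) :
    evalK (P₁ * Q₂ - P₂ * Q₁) z / evalK (Q₁ * Q₂) z =
      evalK P₁ z / evalK Q₁ z - evalK P₂ z / evalK Q₂ z := by
  simp only [evalK_eq_eval_map, Polynomial.map_sub, Polynomial.map_mul, eval_sub, eval_mul]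
    at h₁ h₂ ⊢
  field_simp

/-- Two approximants differ by at most ε on the affinoid, and their difference is again a rational
function without poles there, so Cauchy's estimate applies to it. -/
theorem evalDeriv_sub_bound {f : Hp p → ℂ_[p]} {N : ℕ} {ε : ℝ} {P₁ Q₁ P₂ Q₂ : (QpUr p)[X]}
    (h₁ : IsApprox f N ε P₁ Q₁) (h₂ : IsApprox f N ε P₂ Q₂) {z : Hp p}
    (hz : z ∈ affinoid p N) {t : ℂ_[p]} (ht0 : t ≠ 0) (ht : ‖t‖ < ((p : ℝ) ^ N)⁻¹) :
    ‖evalDeriv P₁ Q₁ z - evalDeriv P₂ Q₂ z‖ * ‖t‖ ≤ ε := by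
  rw [← evalDeriv_sub (h₁.1 z hz) (h₂.1 z hz)]
  refine (evalDeriv_bound (fun w hw => ?_) (fun w hw => ?_) hz ht0 ht).1
  · rw [evalK, eval₂_mul]
    exact mul_ne_zero (h₁.1 w hw) (h₂.1 w hw)
  · rw [evalK_sub_div (h₁.1 w hw) (h₂.1 w hw)]
    refine (norm_sub_le_max_sub _ (f w) _).trans (max_le ?_ (h₂.2 w hw))
    rw [norm_sub_rev]
    exact h₁.2 w hw

theorem hasDerivAt_of_quadratic_bound {F : ℂ_[p] → ℂ_[p]} {x d : ℂ_[p]} {r M : ℝ} (hr : 0 < r)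
    (hM : 0 ≤ M) (h : ∀ y, ‖y‖ ≤ r → ‖F (x + y) - F x - d * y‖ ≤ M * ‖y‖ ^ 2) :
    HasDerivAt F d x := by
  rw [hasDerivAt_iff_isLittleO_nhds_zero, Asymptotics.isLittleO_iff]
  intro c hc
  have hδ : 0 < min r (c / (M + 1)) := lt_min hr (by positivity)
  filter_upwards [Metric.closedBall_mem_nhds (0 : ℂ_[p]) hδ] with y hy
  rw [mem_closedBall_zero_iff, le_min_iff] at hy
  rw [smul_eq_mul, mul_comm y]
  refine (h y hy.1).trans ?_
  rw [sq, ← mul_assoc]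
  refine mul_le_mul_of_nonneg_right ?_ (norm_nonneg _)
  have h1 := hy.2
  rw [le_div_iff₀ (by positivity)] at h1
  nlinarith [norm_nonneg y]

/-- The derivatives of approximants form a Cauchy sequence. The second clause, valid for every
approximant, is what makes the derivative itself a uniform limit of rational functions. -/
theorem exists_hasDerivAt {f : Hp p → ℂ_[p]} (hf : f ∈ rigid p) {N : ℕ} {z : Hp p}
    (hz : z ∈ affinoid p N) {t : ℂ_[p]} (ht0 : t ≠ 0) (ht : ‖t‖ < ((p : ℝ) ^ N)⁻¹) :
    ∃ d, HasDerivAt (extendZero f) d z.val ∧ ∀ (ε : ℝ) (P Q : (QpUr p)[X]), 0 < ε →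
      IsApprox f N ε P Q → ‖d - evalDeriv P Q z‖ * ‖t‖ ≤ ε := by
  have ht' : 0 < ‖t‖ := norm_pos_iff.2 ht0
  have hmono : ∀ {ε δ : ℝ} {P Q : (QpUr p)[X]}, ε ≤ δ → IsApprox f N ε P Q → IsApprox f N δ P Q :=
    fun h hA => ⟨hA.1, fun w hw => (hA.2 w hw).trans h⟩
  have hex : ∀ k : ℕ, ∃ P Q : (QpUr p)[X], IsApprox f N ((1 / 2 : ℝ) ^ k) P Q := fun k =>
    hf N _ (by positivity)
  choose P Q hPQ using hex
  have hanti : ∀ {k l : ℕ}, k ≤ l → (1 / 2 : ℝ) ^ l ≤ (1 / 2 : ℝ) ^ k := fun h =>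
    pow_le_pow_of_le_one (by norm_num) (by norm_num) h
  have hlim : Filter.Tendsto (fun k : ℕ => (1 / 2 : ℝ) ^ k) Filter.atTop (nhds 0) :=
    tendsto_pow_atTop_nhds_zero_of_lt_one (by norm_num) (by norm_num)
  have hc : CauchySeq fun k => evalDeriv (P k) (Q k) z := by
    refine cauchySeq_of_le_tendsto_0 (fun k => (1 / 2 : ℝ) ^ k / ‖t‖) (fun k l m hk hl => ?_) ?_
    · rw [dist_eq_norm, le_div_iff₀ ht']
      exact evalDeriv_sub_bound (hmono (hanti hk) (hPQ k)) (hmono (hanti hl) (hPQ l)) hz ht0 ht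
    · simpa using hlim.div_const ‖t‖
  obtain ⟨d, hd⟩ := cauchySeq_tendsto_of_complete hc
  have hd' : ∀ (ε : ℝ) (P Q : (QpUr p)[X]), 0 < ε →
      IsApprox f N ε P Q → ‖d - evalDeriv P Q z‖ * ‖t‖ ≤ ε := by
    intro ε P₁ Q₁ hε hA
    refine le_of_tendsto ((hd.sub_const _).norm.mul_const ‖t‖) ?_
    filter_upwards [hlim.eventually_le_const hε] with k hk
    exact evalDeriv_sub_bound (hmono hk (hPQ k)) hA hz ht0 ht
  obtain ⟨B, hB⟩ := exists_bound_affinoid hf N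
  have hB0 : 0 ≤ max B 1 := zero_le_one.trans (le_max_right _ _)
  refine ⟨d, hasDerivAt_of_quadratic_bound ht' (M := max B 1 / ‖t‖ ^ 2) (by positivity)
    fun y hy => ?_, hd'⟩
  obtain ⟨w, hw, hwe⟩ := exists_add_mem_affinoid hz (hy.trans_lt ht)
  have hy' : y = w.val - z.val := by rw [hwe, add_sub_cancel_left]
  rw [← hwe, extendZero_val, extendZero_val]
  -- If the quadratic bound failed at y, an approximant closer than the size of the remainder would
  -- have the same remainder up to a smaller error, contradicting its own Taylor bound.
  by_contra! hlt
  have hX : 0 < ‖f w - f z - d * y‖ := lt_of_le_of_lt (by positivity) hlt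
  obtain ⟨k, hk⟩ := ((hlim.eventually_lt_const (lt_min hX one_pos))).exists
  rw [lt_min_iff] at hk
  have hA := hPQ k
  have h1 := (evalDeriv_bound hA.1 (M := max B 1) (fun x hx => by
    have := norm_sub_le_max (f x) (f x - evalK (P k) x / evalK (Q k) x)
    rw [sub_sub_cancel] at this
    exact this.trans (max_le_max (hB x hx) ((hA.2 x hx).trans hk.2.le))) hz ht0 ht).2 w hw
      (by rw [← hy']; exact hy)
  rw [← hy'] at h1
  have h2 : ‖(d - evalDeriv (P k) (Q k) z) * y‖ ≤ (1 / 2 : ℝ) ^ k := by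
    rw [norm_mul]
    exact (mul_le_mul_of_nonneg_left hy (norm_nonneg _)).trans
      (hd' _ _ _ (by positivity) hA)
  have e : f w - f z - d * y = (f w - evalK (P k) w / evalK (Q k) w) -
      (f z - evalK (P k) z / evalK (Q k) z) - (d - evalDeriv (P k) (Q k) z) * y +
      (evalK (P k) w / evalK (Q k) w - evalK (P k) z / evalK (Q k) z -
        evalDeriv (P k) (Q k) z * y) := by ring
  have h3 : ‖f w - f z - d * y‖ ≤ max ((1 / 2 : ℝ) ^ k) (max B 1 * (‖y‖ / ‖t‖) ^ 2) := by
    rw [e]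
    refine (PadicComplex.isNonarchimedean p _ _).trans (max_le_max ?_ h1)
    refine (norm_sub_le_max _ _).trans (max_le ((norm_sub_le_max _ _).trans (max_le ?_ ?_)) h2)
    · exact hA.2 w hw
    · exact hA.2 z hz
  rcases le_max_iff.1 h3 with h | h
  · exact absurd h (not_le.2 hk.1)
  · refine absurd h (not_le.2 (lt_of_eq_of_lt ?_ hlt))
    rw [div_pow]
    ring

/-- Analytic functions on `H_p` have analytic derivatives. -/
theorem exists_rigid_derivative {f : Hp p → ℂ_[p]} (hf : f ∈ rigid p) :
    ∃ f' ∈ rigid p, ∀ z : Hp p, HasDerivAt (extendZero f) (f' z) z.val := by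
  have ht : ∀ N : ℕ, ∃ t : ℂ_[p], t ≠ 0 ∧ ‖t‖ < ((p : ℝ) ^ N)⁻¹ := by
    intro N
    have hp0 : (p : ℚ_[p]) ≠ 0 := by exact_mod_cast (Fact.out : p.Prime).ne_zero
    refine ⟨algebraMap ℚ_[p] ℂ_[p] ((p : ℚ_[p]) ^ ((N : ℤ) + 1)),
      (_root_.map_ne_zero _).2 (zpow_ne_zero _ hp0), ?_⟩
    rw [norm_algebraMap', Padic.norm_p_zpow, ← zpow_natCast, ← zpow_neg]
    exact zpow_lt_zpow_right₀ one_lt_prime_real (by omega)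
  choose t ht0 ht using ht
  have hex : ∀ z : Hp p, ∃ d, HasDerivAt (extendZero f) d z.val := fun z => by
    obtain ⟨N, hN⟩ := exists_mem_affinoid z
    obtain ⟨d, hd, -⟩ := exists_hasDerivAt hf hN (ht0 N) (ht N)
    exact ⟨d, hd⟩
  choose f' hf' using hex
  refine ⟨f', fun N ε hε => ?_, hf'⟩
  have ht' : 0 < ‖t N‖ := norm_pos_iff.2 (ht0 N)
  obtain ⟨P, Q, hA⟩ := hf N (ε * ‖t N‖) (by positivity)
  refine ⟨derivative P * Q - P * derivative Q, Q * Q, fun z hz => ?_, fun z hz => ?_⟩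
  · rw [evalK, eval₂_mul]
    exact mul_ne_zero (hA.1 z hz) (hA.1 z hz)
  · obtain ⟨d, hd, hd'⟩ := exists_hasDerivAt hf hz (ht0 N) (ht N)
    rw [(hf' z).unique hd]
    exact le_of_mul_le_mul_right (hd' _ P Q (by positivity) hA) ht'

/-! ### Compatibility of the connection with the group action -/

theorem eventually_mem_Hp (z : Hp p) : ∀ᶠ x in nhds z.val, ∃ w : Hp p, w.val = x := by
  filter_upwards [isClosed_range_algebraMap.isOpen_compl.mem_nhds z.2] with x hx
  exact ⟨⟨x, hx⟩, rfl⟩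

/-- The chain rule for `z ↦ f (γ z)`. -/
theorem hasDerivAt_comp_smul {f : Hp p → ℂ_[p]} {γ : SL(2, ℚ_[p])} {z : Hp p} {d : ℂ_[p]}
    (h : HasDerivAt (extendZero f) d (γ • z).val) :
    HasDerivAt (extendZero fun w => f (γ • w)) ((denom γ z ^ 2)⁻¹ * d) z.val := by
  have hd := denom_ne_zero γ z
  have h1 : HasDerivAt (fun x => (algebraMap ℚ_[p] ℂ_[p] (γ 0 0) * x +
      algebraMap ℚ_[p] ℂ_[p] (γ 0 1)) / (algebraMap ℚ_[p] ℂ_[p] (γ 1 0) * x +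
      algebraMap ℚ_[p] ℂ_[p] (γ 1 1))) ((denom γ z ^ 2)⁻¹) z.val := by
    have := (((hasDerivAt_id z.val).const_mul (algebraMap ℚ_[p] ℂ_[p] (γ 0 0))).add_const
      (algebraMap ℚ_[p] ℂ_[p] (γ 0 1))).div
      (((hasDerivAt_id z.val).const_mul (algebraMap ℚ_[p] ℂ_[p] (γ 1 0))).add_const
      (algebraMap ℚ_[p] ℂ_[p] (γ 1 1))) hd
    refine this.congr_deriv ?_
    have hdet : algebraMap ℚ_[p] ℂ_[p] (γ 0 0 * γ 1 1 - γ 0 1 * γ 1 0) = 1 := by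
      rw [det_eq, map_one]
    change _ / denom γ z ^ 2 = _
    rw [← one_div]
    congr 1
    simp only [map_sub, map_mul, id] at hdet ⊢
    linear_combination hdet
  have h2 := HasDerivAt.comp z.val (h₂ := extendZero f) h h1
  rw [mul_comm] at h2
  refine h2.congr_of_eventuallyEq ?_
  filter_upwards [eventually_mem_Hp z] with x hx
  obtain ⟨w, rfl⟩ := hx
  rw [extendZero_val, ← extendZero_val f]
  rfl

theorem IsNabla.secAct {n : ℕ} {s t : Sec p n} (h : IsNabla s t) (γ : SL(2, ℚ_[p])) :
    IsNabla (secAct n γ s) (formAct n γ t) := fun P z =>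
  hasDerivAt_comp_smul (γ := γ⁻¹) (f := fun w => s w (polyAct n γ P)) (h (polyAct n γ P) (γ⁻¹ • z))

theorem secAct_mem_anSec {n : ℕ} {s : Sec p n} (hs : s ∈ anSec p n) (γ : SL(2, ℚ_[p])) :
    secAct n γ s ∈ anSec p n := fun P =>
  rigid_comp_smul (f := fun w => s w (polyAct n γ P)) (hs (polyAct n γ P)) γ⁻¹

theorem IsNabla.neg {n : ℕ} {s t : Sec p n} (h : IsNabla s t) : IsNabla (-s) (-t) := by
  simpa using h.smul (-1)

theorem IsNabla.sub {n : ℕ} {s t s' t' : Sec p n} (h : IsNabla s t) (h' : IsNabla s' t') :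
    IsNabla (s - s') (t - t') := by
  simpa only [sub_eq_add_neg] using h.add h'.neg

/-! ### Components of sections with respect to powers of `X - z` -/

section Components

variable {n : ℕ}

/-- The monomial `X ^ i` in `𝒫_n`. -/
def mono (n : ℕ) (i : Fin (n + 1)) : Poly p n :=
  ⟨X ^ (i : ℕ), mem_degreeLE.2 ((degree_X_pow_le _).trans (by exact_mod_cast i.is_le))⟩

theorem natDegree_le_of_mem (P : Poly p n) : (P : ℚ_[p][X]).natDegree ≤ n :=
  natDegree_le_of_degree_le (mem_degreeLE.1 P.2)

theorem eq_sum_mono (P : Poly p n) :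
    P = ∑ i : Fin (n + 1), (P : ℚ_[p][X]).coeff i • mono n i := by
  apply Subtype.ext
  rw [AddSubmonoidClass.coe_finsetSum]
  simp only [Submodule.coe_smul, mono, smul_eq_C_mul]
  rw [Fin.sum_univ_eq_sum_range (fun i => C ((P : ℚ_[p][X]).coeff i) * X ^ i)]
  exact as_sum_range_C_mul_X_pow' _ (Nat.lt_succ_of_le (natDegree_le_of_mem P))

/-- The extension of `R ∈ V_n ⊗ ℂ_p` to polynomials over `ℂ_p`. -/
def extLin (R : Vn p n) : ℂ_[p][X] →ₗ[ℂ_[p]] ℂ_[p] :=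
  ∑ i : Fin (n + 1), R (mono n i) • lcoeff ℂ_[p] i

theorem extLin_apply (R : Vn p n) (P : ℂ_[p][X]) :
    extLin R P = ∑ i : Fin (n + 1), P.coeff i * R (mono n i) := by
  simp [extLin, mul_comm]

theorem extLin_C_mul (R : Vn p n) (a : ℂ_[p]) (P : ℂ_[p][X]) :
    extLin R (C a * P) = a * extLin R P := by
  rw [← smul_eq_C_mul, map_smul, smul_eq_mul]

theorem extLin_map (R : Vn p n) (P : Poly p n) :
    extLin R ((P : ℚ_[p][X]).map (algebraMap ℚ_[p] ℂ_[p])) = R P := by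
  conv_rhs => rw [eq_sum_mono P]
  simp [extLin_apply, Algebra.smul_def]

/-- The component `z ↦ s(z)((X - z) ^ m)` of a section `s`. -/
def comp (m : ℕ) (s : Sec p n) (z : Hp p) : ℂ_[p] := extLin (s z) ((X - C z.val) ^ m)

theorem coeff_X_sub_C_pow (x : ℂ_[p]) (m k : ℕ) :
    ((X - C x) ^ m).coeff k = (-x) ^ (m - k) * (m.choose k : ℂ_[p]) := by
  rw [sub_eq_add_neg, ← C_neg, coeff_X_add_C_pow]

theorem comp_apply (m : ℕ) (s : Sec p n) (z : Hp p) : comp m s z =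
    ∑ i : Fin (n + 1), (-z.val) ^ (m - i) * (m.choose i : ℂ_[p]) * s z (mono n i) := by
  rw [comp, extLin_apply]
  refine Finset.sum_congr rfl fun i _ => ?_
  rw [coeff_X_sub_C_pow]

theorem comp_sub (m : ℕ) (s t : Sec p n) : comp m (s - t) = comp m s - comp m t := by
  funext z
  simp [comp_apply, mul_sub, Finset.sum_sub_distrib]

/-- By Taylor expansion at z, the powers (X - z)^m with m ≤ n span the polynomials of degree at most
n over ℂ_p. -/
theorem eq_zero_of_comp_eq_zero {s : Sec p n} (h : ∀ m ≤ n, comp m s = 0) : s = 0 := by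
  funext z
  ext P
  rw [Pi.zero_apply, LinearMap.zero_apply, ← extLin_map,
    ← sum_taylor_eq ((P : ℚ_[p][X]).map (algebraMap ℚ_[p] ℂ_[p])) z.val, Polynomial.sum_def,
    map_sum]
  refine Finset.sum_eq_zero fun m hm => ?_
  have hm' : m ≤ n := by
    refine (le_natDegree_of_mem_supp _ hm).trans ?_
    rw [natDegree_taylor]
    exact natDegree_map_le.trans (natDegree_le_of_mem P)
  have := congrFun (h m hm') z
  rw [comp, Pi.zero_apply] at this
  rw [extLin_C_mul, this, mul_zero]

theorem coord_mem_rigid : (fun z : Hp p => z.val) ∈ rigid p := by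
  have h := evalQ_mem (p := p) (X : ℚ_[p][X])
  have e : (evalQ (X : ℚ_[p][X]) : Hp p → ℂ_[p]) = fun z => z.val := by
    funext z
    simp [evalQ]
  rwa [e] at h

theorem const_mem_rigid (a : ℚ_[p]) : (fun _ : Hp p => algebraMap ℚ_[p] ℂ_[p] a) ∈ rigid p := by
  have h := evalQ_mem (p := p) (C a : ℚ_[p][X])
  have e : (evalQ (C a : ℚ_[p][X]) : Hp p → ℂ_[p]) = fun _ => algebraMap ℚ_[p] ℂ_[p] a := by
    funext z
    simp [evalQ]
  rwa [e] at h

theorem comp_mem_rigid (m : ℕ) {s : Sec p n} (hs : s ∈ anSec p n) : comp m s ∈ rigid p := by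
  have e : comp m s = ∑ i : Fin (n + 1), (-(fun z : Hp p => z.val)) ^ (m - i) *
      (m.choose i : Hp p → ℂ_[p]) * fun z => s z (mono n i) := by
    funext z
    rw [comp_apply, Finset.sum_apply]
    rfl
  rw [e]
  exact sum_mem fun i _ => mul_mem (mul_mem (pow_mem (neg_mem coord_mem_rigid) _)
    (natCast_mem _ _)) (hs _)

/-- The derivative of a component. -/
theorem IsNabla.hasDerivAt_comp {s t : Sec p n} (h : IsNabla s t) (m : ℕ) (z : Hp p) :
    HasDerivAt (extendZero (comp m s)) (comp m t z - m * comp (m - 1) s z) z.val := by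
  have e : extendZero (comp m s) = fun x => ∑ i : Fin (n + 1),
      ((-x) ^ (m - i) * (m.choose i : ℂ_[p])) * extendZero (fun w => s w (mono n i)) x := by
    funext x
    by_cases hx : ∃ w : Hp p, w.val = x
    · obtain ⟨w, rfl⟩ := hx
      simp only [extendZero_val, comp_apply]
    · simp only [extendZero, Function.extend_apply' _ _ _ hx, Pi.zero_apply, mul_zero,
        Finset.sum_const_zero]
  have h1 : ∀ i : Fin (n + 1), HasDerivAt (fun x : ℂ_[p] => (-x) ^ (m - i) * (m.choose i : ℂ_[p]))
      (-(m * ((-z.val) ^ (m - 1 - i) * ((m - 1).choose i : ℂ_[p])))) z.val := by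
    intro i
    have := (((hasDerivAt_id z.val).neg).pow (m - i)).mul_const (m.choose i : ℂ_[p])
    refine this.congr_deriv ?_
    -- For m = 0 both sides carry the factor 0, so the truncated subtraction m - 1 is harmless.
    rcases Nat.eq_zero_or_pos m with rfl | hm
    · simp
    obtain ⟨m, rfl⟩ : ∃ k, m = k + 1 := ⟨m - 1, by omega⟩
    have h2 : ((m + 1 - i : ℕ) : ℂ_[p]) * ((m + 1).choose i : ℂ_[p]) =
        ((m + 1 : ℕ) : ℂ_[p]) * (m.choose i : ℂ_[p]) := by
      exact_mod_cast by
        rw [mul_comm, mul_comm (m + 1)]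
        exact (Nat.choose_mul_succ_eq m i).symm
    have h3 : m + 1 - (i : ℕ) - 1 = m + 1 - 1 - i := by omega
    simp only [Pi.neg_apply, id, h3]
    rw [Nat.add_sub_cancel]
    linear_combination (-(-z.val) ^ (m - i)) * h2
  rw [e]
  refine (HasDerivAt.fun_sum fun i _ => (h1 i).mul (h (mono n i) z)).congr_deriv ?_
  rw [comp_apply, comp_apply, Finset.mul_sum, ← Finset.sum_sub_distrib]
  refine Finset.sum_congr rfl fun i _ => ?_
  rw [extendZero_val]
  ring

/-! ### Sections with prescribed components -/

theorem map_hasseDeriv (m : ℕ) (P : ℚ_[p][X]) (f : ℚ_[p] →+* ℂ_[p]) :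
    (hasseDeriv m P).map f = hasseDeriv m (P.map f) := by
  ext k
  simp [hasseDeriv_coeff]

/-- The section with given components. -/
def ofComp (n : ℕ) (c : ℕ → Hp p → ℂ_[p]) : Sec p n := fun z =>
  { toFun := fun P => ∑ m ∈ Finset.range (n + 1), evalQ (hasseDeriv m (P : ℚ_[p][X])) z * c m z
    map_add' := fun P Q => by
      simp only [Submodule.coe_add, map_add, evalQ, eval₂_add, add_mul, Finset.sum_add_distrib]
    map_smul' := fun a P => by
      simp only [Submodule.coe_smul, map_smul]
      simp only [evalQ, smul_eq_C_mul, eval₂_mul, eval₂_C, mul_assoc, ← Finset.mul_sum,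
        RingHom.id_apply]
      rw [Algebra.smul_def] }

theorem ofComp_apply (c : ℕ → Hp p → ℂ_[p]) (z : Hp p) (P : Poly p n) : ofComp n c z P =
    ∑ m ∈ Finset.range (n + 1), evalQ (hasseDeriv m (P : ℚ_[p][X])) z * c m z := rfl

theorem ofComp_mem {c : ℕ → Hp p → ℂ_[p]} (hc : ∀ m, c m ∈ rigid p) : ofComp n c ∈ anSec p n := by
  intro P
  have e : (fun z => ofComp n c z P) = ∑ m ∈ Finset.range (n + 1),
      evalQ (hasseDeriv m (P : ℚ_[p][X])) * c m := by
    funext z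
    rw [ofComp_apply, Finset.sum_apply]
    rfl
  rw [e]
  exact sum_mem fun m _ => mul_mem (evalQ_mem _) (hc m)

/-- The values of the Hasse derivatives at z are the Taylor coefficients there, and (X - z)^m has
only the m-th one. -/
theorem comp_ofComp (c : ℕ → Hp p → ℂ_[p]) {m : ℕ} (hm : m ≤ n) : comp m (ofComp n c) = c m := by
  funext z
  have h : ∀ P : ℂ_[p][X], P.natDegree ≤ n → extLin (ofComp n c z) P =
      ∑ k ∈ Finset.range (n + 1), (taylor z.val P).coeff k * c k z := by
    intro P hP
    have hlin : ∀ (i : Fin (n + 1)), ofComp n c z (mono n i) =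
        ∑ k ∈ Finset.range (n + 1), (taylor z.val (X ^ (i : ℕ) : ℂ_[p][X])).coeff k * c k z := by
      intro i
      rw [ofComp_apply]
      refine Finset.sum_congr rfl fun k _ => ?_
      rw [taylor_coeff, evalQ, ← eval_map, map_hasseDeriv, mono, Polynomial.map_pow, map_X]
    rw [extLin_apply]
    conv_rhs => rw [as_sum_range_C_mul_X_pow' P (Nat.lt_succ_of_le hP)]
    simp only [hlin, Finset.mul_sum, map_sum, finsetSum_coeff, Finset.sum_mul]
    rw [Finset.sum_comm]
    refine Finset.sum_congr rfl fun k _ => ?_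
    rw [← Fin.sum_univ_eq_sum_range
      (fun i => (taylor z.val (C (P.coeff i) * X ^ i)).coeff k * c k z)]
    refine Finset.sum_congr rfl fun i _ => ?_
    rw [taylor_mul, taylor_C, coeff_C_mul, mul_assoc]
  rw [comp, h _ ((natDegree_pow_le).trans (by rw [natDegree_X_sub_C, mul_one]; exact hm))]
  have ht : taylor z.val ((X - C z.val) ^ m) = X ^ m := by
    rw [taylor_pow, map_sub, taylor_X, taylor_C, add_sub_cancel_right]
  simp only [ht, coeff_X_pow, ite_mul, one_mul, zero_mul]
  rw [Finset.sum_ite_eq' (Finset.range (n + 1)) m, if_pos (Finset.mem_range.2 (by omega))]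

theorem omegaSec_eq_ofComp (f : Hp p → ℂ_[p]) :
    omegaSec n f = ofComp n fun m => if m = 0 then f else 0 := by
  funext z
  ext P
  rw [ofComp_apply, Finset.sum_eq_single_of_mem 0 (Finset.mem_range.2 (by omega))]
  · rw [if_pos rfl, hasseDeriv_zero', mul_comm]
    rfl
  · intro m _ hm
    rw [if_neg hm, Pi.zero_apply, mul_zero]

theorem comp_omegaSec (f : Hp p → ℂ_[p]) {m : ℕ} (hm : m ≤ n) :
    comp m (omegaSec n f) = if m = 0 then f else 0 := by
  rw [omegaSec_eq_ofComp, comp_ofComp _ hm]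

/-- ∂⁰(z) takes the value 1 on (X - z)^0 and kills all higher powers, so it spans the functionals
with only the component m = 0. -/
theorem eq_omegaSec {t : Sec p n} (h : ∀ m ≤ n, m ≠ 0 → comp m t = 0) :
    t = omegaSec n (comp 0 t) := by
  rw [← sub_eq_zero]
  refine eq_zero_of_comp_eq_zero fun m hm => ?_
  rw [comp_sub, comp_omegaSec _ hm]
  split_ifs with h0
  · rw [h0, sub_self]
  · rw [h m hm h0, sub_zero]

theorem map_polyAct_mono (γ : SL(2, ℚ_[p])) (i : Fin (n + 1)) :
    (polyAct n γ (mono n i) : ℚ_[p][X]).map (algebraMap ℚ_[p] ℂ_[p]) =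
      (C (algebraMap ℚ_[p] ℂ_[p] (γ 0 0)) * X + C (algebraMap ℚ_[p] ℂ_[p] (γ 0 1))) ^ (i : ℕ) *
      (C (algebraMap ℚ_[p] ℂ_[p] (γ 1 0)) * X + C (algebraMap ℚ_[p] ℂ_[p] (γ 1 1))) ^
        (n - (i : ℕ)) := by
  change (polyActAux n γ (X ^ (i : ℕ))).map _ = _
  rw [polyActAux, Finset.sum_eq_single_of_mem (i : ℕ) (Finset.mem_range.2 i.2)]
  · simp
  · intro k _ hk
    rw [coeff_X_pow, if_neg hk, C_0, zero_mul, zero_mul]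

/-- The top component of a section is a form of weight `-n`. -/
theorem comp_secAct (γ : SL(2, ℚ_[p])) (s : Sec p n) (w : Hp p) :
    denom γ w ^ n * comp n (secAct n γ s) (γ • w) = comp n s w := by
  have hd := denom_ne_zero γ w
  have e : secAct n γ s (γ • w) = rho n γ (s w) := by
    change rho n γ (s (γ⁻¹ • γ • w)) = _
    rw [inv_smul_smul]
  have hdet : algebraMap ℚ_[p] ℂ_[p] (γ 0 0 * γ 1 1 - γ 0 1 * γ 1 0) = 1 := by
    rw [det_eq, map_one]
  simp only [map_sub, map_mul] at hdet
  have hpoly : ∀ (U V : ℂ_[p][X]) (x : ℂ_[p]), ∑ i : Fin (n + 1), C (((X - C x) ^ n).coeff i) *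
      (U ^ (i : ℕ) * V ^ (n - (i : ℕ))) = (U + C (-x) * V) ^ n := by
    intro U V x
    have h := Fin.sum_univ_eq_sum_range (fun i : ℕ => (C (((X - C x : ℂ_[p][X]) ^ n).coeff i) *
      (U ^ i * V ^ (n - i)) : ℂ_[p][X])) (n + 1)
    rw [h, add_pow]
    refine Finset.sum_congr rfl fun i _ => ?_
    rw [coeff_X_sub_C_pow, C_mul, C_pow, C_eq_natCast, mul_pow]
    ring
  -- The identity (aX + b) - γw (cX + d) = (cw + d)⁻¹ (X - w), whose n-th power is the
  -- transformation law.
  have h1 : (C (algebraMap ℚ_[p] ℂ_[p] (γ 0 0)) * X + C (algebraMap ℚ_[p] ℂ_[p] (γ 0 1))) +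
      C (-(γ • w).val) * (C (algebraMap ℚ_[p] ℂ_[p] (γ 1 0)) * X +
        C (algebraMap ℚ_[p] ℂ_[p] (γ 1 1))) = C ((denom γ w)⁻¹) * (X - C w.val) := by
    have h2 : algebraMap ℚ_[p] ℂ_[p] (γ 0 0) - (γ • w).val * algebraMap ℚ_[p] ℂ_[p] (γ 1 0) =
        (denom γ w)⁻¹ := by
      refine eq_inv_of_mul_eq_one_left ?_
      rw [smul_val, sub_mul, mul_right_comm, div_mul_cancel₀ _ hd]
      simp only [num, denom]
      linear_combination hdet
    have h3 : algebraMap ℚ_[p] ℂ_[p] (γ 0 1) - (γ • w).val * algebraMap ℚ_[p] ℂ_[p] (γ 1 1) =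
        -((denom γ w)⁻¹ * w.val) := by
      rw [smul_val]
      field_simp
      simp only [num, denom]
      linear_combination -w.val * hdet
    rw [mul_sub, ← C_mul, sub_eq_add_neg, ← C_neg, ← h3, ← h2]
    simp only [C_sub, C_mul, C_neg]
    ring
  have h4 : extLin (rho n γ (s w)) ((X - C (γ • w).val) ^ n) =
      extLin (s w) (C ((denom γ w)⁻¹ ^ n) * (X - C w.val) ^ n) := by
    rw [C_pow, ← mul_pow, ← h1, ← hpoly, map_sum, extLin_apply]
    refine Finset.sum_congr rfl fun i _ => ?_
    rw [extLin_C_mul, ← map_polyAct_mono, extLin_map]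
    rfl
  rw [comp, comp, e, h4, extLin_C_mul, ← mul_assoc, ← mul_pow, mul_inv_cancel₀ hd, one_pow,
    one_mul]

/-! ### The filtration in terms of components -/

/-- `mulPoly` of a family of monomials. -/
theorem mulPoly_ite (S : Finset (Fin n)) :
    mulPoly p n (fun i => if i ∈ S then polyX else polyOne) =
      mono n ⟨S.card, Nat.lt_succ_of_le ((Finset.card_le_univ S).trans_eq (Fintype.card_fin n))⟩ :=
    by
  apply Subtype.ext
  change ∏ i, ((if i ∈ S then polyX else polyOne : Poly p 1) : ℚ_[p][X]) = X ^ S.card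
  have : ∀ i, ((if i ∈ S then polyX else polyOne : Poly p 1) : ℚ_[p][X]) =
      if i ∈ S then X else 1 := fun i => by split_ifs <;> rfl
  simp only [this, Finset.prod_ite_mem, Finset.univ_inter, Finset.prod_const]

/-- The analogue of `comp` for tensors. -/
def tensorComp (A : Finset (Fin n)) (T : TensorSec p n) (z : Hp p) : ℂ_[p] :=
  ∑ S ∈ A.powerset, (-z.val) ^ (A.card - S.card) *
    T z fun i => if i ∈ S then polyX else polyOne

/-- `tensorComp A` evaluates a multilinear form on X - z in the places of A and on 1 elsewhere,
expanded over subsets. The product of these entries is (X - z)^|A|, and grouping subsets by size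
gives the binomial expansion. -/
theorem tensorComp_toTensor (A : Finset (Fin n)) (s : Sec p n) :
    tensorComp A (toTensor p n s) = comp A.card s := by
  funext z
  have hA : A.card ≤ n := (Finset.card_le_univ A).trans_eq (Fintype.card_fin n)
  have h : ∀ S ∈ A.powerset, (-z.val) ^ (A.card - S.card) *
      toTensor p n s z (fun i => if i ∈ S then polyX else polyOne) =
      (fun k : ℕ => (-z.val) ^ (A.card - k) *
        if h : k < n + 1 then s z (mono n ⟨k, h⟩) else 0) S.card := by
    intro S hS
    have hSn : S.card < n + 1 :=
      Nat.lt_succ_of_le ((Finset.card_le_card (Finset.mem_powerset.1 hS)).trans hA)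
    change _ * s z (mulPoly p n _) = _
    rw [mulPoly_ite]
    simp only [dif_pos hSn]
  rw [tensorComp, Finset.sum_congr rfl h, Finset.sum_powerset_apply_card
    (fun k : ℕ => (-z.val) ^ (A.card - k) * if h : k < n + 1 then s z (mono n ⟨k, h⟩) else 0),
    comp_apply]
  have h2 := Fin.sum_univ_eq_sum_range (fun k : ℕ => (-z.val) ^ (A.card - k) *
    (A.card.choose k : ℂ_[p]) * if h : k < n + 1 then s z (mono n ⟨k, h⟩) else 0) (n + 1)
  have h3 : ∀ i : Fin (n + 1), (-z.val) ^ (A.card - (i : ℕ)) *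
      (A.card.choose i : ℂ_[p]) * s z (mono n i) = (-z.val) ^ (A.card - (i : ℕ)) *
      (A.card.choose i : ℂ_[p]) * if h : (i : ℕ) < n + 1 then s z (mono n ⟨i, h⟩) else 0 := by
    intro i
    rw [dif_pos i.2]
  rw [Finset.sum_congr rfl fun i _ => h3 i, h2]
  have hsub : Finset.range (A.card + 1) ⊆ Finset.range (n + 1) :=
    Finset.range_subset_range.2 (by omega)
  rw [← Finset.sum_subset hsub]
  · refine Finset.sum_congr rfl fun k _ => ?_
    rw [nsmul_eq_mul]
    ring
  · intro k _ hk
    rw [Finset.mem_range, not_lt] at hk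
    rw [Nat.choose_eq_zero_of_lt (by omega), Nat.cast_zero, mul_zero, zero_mul]

theorem tensorComp_pure (A : Finset (Fin n)) {T : TensorSec p n} {z : Hp p} {a : ℂ_[p]}
    {ℓ : Fin n → Vn p 1} (h : ∀ P, T z P = a * ∏ i, ℓ i (P i)) :
    tensorComp A T z = a * ((∏ i ∈ A, (ℓ i polyX - z.val * ℓ i polyOne)) *
      ∏ i ∈ Aᶜ, ℓ i polyOne) := by
  have h1 : ∏ i ∈ A, (ℓ i polyX - z.val * ℓ i polyOne) =
      ∏ i ∈ A, (ℓ i polyX + -z.val * ℓ i polyOne) :=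
    Finset.prod_congr rfl fun i _ => by ring
  rw [h1, Finset.prod_add, tensorComp, Finset.sum_mul, Finset.mul_sum]
  refine Finset.sum_congr rfl fun S hS => ?_
  have hSA := Finset.mem_powerset.1 hS
  have h2 : ∏ i, ℓ i (if i ∈ S then polyX else polyOne) =
      (∏ i ∈ S, ℓ i polyX) * (∏ i ∈ A \ S, ℓ i polyOne) * ∏ i ∈ Aᶜ, ℓ i polyOne := by
    rw [← Finset.prod_mul_prod_compl A, ← Finset.prod_sdiff hSA,
      mul_comm (∏ i ∈ A \ S, _) (∏ i ∈ S, _)]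
    congr 1
    · congr 1
      · exact Finset.prod_congr rfl fun i hi => by rw [if_pos hi]
      · exact Finset.prod_congr rfl fun i hi => by rw [if_neg (Finset.mem_sdiff.1 hi).2]
    · exact Finset.prod_congr rfl fun i hi => by
        rw [if_neg fun hi' => Finset.mem_compl.1 hi (hSA hi')]
  rw [h, h2, Finset.prod_mul_distrib, Finset.prod_const, Finset.card_sdiff_of_subset hSA]
  ring

/-- For a pure tensor with degrees d_i ≤ 1 and sum at least j > n - |A|, some i in A must have d_i =
1; its factor lies in the kernel of evaluation at X - z. A degree d_i ≥ 2 forces the factor to be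
zero. -/
theorem tensorComp_eq_zero {j : ℤ} {T : TensorSec p n} (hT : T ∈ filTensor p n j)
    {A : Finset (Fin n)} (hA : (n : ℤ) - A.card < j) : tensorComp A T = 0 := by
  induction hT using Submodule.span_induction with
  | zero => funext z; simp [tensorComp]
  | add T U _ _ hT hU =>
    funext z
    have h1 := congrFun hT z
    have h2 := congrFun hU z
    simp only [tensorComp, Pi.add_apply, add_apply, mul_add,
      Finset.sum_add_distrib, Pi.zero_apply] at h1 h2 ⊢
    rw [h1, h2, add_zero]
  | smul c T _ hT =>
    funext z
    have h1 := congrFun hT z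
    have e : tensorComp A (c • T) z = (c : ℂ_[p]) * tensorComp A T z := by
      rw [tensorComp, tensorComp, Finset.mul_sum]
      refine Finset.sum_congr rfl fun S _ => ?_
      change _ * ((c : ℂ_[p]) * _) = _
      ring
    rw [e, h1, Pi.zero_apply, mul_zero]
  | mem T hT =>
    obtain ⟨a, -, ℓ, d, hd, hℓ, h⟩ := hT
    funext z
    rw [tensorComp_pure A (a := a z) (ℓ := fun i => ℓ i z) (fun P => h z P), Pi.zero_apply]
    by_cases h2 : ∃ i, 2 ≤ d i
    · obtain ⟨i, hi⟩ := h2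
      have h0 : ℓ i = 0 := by
        have := hℓ i
        rwa [filOne, if_neg (by omega), if_neg (by omega), Submodule.mem_bot] at this
      by_cases hiA : i ∈ A
      · rw [Finset.prod_eq_zero hiA (by simp [h0]), zero_mul, mul_zero]
      · rw [Finset.prod_eq_zero (Finset.mem_compl.2 hiA) (by simp [h0]), mul_zero, mul_zero]
    push Not at h2
    by_cases h1 : ∃ i ∈ A, d i = 1
    · obtain ⟨i, hiA, hi⟩ := h1
      have hk := hℓ i
      rw [filOne, if_neg (by omega), if_pos hi] at hk
      rw [Finset.prod_eq_zero hiA (hk.2 z), zero_mul, mul_zero]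
    · push Not at h1
      exfalso
      have h3 : ∑ i, d i ≤ ∑ i, (if i ∈ A then (0 : ℤ) else 1) := by
        refine Finset.sum_le_sum fun i _ => ?_
        have := h2 i
        split_ifs with hi
        · have := h1 i hi
          omega
        · omega
      have h4 : ∑ i, (if i ∈ A then (0 : ℤ) else 1) = n - A.card := by
        have : ∀ i, (if i ∈ A then (0 : ℤ) else 1) = 1 - if i ∈ A then 1 else 0 := fun i => by
          split_ifs <;> rfl
        simp [this, Finset.sum_sub_distrib]
      omega

/-- The section `P ↦ P'` of `V_1 ⊗ 𝒪`. -/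
def slope : Sec p 1 := fun _ =>
  { toFun := fun P => algebraMap ℚ_[p] ℂ_[p] ((P : ℚ_[p][X]).coeff 1)
    map_add' := fun P Q => by simp
    map_smul' := fun a P => by simp [Algebra.smul_def] }

theorem slope_mem : (slope : Sec p 1) ∈ filOne p 0 := by
  rw [filOne, if_pos le_rfl]
  exact fun P => const_mem_rigid _

theorem evalAt_mem : (fun z => evalAt 1 z : Sec p 1) ∈ filOne p 1 := by
  rw [filOne, if_neg (by omega), if_pos rfl]
  refine ⟨fun P => evalQ_mem _, fun z => ?_⟩
  change evalQ (X : ℚ_[p][X]) z - z.val * evalQ (1 : ℚ_[p][X]) z = 0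
  simp [evalQ]

theorem map_poly_one (P : Poly p 1) (z : Hp p) :
    (P : ℚ_[p][X]).map (algebraMap ℚ_[p] ℂ_[p]) =
      C (slope z P) * (X - C z.val) + C (evalAt 1 z P) := by
  have h := eq_X_add_C_of_natDegree_le_one (natDegree_le_of_mem P)
  have h1 : slope z P = algebraMap ℚ_[p] ℂ_[p] ((P : ℚ_[p][X]).coeff 1) := rfl
  have h2 : evalAt 1 z P = algebraMap ℚ_[p] ℂ_[p] ((P : ℚ_[p][X]).coeff 1) * z.val +
      algebraMap ℚ_[p] ℂ_[p] ((P : ℚ_[p][X]).coeff 0) := by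
    change (P : ℚ_[p][X]).eval₂ _ _ = _
    conv_lhs => rw [h]
    simp
  rw [h1, h2]
  conv_lhs => rw [h]
  simp only [Polynomial.map_add, Polynomial.map_mul, map_C, map_X, C_add, C_mul]
  ring

/-- The tensor `s_m ⊗ ℓ_1 ⊗ ⋯ ⊗ ℓ_n`, `m = |S|`, where `ℓ_i` is the slope if `i ∈ S` and evaluation
at `z` otherwise. -/
def tensorTerm (s : Sec p n) (S : Finset (Fin n)) : TensorSec p n := fun z =>
  comp S.card s z • (MultilinearMap.mkPiAlgebra ℚ_[p] (Fin n) ℂ_[p]).compLinearMap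
    fun i => if i ∈ S then slope z else evalAt 1 z

theorem tensorTerm_apply (s : Sec p n) (S : Finset (Fin n)) (z : Hp p) (P : Fin n → Poly p 1) :
    tensorTerm s S z P = comp S.card s z * ∏ i, (if i ∈ S then slope z else evalAt 1 z) (P i) := by
  simp [tensorTerm]

/-- Write every linear factor as P_i = P_i' (X - z) + P_i(z) and expand the product; the subset S
records where the slope is taken. -/
theorem toTensor_eq_sum (s : Sec p n) :
    toTensor p n s = ∑ S ∈ (Finset.univ : Finset (Fin n)).powerset, tensorTerm s S := by
  funext z
  ext P
  rw [Finset.sum_apply, sum_apply]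
  change s z (mulPoly p n P) = _
  rw [← extLin_map]
  have h : ((mulPoly p n P : Poly p n) : ℚ_[p][X]) = ∏ i, (P i : ℚ_[p][X]) := rfl
  rw [h, Polynomial.map_prod, Finset.prod_congr rfl fun i _ => map_poly_one (P i) z,
    Finset.prod_add, map_sum]
  refine Finset.sum_congr rfl fun S _ => ?_
  rw [tensorTerm_apply, Finset.prod_mul_distrib, Finset.prod_const, ← map_prod C, ← map_prod C,
    mul_right_comm, ← C_mul, extLin_C_mul, comp, mul_comm, ← Finset.prod_mul_prod_compl S,
    ← Finset.compl_eq_univ_sdiff]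
  congr 2
  · exact Finset.prod_congr rfl fun i hi => by rw [if_pos hi]
  · exact Finset.prod_congr rfl fun i hi => by rw [if_neg (Finset.mem_compl.1 hi)]

/-- Components are tensor components, which vanish in high filtration degree; conversely, in the
expansion over subsets S the term of S has degree n - |S|, because each evaluation factor lies in
F^1 and each slope in F^0. -/
theorem mem_fil_iff {s : Sec p n} {j : ℤ} :
    s ∈ fil p n j ↔ s ∈ anSec p n ∧ ∀ m ≤ n, (n : ℤ) - m < j → comp m s = 0 := by
  refine ⟨fun h => ⟨h.1, fun m hm hmj => ?_⟩, fun h => ⟨h.1, ?_⟩⟩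
  · obtain ⟨A, -, hA⟩ := Finset.exists_subset_card_eq
      (s := (Finset.univ : Finset (Fin n))) (n := m) (by simpa using hm)
    rw [← hA, ← tensorComp_toTensor]
    exact tensorComp_eq_zero h.2 (by rwa [hA])
  · change toTensor p n s ∈ filTensor p n j
    rw [toTensor_eq_sum]
    refine Submodule.sum_mem _ fun S _ => ?_
    have hSn : S.card ≤ n := (Finset.card_le_univ S).trans_eq (Fintype.card_fin n)
    by_cases hj : (n : ℤ) - S.card < j
    · have : tensorTerm s S = 0 := by
        funext z
        rw [tensorTerm, h.2 _ hSn hj, Pi.zero_apply, zero_smul]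
        rfl
      rw [this]
      exact Submodule.zero_mem _
    · refine Submodule.subset_span ⟨comp S.card s, comp_mem_rigid _ h.1,
        fun i => if i ∈ S then slope else fun z => evalAt 1 z, fun i => if i ∈ S then 0 else 1,
        ?_, fun i => ?_, fun z P => ?_⟩
      · have : ∀ i, (if i ∈ S then (0 : ℤ) else 1) = 1 - if i ∈ S then 1 else 0 := fun i => by
          split_ifs <;> rfl
        have h4 : ∑ i, (if i ∈ S then (0 : ℤ) else 1) = n - S.card := by
          simp [this, Finset.sum_sub_distrib]
        exact le_of_le_of_eq (by omega) h4.symm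
      · dsimp only
        split_ifs
        · exact slope_mem
        · exact evalAt_mem
      · rw [tensorTerm_apply]
        congr 1
        refine Finset.prod_congr rfl fun i _ => ?_
        dsimp only
        split_ifs <;> rfl

end Components

/-! ### Solving the connection -/

section Connection

variable {n : ℕ}

theorem deriv_mem_rigid {f : Hp p → ℂ_[p]} (hf : f ∈ rigid p) :
    (fun z : Hp p => deriv (extendZero f) z.val) ∈ rigid p ∧
      ∀ z : Hp p, HasDerivAt (extendZero f) (deriv (extendZero f) z.val) z.val := by
  obtain ⟨f', hf', h⟩ := exists_rigid_derivative hf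
  have e : (fun z : Hp p => deriv (extendZero f) z.val) = f' := funext fun z => (h z).deriv
  exact ⟨e ▸ hf', fun z => (h z).differentiableAt.hasDerivAt⟩

theorem exists_isNabla {s : Sec p n} (hs : s ∈ anSec p n) : ∃ t, IsNabla s t := by
  have h : ∀ P : Poly p n, ∀ z : Hp p, HasDerivAt (extendZero fun w => s w P)
    (deriv (extendZero fun w => s w P) z.val) z.val := fun P => (deriv_mem_rigid (hs P)).2
  refine ⟨fun z => { toFun := fun P => deriv (extendZero fun w => s w P) z.val
                     map_add' := fun P Q => ?_
                     map_smul' := fun a P => ?_ }, h⟩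
  · have e : (fun w => s w (P + Q)) = (fun w => s w P) + fun w => s w Q :=
      funext fun w => map_add _ _ _
    rw [e, extendZero_add]
    exact ((h P z).add (h Q z)).deriv
  · have e : (fun w => s w (a • P)) = fun w => algebraMap ℚ_[p] ℂ_[p] a * s w P :=
      funext fun w => by rw [map_smul, Algebra.smul_def]
    rw [e, extendZero_mul fun _ => algebraMap ℚ_[p] ℂ_[p] a, RingHom.id_apply, Algebra.smul_def]
    exact ((h P z).const_mul _).deriv

theorem IsNabla.eq_zero {t : Sec p n} (h : IsNabla 0 t) : t = 0 := by
  funext z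
  ext P
  exact (h P z).unique (isNabla_zero P z)

/-- A section without top component, whose derivative lies in the last step of the filtration,
vanishes. -/
theorem IsNabla.eq_zero_of_comp {s t : Sec p n} (h : IsNabla s t) (hs : comp n s = 0)
    (ht : ∀ m ≤ n, m ≠ 0 → comp m t = 0) : s = 0 := by
  -- Descending from m = n: if s_m = 0 and t_m = 0 with m ≥ 1, then the derivative formula leaves m
  -- s_{m-1} = 0.
  have key : ∀ l ≤ n, comp (n - l) s = 0 := by
    intro l
    induction l with
    | zero => intro _; exact hs
    | succ l ih =>
      intro hl
      funext z
      have h1 := h.hasDerivAt_comp (n - l) z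
      rw [ih (by omega), ht _ (by omega) (by omega), extendZero_zero, Pi.zero_apply, zero_sub] at h1
      have h2 := h1.unique (hasDerivAt_const z.val (0 : ℂ_[p]))
      rw [neg_eq_zero, mul_eq_zero] at h2
      rw [Nat.sub_add_eq]
      exact h2.resolve_left (Nat.cast_ne_zero.2 (by omega))
  refine eq_zero_of_comp_eq_zero fun m hm => ?_
  have := key (n - m) (by omega)
  rwa [Nat.sub_sub_self hm] at this

/-- The components, from the top one downwards, of a section whose derivative agrees with `ω` up to
the last step of the filtration. -/
def primitiveComp (ω : Sec p n) : ℕ → Hp p → ℂ_[p]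
  | 0 => 0
  -- Solves s_m' + m s_{m-1} = ω_m for s_{m-1}, with m = n - l; the index l counts from the top
  -- component.
  | l + 1 => fun z => ((n - l : ℕ) : ℂ_[p])⁻¹ *
      (comp (n - l) ω z - deriv (extendZero (primitiveComp ω l)) z.val)

theorem primitiveComp_mem {ω : Sec p n} (hω : ω ∈ anSec p n) (l : ℕ) :
    primitiveComp ω l ∈ rigid p := by
  induction l with
  | zero => exact zero_mem _
  | succ l ih =>
    have h := const_mem_rigid (p := p) (((n - l : ℕ) : ℚ_[p])⁻¹)
    rw [map_inv₀, map_natCast] at h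
    exact mul_mem h (sub_mem (comp_mem_rigid _ hω) (deriv_mem_rigid ih).1)

/-- The components m ≥ 1 of the equation ∇s = ω determine the next lower component of s
algebraically; only the component m = 0 would require an integration, and it is left free. -/
theorem exists_primitive {ω : Sec p n} (hω : ω ∈ anSec p n) : ∃ s ∈ anSec p n, ∃ t,
    IsNabla s t ∧ comp n s = 0 ∧ ∀ m ≤ n, m ≠ 0 → comp m t = comp m ω := by
  have hc := primitiveComp_mem hω
  have hs : ofComp n (fun m => primitiveComp ω (n - m)) ∈ anSec p n := ofComp_mem fun m => hc _
  obtain ⟨t, ht⟩ := exists_isNabla hs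
  refine ⟨_, hs, t, ht, ?_, fun m hm hm0 => funext fun z => ?_⟩
  · rw [comp_ofComp _ le_rfl, Nat.sub_self]
    rfl
  · have h1 := ht.hasDerivAt_comp m z
    rw [comp_ofComp _ hm, comp_ofComp _ (by omega)] at h1
    have h2 := h1.deriv
    obtain ⟨l, rfl⟩ : ∃ l, m = n - l := ⟨n - m, by omega⟩
    have h3 : n - (n - l - 1) = (n - (n - l)) + 1 := by omega
    have h4 : n - (n - (n - l)) = n - l := by omega
    have h5 : ((n - l : ℕ) : ℂ_[p]) ≠ 0 := Nat.cast_ne_zero.2 hm0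
    rw [h3, primitiveComp, h4, mul_inv_cancel_left₀ h5] at h2
    linear_combination -h2

end Connection

/-! ### The Hodge filtration on cohomology -/

section Hodge

variable {n : ℕ} {Γ : Subgroup SL(2, ℚ_[p])} {Γ' : Subgroup Γ}

/-! ### The action of Γ on cochains and coboundaries -/

theorem eq_of_evalQ_eq {P Q : ℚ_[p][X]} (h : ∀ z : Hp p, evalQ P z = evalQ Q z) : P = Q := by
  refine map_injective _ (algebraMap ℚ_[p] ℂ_[p]).injective (sub_eq_zero.1 ?_)
  by_contra h0
  classical
  obtain ⟨z, -, hz⟩ := exists_generic_vertex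
    ((P.map (algebraMap ℚ_[p] ℂ_[p]) - Q.map (algebraMap ℚ_[p] ℂ_[p])).roots.toFinset) 0 0
  have h1 : z.val ∈ (P.map (algebraMap ℚ_[p] ℂ_[p]) - Q.map (algebraMap ℚ_[p] ℂ_[p])).roots := by
    rw [mem_roots h0, IsRoot, eval_sub, eval_map, eval_map, sub_eq_zero]
    exact h z
  have h2 := hz _ (Multiset.mem_toFinset.2 h1)
  rw [sub_self, norm_zero] at h2
  exact ((prime_zpow_pos (p := p) 0).trans_le (le_max_left _ _)).ne h2

theorem polyAct_mul (γ δ : SL(2, ℚ_[p])) (P : Poly p n) :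
    polyAct n (γ * δ) P = polyAct n δ (polyAct n γ P) := by
  refine Subtype.ext (eq_of_evalQ_eq fun z => ?_)
  rw [evalQ_polyAct, evalQ_polyAct, evalQ_polyAct, denom_mul, mul_smul]
  ring

theorem secAct_mul (γ δ : SL(2, ℚ_[p])) (s : Sec p n) :
    secAct n (γ * δ) s = secAct n γ (secAct n δ s) := by
  funext z
  ext P
  change s ((γ * δ)⁻¹ • z) (polyAct n (γ * δ) P) =
    s (δ⁻¹ • γ⁻¹ • z) (polyAct n δ (polyAct n γ P))
  rw [polyAct_mul, mul_inv_rev, mul_smul]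

theorem cochainAct_sub [Γ'.Normal] (g : Γ) (x y : Cochain n Γ') :
    cochainAct n Γ' g (x - y) = cochainAct n Γ' g x - cochainAct n Γ' g y := by
  refine Prod.ext (funext fun γ => ?_) ?_ <;> simp [cochainAct]

/-- g carries the coboundary of s to that of g s, since g (g⁻¹ γ g) = γ g. -/
theorem cochainAct_mem_coboundaries [Γ'.Normal] (g : Γ) {x : Cochain n Γ'}
    (hx : x ∈ coboundaries n Γ') : cochainAct n Γ' g x ∈ coboundaries n Γ' := by
  obtain ⟨s, hs, h1, h2⟩ := hx
  refine ⟨secAct n (g : SL(2, ℚ_[p])) s, secAct_mem_anSec hs _, fun γ => ?_, h2.secAct _⟩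
  change secAct n (g : SL(2, ℚ_[p])) (x.1 (MulAut.conjNormal g⁻¹ γ)) = _
  rw [h1, map_sub, ← secAct_mul, ← secAct_mul]
  congr 3
  rw [MulAut.conjNormal_apply]
  simp [mul_assoc]

/-- The action on such forms is the weight n + 2 slash action on f: the n comes from V_n and the 2
from dz. -/
theorem formAct_omegaSec_eq (γ : SL(2, ℚ_[p])) (f : Hp p → ℂ_[p]) :
    formAct n γ (omegaSec n f) =
      omegaSec n fun z => (denom γ⁻¹ z ^ (n + 2))⁻¹ * f (γ⁻¹ • z) := by
  funext z
  ext P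
  change (denom γ⁻¹ z ^ 2)⁻¹ * (f (γ⁻¹ • z) * evalQ (polyAct n γ P : ℚ_[p][X]) (γ⁻¹ • z)) =
    (denom γ⁻¹ z ^ (n + 2))⁻¹ * f (γ⁻¹ • z) * evalQ (P : ℚ_[p][X]) z
  have h1 : denom γ (γ⁻¹ • z) = (denom γ⁻¹ z)⁻¹ := by
    refine eq_inv_of_mul_eq_one_left ?_
    rw [← denom_mul, mul_inv_cancel]
    simp [denom]
  rw [evalQ_polyAct, smul_inv_smul, h1, pow_add, mul_inv, inv_pow]
  ring

/-- A form in the last step of the filtration which is exact on `X_{Γ'}` vanishes. -/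
theorem eq_zero_of_omegaSec_mem_coboundaries [CompactSpace (SL(2, ℚ_[p]) ⧸ Γ)] [Γ'.FiniteIndex]
    (hn : n ≠ 0) {f : Hp p → ℂ_[p]} (h : ((0, omegaSec n f) : Cochain n Γ') ∈ coboundaries n Γ') :
    f = 0 := by
  obtain ⟨s, hs, h1, h2⟩ := h
  obtain ⟨N, hN⟩ := exists_affinoid_covering_of_finiteIndex Γ'
  have hinv : ∀ γ : Γ', secAct n ((γ : Γ) : SL(2, ℚ_[p])) s = s := fun γ =>
    sub_eq_zero.1 (h1 γ).symm
  -- The cochain part is zero, so s is invariant and its top component is a form of weight -n.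
  have htop : comp n s = 0 := by
    refine eq_zero_of_negative_weight (Γ := Set.range fun γ : Γ' => ((γ : Γ) : SL(2, ℚ_[p])))
      (N := N) (fun z => ?_) hn (comp_mem_rigid n hs) ?_
    · obtain ⟨γ, hγ⟩ := hN z
      exact ⟨_, ⟨γ, rfl⟩, hγ⟩
    · rintro _ ⟨γ, rfl⟩ z
      have := comp_secAct ((γ : Γ) : SL(2, ℚ_[p])) s z
      rw [hinv γ] at this
      exact this.symm
  have hs0 : s = 0 := h2.eq_zero_of_comp htop fun m hm hm0 => by
    rw [comp_omegaSec f hm, if_neg hm0]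
  rw [hs0] at h2
  have h3 := comp_omegaSec (n := n) f (Nat.zero_le n)
  rw [if_pos rfl, show omegaSec n f = 0 from h2.eq_zero] at h3
  rw [← h3]
  funext z
  simp [comp_apply]

/-- A cocycle whose components `c(γ)` lie in the first step of the filtration is cohomologous to a
form in the last step. -/
theorem exists_sub_omegaSec_mem_coboundaries {x : Cochain n Γ'} (hx : x ∈ cocycles n Γ')
    (htop : ∀ γ, comp n (x.1 γ) = 0) :
    ∃ f ∈ rigid p, x - (0, omegaSec n f) ∈ coboundaries n Γ' := by
  obtain ⟨s, hs, t, hst, hsn, ht⟩ := exists_primitive hx.2.1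
  have hω : ∀ m ≤ n, m ≠ 0 → comp m (x.2 - t) = 0 := fun m hm hm0 => by
    rw [comp_sub, ht m hm hm0, sub_self]
  have hωf := eq_omegaSec hω
  have htan : comp 0 t ∈ rigid p := by
    have e : comp 0 t = fun z => deriv (extendZero (comp 0 s)) z.val := by
      funext z
      rw [(hst.hasDerivAt_comp 0 z).deriv]
      simp
    rw [e]
    exact (deriv_mem_rigid (comp_mem_rigid 0 hs)).1
  refine ⟨comp 0 (x.2 - t), ?_, s, hs, fun γ => ?_, ?_⟩
  · rw [comp_sub]
    exact sub_mem (comp_mem_rigid 0 hx.2.1) htan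
  -- The difference c(γ) - (γs - s) has no top component, and its derivative lies in the last step
  -- because x.2 - t does; by uniqueness it vanishes.
  · have h1 := (hx.2.2.2 γ).sub ((hst.secAct ((γ : Γ) : SL(2, ℚ_[p]))).sub hst)
    have h2 : formAct n ((γ : Γ) : SL(2, ℚ_[p])) x.2 - x.2 -
        (formAct n ((γ : Γ) : SL(2, ℚ_[p])) t - t) =
        formAct n ((γ : Γ) : SL(2, ℚ_[p])) (x.2 - t) - (x.2 - t) := by
      rw [map_sub]
      abel
    rw [h2, hωf, formAct_omegaSec_eq] at h1
    have h3 := h1.eq_zero_of_comp ?_ ?_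
    · simpa [sub_eq_zero] using h3
    · rw [comp_sub, comp_sub, htop γ, hsn]
      have h4 : comp n (secAct n ((γ : Γ) : SL(2, ℚ_[p])) s) = 0 := by
        funext z
        have h5 := comp_secAct ((γ : Γ) : SL(2, ℚ_[p])) s (((γ : Γ) : SL(2, ℚ_[p]))⁻¹ • z)
        rw [smul_inv_smul, hsn, Pi.zero_apply, mul_eq_zero] at h5
        exact h5.resolve_left (pow_ne_zero _ (denom_ne_zero _ _))
      rw [h4]
      simp
    · intro m hm hm0
      rw [comp_sub, comp_omegaSec _ hm, comp_omegaSec _ hm, if_neg hm0, if_neg hm0, sub_zero]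
  · change IsNabla s (x.2 - omegaSec n (comp 0 (x.2 - t)))
    rw [← hωf, sub_sub_cancel]
    exact hst

/-! ### The steps of the Hodge filtration -/

theorem toH1Free_eq_iff {x y : cocycles n Γ'} : toH1Free n Γ' x = toH1Free n Γ' y ↔
    (x : Cochain n Γ') - y ∈ coboundaries n Γ' :=
  Submodule.Quotient.eq _

theorem omega_injective [Γ'.Normal] [CompactSpace (SL(2, ℚ_[p]) ⧸ Γ)] [Γ'.FiniteIndex]
    (hn : n ≠ 0) : Function.Injective (omega n Γ') := by
  rw [injective_iff_map_eq_zero]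
  intro f hf
  have h1 : toH1Free n Γ' ⟨(0, omegaSec n f), omega_cocycle Γ' f.2⟩ = toH1Free n Γ' 0 := by
    rw [map_zero]
    exact congrArg Subtype.val hf
  rw [toH1Free_eq_iff] at h1
  refine Subtype.ext (eq_zero_of_omegaSec_mem_coboundaries (Γ' := Γ') hn ?_)
  simpa using h1

theorem hodge_eq_top [Γ'.Normal] {i : ℤ} (hi : i ≤ 0) : hodge n Γ' i = ⊤ := by
  rw [eq_top_iff]
  rintro ⟨_, y, hy, rfl⟩ -
  refine ⟨y, ⟨fun γ _ => ?_, ?_⟩, rfl⟩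
  · exact mem_fil_iff.2 ⟨y.2.1 γ, fun m hm h => by omega⟩
  · exact mem_fil_iff.2 ⟨y.2.2.1, fun m hm h => by omega⟩

theorem hodge_eq_bot [Γ'.Normal] {i : ℤ} (hi : (n : ℤ) + 2 ≤ i) : hodge n Γ' i = ⊥ := by
  rw [eq_bot_iff]
  rintro ⟨_, hx⟩ ⟨y, hy, rfl⟩
  have h1 : (y : Cochain n Γ') = 0 := by
    refine Prod.ext (funext fun γ => ?_) ?_
    · exact eq_zero_of_comp_eq_zero fun m hm => (mem_fil_iff.1 (hy.1 γ trivial)).2 m hm (by omega)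
    · exact eq_zero_of_comp_eq_zero fun m hm => (mem_fil_iff.1 hy.2).2 m hm (by omega)
  rw [Submodule.mem_bot]
  apply Subtype.ext
  change toH1Free n Γ' y = 0
  rw [show y = 0 from Subtype.ext h1, map_zero]

theorem range_omega_le_hodge [Γ'.Normal] {i : ℤ} (hi : i ≤ n + 1) :
    LinearMap.range (omega n Γ') ≤ hodge n Γ' i := by
  rintro _ ⟨f, rfl⟩
  have h : ((0, omegaSec n f) : Cochain n Γ') ∈ filCochains n Γ' i := by
    refine ⟨fun γ _ => zero_mem _, mem_fil_iff.2 ⟨omegaSec_mem f.2.1, fun m hm h => ?_⟩⟩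
    rw [comp_omegaSec _ hm, if_neg (by omega)]
  have h2 : (⟨(0, omegaSec n f), omega_cocycle Γ' f.2⟩ : cocycles n Γ') ∈
      (filCochains n Γ' i).submoduleOf (cocycles n Γ') := h
  exact Submodule.mem_map_of_mem (f := toH1Free n Γ') h2

/-- For i ≥ 1 the class has a representative with c(γ) in F^1, hence one of the form (0, f ∂⁰ ⊗ dz).
Modularity of f under Γ, not only under Γ', comes from the invariance of the class. -/
theorem hodge_le_range_omega [Γ'.Normal] [CompactSpace (SL(2, ℚ_[p]) ⧸ Γ)] [Γ'.FiniteIndex]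
    (hn : n ≠ 0) {i : ℤ} (hi : 1 ≤ i) : hodge n Γ' i ≤ LinearMap.range (omega n Γ') := by
  rintro ⟨_, x, hx, rfl⟩ ⟨y, hy, hyx⟩
  rw [Submodule.subtype_apply, toH1Free_eq_iff] at hyx
  obtain ⟨f, hf, hyf⟩ := exists_sub_omegaSec_mem_coboundaries y.2
    fun γ => (mem_fil_iff.1 (hy.1 γ trivial)).2 n le_rfl (by omega)
  have hxf : (x : Cochain n Γ') - (0, omegaSec n f) ∈ coboundaries n Γ' := by
    have := sub_mem hyf hyx
    rwa [sub_sub_sub_cancel_left] at this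
  have hmod : f ∈ modularForms Γ (n + 2) := by
    refine ⟨hf, fun g hg z => ?_⟩
    have h1 := cochainAct_mem_coboundaries (⟨g, hg⟩ : Γ)⁻¹ hxf
    rw [cochainAct_sub] at h1
    have hxg : cochainAct n Γ' (⟨g, hg⟩ : Γ)⁻¹ x.1 - x.1 ∈ coboundaries n Γ' := hx.2 _
    -- As x and its translate both differ by coboundaries from the forms of f and of its slash
    -- translate by g, the form of the difference is exact, hence zero.
    have h2 := sub_mem (add_mem hxg hxf) h1
    have e : cochainAct n Γ' (⟨g, hg⟩ : Γ)⁻¹ x.1 - x.1 + (x.1 - (0, omegaSec n f)) -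
        (cochainAct n Γ' (⟨g, hg⟩ : Γ)⁻¹ x.1 - cochainAct n Γ' (⟨g, hg⟩ : Γ)⁻¹ (0, omegaSec n f)) =
        (0, omegaSec n ((fun z => (denom g z ^ (n + 2))⁻¹ * f (g • z)) - f)) := by
      have e2 : cochainAct n Γ' (⟨g, hg⟩ : Γ)⁻¹ (0, omegaSec n f) =
          (0, omegaSec n fun z => (denom g z ^ (n + 2))⁻¹ * f (g • z)) := by
        refine Prod.ext (funext fun γ => by simp [cochainAct]) ?_
        have := formAct_omegaSec_eq (n := n) g⁻¹ f
        rw [inv_inv] at this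
        exact this
      have e3 : ((0, omegaSec n ((fun z => (denom g z ^ (n + 2))⁻¹ * f (g • z)) - f)) :
          Cochain n Γ') = (0, omegaSec n fun z => (denom g z ^ (n + 2))⁻¹ * f (g • z)) -
            (0, omegaSec n f) := by
        rw [map_sub, Prod.mk_sub_mk, sub_zero]
      rw [e2, e3]
      abel
    rw [e] at h2
    have h3 := congrFun (eq_zero_of_omegaSec_mem_coboundaries hn h2) z
    have hd := pow_ne_zero (n + 2) (denom_ne_zero g z)
    rw [Pi.sub_apply, Pi.zero_apply, sub_eq_zero] at h3
    rw [← h3, mul_inv_cancel_left₀ hd]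
  refine ⟨⟨f, hmod⟩, Subtype.ext ?_⟩
  change toH1Free n Γ' ⟨(0, omegaSec n f), omega_cocycle Γ' hmod⟩ = toH1Free n Γ' x
  exact (toH1Free_eq_iff.2 hxf).symm

end Hodge

end PadicHodge

end

theorem proposition5 (p : ℕ) [Fact p.Prime] (Γ : Subgroup (Matrix.SpecialLinearGroup (Fin 2) ℚ_[p]))
    [DiscreteTopology Γ]
    [CompactSpace (Matrix.SpecialLinearGroup (Fin 2) ℚ_[p] ⧸ Γ)]
    (Γ' : Subgroup Γ) [Γ'.Normal] [Γ'.FiniteIndex] [IsFreeGroup Γ']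
    (n k : ℕ) (hk : 4 ≤ k) (hke : Even k) (hn : k = n + 2) :
    Function.Injective (PadicHodge.omega n Γ') ∧
    ∀ i : ℤ,
      (i ≤ 0 → PadicHodge.hodge n Γ' i = ⊤) ∧
      (1 ≤ i ∧ i ≤ (k : ℤ) - 1 →
        PadicHodge.hodge n Γ' i = LinearMap.range (PadicHodge.omega n Γ')) ∧
      ((k : ℤ) ≤ i → PadicHodge.hodge n Γ' i = ⊥) := by
  have hn0 : n ≠ 0 := by omega
  refine ⟨PadicHodge.omega_injective hn0, fun i => ⟨PadicHodge.hodge_eq_top, fun hi => ?_,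
    fun hi => PadicHodge.hodge_eq_bot (by omega)⟩⟩
  exact le_antisymm (PadicHodge.hodge_le_range_omega hn0 hi.1)
    (PadicHodge.range_omega_le_hodge (by omega))
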